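/- A palindrome is a string equal to its reversal. For strings $x$ and $y$ let $\mathsf{LPALCF}(x,y)$ be the length of a longest palindrome (possibly the empty string) that is a factor, i.e. a contiguous substring, of both $x$ and $y$. The maximal palindrome of $x$ with a given center (a position of $x$, or the gap between two consecutive positions) is the longest palindromic factor of $x$ with that center; it may be empty at a gap. Algorithm lPalcf, on input $x,y$: (1) compute all maximal palindromes of $x$ and of $y$; (2) collect, for odd lengths, for every position $i$ of $x$ (resp. $y$) the factor of $x$ (resp. $y$) from $i$ to the end of the maximal palindrome centered at $i$, and, for even lengths, for every gap between positions $i$ and $i+1$ the (possibly empty) factor from $i+1$ to the end of the maximal palindrome centered at that gap; (3) create a lexicographically sorted list of the collected odd-type factors of both strings, and one of the even-type factors; (4) compute the longest common prefixes of consecutive entries of each list; (5) let $\ell_{\rm odd}$ (resp. $\ell_{\rm even}$) be the maximal length of a longest common prefix of an entry from $x$ and an entry from $y$ in the odd (resp. even) list ($0$ if there is no such pair), and return $\max(2\ell_{\rm odd}-1,\ 2\ell_{\rm even})$. Theorem. For all strings $x$ and $y$, every execution of lPalcf (that is, for every order of equal strings in the sorted lists) returns $\mathsf{LPALCF}(x,y)$.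 Moreover, on inputs over the alphabet $\Sigma=\{1,\ldots,(|x|+|y|)^{\mathcal O(1)}\}$ the algorithm runs in time $\mathcal{O}(|x|+|y|)$ on the word RAM. Precisely: there is a single word RAM program such that for every $c\in\mathbb N$ there are constants $K,C$, depending only on $c$, such that for all strings $x,y$ over $\{1,\ldots,(|x|+|y|)^c\}$ and every word size $w\ge K\log_2(|x|+|y|+2)$ the program, started with $x$ and $y$ in its otherwise zero memory, carries out an execution of lPalcf, producing in memory the results of steps (1) to (4) in this order, and halts with $\mathsf{LPALCF}(x,y)$ after at most $C(|x|+|y|+1)$ unit-cost instructions (loads and stores, jumps, comparisons, and arithmetic modulo $2^w$ including integer division and remainder). -/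

import Mathlib

namespace Palcf

/-! ## Strings, palindromes, maximal palindromes -/

/-- The factor of `x` that starts at position `i` (counted from `0`) and has length `len`. -/
def factor (x : List ℕ) (i len : ℕ) : List ℕ := (x.drop i).take len

/-- A palindrome is a string that equals its reversal. -/
def IsPal (p : List ℕ) : Prop := p.reverse = p

instance (p : List ℕ) : Decidable (IsPal p) := inferInstanceAs (Decidable (p.reverse = p))

/-- `x` and `y` are strings on the alphabet `{1, …, (|x| + |y|) ^ c}`. -/
def OverPolyAlphabet (c : ℕ) (x y : List ℕ) : Prop :=
  ∀ a ∈ x ++ y, 1 ≤ a ∧ a ≤ (x.length + y.length) ^ c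

/-- `m` is the length of a longest palindrome that is a factor of both `x` and `y`
(the empty string is a palindrome and a factor of every string). -/
def IsLPALCF (x y : List ℕ) (m : ℕ) : Prop :=
  IsGreatest {l : ℕ | ∃ p : List ℕ, p <:+: x ∧ p <:+: y ∧ IsPal p ∧ p.length = l} m

/-- There is a palindromic factor of `x` of length `len` with center `k / 2`. A factor that starts
at `i` and has length `len` ends at `j = i + len - 1`, so `i + j = k` reads `2 * i + len = k + 1`.
An odd `k` is the center of palindromes of even length, among them the empty one. -/
def PalAt (x : List ℕ) (k len : ℕ) : Prop :=
  ∃ i ≤ k + 1, 2 * i + len = k + 1 ∧ i + len ≤ x.length ∧ IsPal (factor x i len)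

instance (x : List ℕ) (k : ℕ) : DecidablePred (PalAt x k) := fun len =>
  inferInstanceAs (Decidable
    (∃ i ≤ k + 1, 2 * i + len = k + 1 ∧ i + len ≤ x.length ∧ IsPal (factor x i len)))

/-- The length (twice the radius) of the maximal palindrome of `x` with center `k / 2`,
for `k < 2 * |x| - 1`. -/
def maxPalLen (x : List ℕ) (k : ℕ) : ℕ := Nat.findGreatest (PalAt x k) x.length

/-! ## The algorithm: the results of its five steps -/

/-- A factor of one of the two input strings, given by its position:
`src = 0` for `x` and `src = 1` for `y`. -/
structure Piece where
  src : ℕ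
  start : ℕ
  len : ℕ

/-- The string that a piece denotes. -/
def Piece.str (x y : List ℕ) (f : Piece) : List ℕ :=
  factor (if f.src = 0 then x else y) f.start f.len

/-- Length of the longest common prefix. -/
def lcp : List ℕ → List ℕ → ℕ
  | a :: u, b :: v => if a = b then lcp u v + 1 else 0
  | _, _ => 0

/-- Step 1: the lengths of the `2 * |x| - 1` maximal palindromes of `x`, in the order of their
centers `0, 1/2, 1, …, |x| - 1`. -/
def maxPals (x : List ℕ) : List ℕ := (List.range (2 * x.length - 1)).map (maxPalLen x)

/-- Step 2, odd lengths: from each center `i` to the end of the maximal palindrome of odd length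
that is centered at `i`. -/
def oddPieces (src : ℕ) (x : List ℕ) : List Piece :=
  (List.range x.length).map fun i => ⟨src, i, (maxPalLen x (2 * i) + 1) / 2⟩

/-- Step 2, even lengths: from position `i + 1` to the end of the (possibly empty) maximal
palindrome of even length that is centered between positions `i` and `i + 1`. -/
def evenPieces (src : ℕ) (x : List ℕ) : List Piece :=
  (List.range (x.length - 1)).map fun i => ⟨src, i + 1, maxPalLen x (2 * i + 1) / 2⟩

/-- Step 3: `L` is a lexicographically sorted list of the collected factors. -/
def IsSortedListOf (x y : List ℕ) (L pieces : List Piece) : Prop :=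
  L.Perm pieces ∧ L.Pairwise fun f g => f.str x y ≤ g.str x y

/-- Step 4: longest common prefixes of consecutive entries. -/
def lcps (x y : List ℕ) (L : List Piece) : List ℕ :=
  List.zipWith (fun f g => lcp (f.str x y) (g.str x y)) L L.tail

/-- Step 5: the maximal length of the longest common prefixes between a string from `x` and a
string from `y` (`0` if there is no such pair). -/
def maxCrossLcp (x y : List ℕ) (L : List Piece) : ℕ :=
  ((L.filter fun f => f.src = 0).flatMap fun f =>
    (L.filter fun g => g.src = 1).map fun g => lcp (f.str x y) (g.str x y)).foldr max 0

/-- The data that the algorithm produces. -/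
structure Execution where
  palsX : List ℕ
  palsY : List ℕ
  oddF : List Piece
  evenF : List Piece
  oddL : List Piece
  evenL : List Piece
  oddLcps : List ℕ
  evenLcps : List ℕ
  result : ℕ

/-- `E` is an execution of the algorithm lPalcf on `x` and `y`. It is unique up to the order of
equal strings in the sorted lists. Natural subtraction only matters if no odd palindrome is common
to the two strings; the contribution of the odd lengths is then `0`. -/
structure Execution.IsLPalcf (x y : List ℕ) (E : Execution) : Prop where
  step1x : E.palsX = maxPals x
  step1y : E.palsY = maxPals y
  step2odd : E.oddF = oddPieces 0 x ++ oddPieces 1 y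
  step2even : E.evenF = evenPieces 0 x ++ evenPieces 1 y
  step3odd : IsSortedListOf x y E.oddL E.oddF
  step3even : IsSortedListOf x y E.evenL E.evenF
  step4odd : E.oddLcps = lcps x y E.oddL
  step4even : E.evenLcps = lcps x y E.evenL
  step5 : E.result = max (2 * maxCrossLcp x y E.oddL - 1) (2 * maxCrossLcp x y E.evenL)

/-! ## The word RAM with word size `w` -/

inductive BinOp
  | add | sub | mul | div | mod

/-- Arithmetic modulo `2 ^ w`; quotient and remainder of natural numbers. -/
def BinOp.eval (w : ℕ) : BinOp → ℕ → ℕ → ℕ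
  | .add, a, b => (a + b) % 2 ^ w
  | .sub, a, b => (a + (2 ^ w - b)) % 2 ^ w
  | .mul, a, b => (a * b) % 2 ^ w
  | .div, a, b => (a / b) % 2 ^ w
  | .mod, a, b => (a % b) % 2 ^ w

/-- Instructions. A program names finitely many registers; the memory is accessed through
addresses that are held in registers. -/
inductive Instr
  | const (d v : ℕ)               -- `R[d] := v`
  | move (d a : ℕ)                -- `R[d] := R[a]`
  | op (o : BinOp) (d a b : ℕ)    -- `R[d] := R[a] o R[b]`
  | load (d a : ℕ)                -- `R[d] := M[R[a]]`
  | store (a s : ℕ)               -- `M[R[a]] := R[s]`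
  | jump (t : ℕ)                  -- continue at instruction `t`
  | jumpLt (a b t : ℕ)            -- continue at instruction `t` if `R[a] < R[b]`
  | jumpEq (a b t : ℕ)            -- continue at instruction `t` if `R[a] = R[b]`

abbrev Program := List Instr

/-- Program counter, registers and memory. All words reached from an initial state whose words are
smaller than `2 ^ w` are smaller than `2 ^ w`, so only the `2 ^ w` first cells are in use. -/
structure State where
  pc : ℕ
  reg : ℕ → ℕ
  mem : ℕ → ℕ

/-- The effect of one instruction. -/
def Instr.exec (w : ℕ) (s : State) : Instr → State
  | .const d v => { s with pc := s.pc + 1, reg := Function.update s.reg d (v % 2 ^ w) }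
  | .move d a => { s with pc := s.pc + 1, reg := Function.update s.reg d (s.reg a) }
  | .op o d a b =>
      { s with pc := s.pc + 1, reg := Function.update s.reg d (o.eval w (s.reg a) (s.reg b)) }
  | .load d a => { s with pc := s.pc + 1, reg := Function.update s.reg d (s.mem (s.reg a)) }
  | .store a r => { s with pc := s.pc + 1, mem := Function.update s.mem (s.reg a) (s.reg r) }
  | .jump t => { s with pc := t }
  | .jumpLt a b t => { s with pc := if s.reg a < s.reg b then t else s.pc + 1 }
  | .jumpEq a b t => { s with pc := if s.reg a = s.reg b then t else s.pc + 1 }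

/-- One unit of time. The machine has halted, and stays put, once the program counter is outside
the program. -/
def step (w : ℕ) (P : Program) (s : State) : State :=
  match P[s.pc]? with
  | none => s
  | some ins => ins.exec w s

def Halted (P : Program) (s : State) : Prop := P.length ≤ s.pc

/-- Initially `R[0] = |x|`, `R[1] = |y|`, the memory starts with the letters of `x` followed by
those of `y`, and everything else is `0`. -/
def initState (x y : List ℕ) : State where
  pc := 0
  reg := fun r => if r = 0 then x.length else if r = 1 then y.length else 0
  mem := fun a => (x ++ y).getD a 0

/-- The state after `t` steps on input `x`, `y`. -/
def stateAt (w : ℕ) (P : Program) (x y : List ℕ) (t : ℕ) : State :=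
  (step w P)^[t] (initState x y)

/-- The memory holds the array `l` at the address in register `r`. -/
def State.HoldsArray (w : ℕ) (s : State) (r : ℕ) (l : List ℕ) : Prop :=
  s.reg r + l.length ≤ 2 ^ w ∧ ∀ i (h : i < l.length), s.mem (s.reg r + i) = l[i]

/-- Pieces are stored in three consecutive words each. -/
def encode (l : List Piece) : List ℕ := l.flatMap fun f => [f.src, f.start, f.len]

/-- On input `x`, `y` the program carries out the execution `E` within `T` steps: it passes, in
this order, through states that hold the results of steps 1 to 4 (the two arrays of each step at
the addresses in registers `0` and `1`), and it halts with the result in register `0`. -/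
def CarriesOut (w : ℕ) (P : Program) (x y : List ℕ) (E : Execution) (T : ℕ) : Prop :=
  ∃ t₁ t₂ t₃ t₄ t₅ : ℕ, t₁ ≤ t₂ ∧ t₂ ≤ t₃ ∧ t₃ ≤ t₄ ∧ t₄ ≤ t₅ ∧ t₅ ≤ T ∧
    ((stateAt w P x y t₁).HoldsArray w 0 E.palsX ∧
      (stateAt w P x y t₁).HoldsArray w 1 E.palsY) ∧
    ((stateAt w P x y t₂).HoldsArray w 0 (encode E.oddF) ∧
      (stateAt w P x y t₂).HoldsArray w 1 (encode E.evenF)) ∧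
    ((stateAt w P x y t₃).HoldsArray w 0 (encode E.oddL) ∧
      (stateAt w P x y t₃).HoldsArray w 1 (encode E.evenL)) ∧
    ((stateAt w P x y t₄).HoldsArray w 0 E.oddLcps ∧
      (stateAt w P x y t₄).HoldsArray w 1 E.evenLcps) ∧
    Halted P (stateAt w P x y t₅) ∧ (stateAt w P x y t₅).reg 0 = E.result

end Palcf

/-!
The algorithm is correct because a palindrome is determined by the parity of its length and its
second half, including the central letter. The second half of a palindromic factor of `x` is an
initial part of the half of the maximal palindrome of `x` with the same center (`exists_center`). So
a common palindrome gives a common prefix of two collected pieces, one from `x` and one from `y`,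
and two such pieces with a common prefix give a common palindrome (`exists_common_palindrome`).
Hence the maximal common prefixes of pieces of different strings in the two lists determine the
length of a longest common palindrome (`Execution.IsLPalcf.correct`).

For linear time, the program builds the palindromic tree of the text `0 x (A + 1) y (A + 2)`, where
`A` is the largest letter. A node is a palindrome, its parent is what remains without the first and
the last letter, and its suffix link is its longest proper palindromic suffix. As the memory is zero
at the start, and words suffice for addresses of polynomial size, the children are kept in a table
that is addressed directly by node and letter. The tree grows with the letters of the text: the
longest palindromic suffix is found by a search along suffix links, and the lengths of this suffix
and of its suffix link are a potential for the time (`Built`). Whenever the search leaves a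
palindrome, the maximal palindromes with centers up to that of the suffix link are known by
reflection, as in Manacher's algorithm (`PTree.MaxAt.mirror`). So each center gets the node of its
maximal palindrome.

In the tree, the path from the root to a node spells the second half of the palindrome of the node
(`PTree.Valid.half_eq`), so each collected piece is the string of a path, and the preorder of the
tree with children in the order of their letters is the lexicographic order of the pieces. The
children are ordered by radix sort in base `|x| + |y| + 8`; the letters are polynomial, so they have
a constant number of digits (`run_sortNodes`, `run_preorder`). The longest common prefix of a node
and its predecessor in preorder is one letter shorter than its own string (`NextInPreorder`), and in
a sorted list longest common prefixes are minima of those of neighbours (`lcp_of_sorted`). This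
gives the longest common prefixes of consecutive pieces while the pieces are listed (`run_emit`),
and shows that it suffices to look at consecutive pieces of different strings for the maximum
(`eq_maxCrossLcp`).

The program is written in a structured language `Cmd` with variables and arrays. Its semantics
counts the iterations of loops and has no execution if a word overflows or an array is left, so that
total correctness (`Cmd.Run`) is proved on natural numbers. The compiled program for the word RAM
simulates it, with at most as many steps as the number of instructions times the number of
iterations plus one (`Cmd.Exec.simulate`).
-/

set_option linter.constructorNameAsVariable false

namespace Palcf

/-! ### Longest common prefixes -/

/-- `lcp u v` is the largest `r` such that both strings have initial parts of length `r` and these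
agree. -/
theorem le_lcp_iff {u v : List ℕ} {r : ℕ} :
    r ≤ lcp u v ↔ r ≤ u.length ∧ r ≤ v.length ∧ u.take r = v.take r := by
  induction u generalizing v r with
  | nil =>
    simp only [lcp, List.length_nil]
    constructor
    · intro h
      obtain rfl : r = 0 := by omega
      simp
    · exact fun h => h.1
  | cons a u ih =>
    cases v with
    | nil =>
      simp only [lcp, List.length_nil]
      constructor
      · intro h
        obtain rfl : r = 0 := by omega
        simp
      · exact fun h => h.2.1
    | cons b v =>
      cases r with
      | zero => simp
      | succ r =>
        simp only [lcp, List.length_cons, List.take_succ_cons, List.cons.injEq,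
          Nat.add_le_add_iff_right]
        by_cases h : a = b
        · simp [h, ih]
        · simp [h]

theorem lcp_le_left (u v : List ℕ) : lcp u v ≤ u.length := (le_lcp_iff.1 le_rfl).1

theorem lcp_le_right (u v : List ℕ) : lcp u v ≤ v.length := (le_lcp_iff.1 le_rfl).2.1

theorem take_lcp (u v : List ℕ) : u.take (lcp u v) = v.take (lcp u v) := (le_lcp_iff.1 le_rfl).2.2

theorem lcp_comm (u v : List ℕ) : lcp u v = lcp v u := by
  have h : ∀ u v : List ℕ, lcp u v ≤ lcp v u := fun u v =>
    le_lcp_iff.2 ⟨lcp_le_right u v, lcp_le_left u v, (take_lcp u v).symm⟩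
  exact le_antisymm (h u v) (h v u)

theorem lcp_self (u : List ℕ) : lcp u u = u.length :=
  le_antisymm (lcp_le_left u u) (le_lcp_iff.2 ⟨le_rfl, le_rfl, rfl⟩)

/-- In lexicographic order, a string between two others has their common prefix. So the longest
common prefixes of neighbours in a sorted list determine those of all pairs, as minima. -/
theorem lcp_of_sorted {u v w : List ℕ} (h1 : u ≤ v) (h2 : v ≤ w) :
    lcp u w = min (lcp u v) (lcp v w) := by
  induction u generalizing v w with
  | nil => simp [lcp]
  | cons a u ih =>
    cases v with
    | nil => exact absurd h1 (not_le.2 (List.nil_lt_cons a u))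
    | cons b v =>
      cases w with
      | nil => exact absurd h2 (not_le.2 (List.nil_lt_cons b v))
      | cons c w =>
        rw [← not_lt] at h1 h2
        have h1' := mt List.cons_lt_cons_iff.2 h1
        have h2' := mt List.cons_lt_cons_iff.2 h2
        push Not at h1' h2'
        simp only [lcp]
        by_cases hac : a = c
        · subst hac
          obtain rfl : a = b := le_antisymm h1'.1 h2'.1
          simp [ih (h1'.2 rfl) (h2'.2 rfl)]
        · rw [if_neg hac]
          by_cases hab : a = b
          · subst hab; simp [hac]
          · simp [hab]

/-! ### Second halves of palindromes, and the result of an execution -/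

theorem le_foldr_max {l : List ℕ} {a : ℕ} (h : a ∈ l) : a ≤ l.foldr max 0 := by
  induction l with
  | nil => simp at h
  | cons b l ih =>
    rcases List.mem_cons.1 h with rfl | h
    · exact le_max_left _ _
    · exact (ih h).trans (le_max_right _ _)

theorem foldr_max_mem (l : List ℕ) : l.foldr max 0 = 0 ∨ l.foldr max 0 ∈ l := by
  induction l with
  | nil => simp
  | cons b l ih =>
    simp only [List.foldr_cons, List.mem_cons]
    rcases max_choice b (l.foldr max 0) with h | h <;> rw [h] <;> tauto

theorem le_maxCrossLcp {x y : List ℕ} {L : List Piece} {f g : Piece} (hf : f ∈ L) (hg : g ∈ L)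
    (h0 : f.src = 0) (h1 : g.src = 1) : lcp (f.str x y) (g.str x y) ≤ maxCrossLcp x y L := by
  apply le_foldr_max
  simp only [List.mem_flatMap, List.mem_filter, List.mem_map, decide_eq_true_eq]
  exact ⟨f, ⟨hf, h0⟩, g, ⟨hg, h1⟩, rfl⟩

theorem maxCrossLcp_attained {x y : List ℕ} {L : List Piece} (h : maxCrossLcp x y L ≠ 0) :
    ∃ f ∈ L, ∃ g ∈ L, f.src = 0 ∧ g.src = 1 ∧ lcp (f.str x y) (g.str x y) = maxCrossLcp x y L := by
  rcases foldr_max_mem (((L.filter fun f => f.src = 0).flatMap fun f =>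
    (L.filter fun g => g.src = 1).map fun g => lcp (f.str x y) (g.str x y))) with h0 | h0
  · exact absurd h0 h
  · simp only [List.mem_flatMap, List.mem_filter, List.mem_map, decide_eq_true_eq] at h0
    obtain ⟨f, ⟨hf, hf0⟩, g, ⟨hg, hg1⟩, he⟩ := h0
    exact ⟨f, hf, g, hg, hf0, hg1, he⟩

theorem length_factor {x : List ℕ} {i l : ℕ} (h : i + l ≤ x.length) :
    (factor x i l).length = l := by
  simp [factor]; omega

theorem getElem_factor {x : List ℕ} {i l t : ℕ} (h : t < (factor x i l).length) :
    (factor x i l)[t] = x.getD (i + t) 0 := by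
  have h' := h
  simp only [factor, List.length_take, List.length_drop, lt_min_iff] at h'
  simp only [factor, List.getElem_take, List.getElem_drop]
  rw [List.getD_eq_getElem _ _ (by omega)]

theorem isPal_iff {p : List ℕ} :
    IsPal p ↔ ∀ t, t < p.length → p.getD t 0 = p.getD (p.length - 1 - t) 0 := by
  rw [IsPal]
  constructor
  · intro h t ht
    rw [List.getD_eq_getElem _ _ ht, List.getD_eq_getElem _ _ (by omega)]
    conv_lhs => rw [List.getElem_of_eq h.symm ht, List.getElem_reverse]
  · intro h
    refine List.ext_getElem (by simp) fun t h1 h2 => ?_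
    rw [List.getElem_reverse]
    have := h t h2
    rw [List.getD_eq_getElem _ _ h2, List.getD_eq_getElem _ _ (by omega)] at this
    exact this.symm

/-- Comparison of each letter with its mirror image; positions are those of `x`. -/
theorem isPal_factor_iff {x : List ℕ} {i l : ℕ} (h : i + l ≤ x.length) :
    IsPal (factor x i l) ↔ ∀ t < l, x.getD (i + t) 0 = x.getD (i + l - 1 - t) 0 := by
  rw [isPal_iff, length_factor h]
  refine forall₂_congr fun t ht => ?_
  have hl := length_factor h
  rw [List.getD_eq_getElem _ _ (by omega), List.getD_eq_getElem _ _ (by omega), getElem_factor,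
    getElem_factor, show i + (l - 1 - t) = i + l - 1 - t by omega]

theorem factor_infix (x : List ℕ) (i l : ℕ) : factor x i l <:+: x :=
  (List.take_prefix _ _).isInfix.trans (List.drop_suffix _ _).isInfix

theorem exists_factor_of_infix {p x : List ℕ} (h : p <:+: x) :
    ∃ i, i + p.length ≤ x.length ∧ factor x i p.length = p := by
  obtain ⟨s, t, rfl⟩ := h
  exact ⟨s.length, by simp, by simp [factor]⟩

theorem drop_factor (x : List ℕ) (i l d : ℕ) :
    (factor x i l).drop d = factor x (i + d) (l - d) := by
  simp [factor, List.drop_take]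

theorem take_factor (x : List ℕ) (i l r : ℕ) (h : r ≤ l) :
    (factor x i l).take r = factor x i r := by
  simp [factor, List.take_take, Nat.min_eq_left h]

/-- A palindrome is determined by its length and its second half. -/
theorem IsPal.eq_of_drop_eq {p q : List ℕ} (hp : IsPal p) (hq : IsPal q)
    (hl : p.length = q.length) (h : p.drop (p.length / 2) = q.drop (q.length / 2)) : p = q := by
  have key : ∀ t, p.length / 2 ≤ t → t < p.length → p.getD t 0 = q.getD t 0 := by
    intro t h1 h2
    have := congrArg (fun l => l.getD (t - p.length / 2) 0) h
    simp only [List.getD_eq_getElem?_getD, List.getElem?_drop] at this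
    rw [← hl, Nat.add_sub_cancel' h1] at this
    simpa [List.getD_eq_getElem?_getD] using this
  refine List.ext_getElem hl fun t h1 h2 => ?_
  have hgoal : p.getD t 0 = q.getD t 0 := by
    rcases Nat.lt_or_ge t (p.length / 2) with h3 | h3
    · rw [isPal_iff.1 hp t h1, isPal_iff.1 hq t h2, ← hl]
      exact key _ (by omega) (by omega)
    · exact key t h3 h1
  rwa [List.getD_eq_getElem _ _ h1, List.getD_eq_getElem _ _ h2] at hgoal

/-- Cutting off `d` letters on both sides keeps the center. -/
theorem PalAt.shrink {x : List ℕ} {k l d : ℕ} (h : PalAt x k (l + 2 * d)) : PalAt x k l := by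
  obtain ⟨i, hi, he, hle, hp⟩ := h
  refine ⟨i + d, by omega, by omega, by omega, ?_⟩
  rw [isPal_factor_iff hle] at hp
  rw [isPal_factor_iff (by omega)]
  intro t ht
  have := hp (d + t) (by omega)
  rwa [← Nat.add_assoc, show i + (l + 2 * d) - 1 - (d + t) = i + d + l - 1 - t by omega] at this

theorem palAt_maxPalLen {x : List ℕ} {k : ℕ} (h : maxPalLen x k ≠ 0) :
    PalAt x k (maxPalLen x k) := Nat.findGreatest_of_ne_zero rfl h

theorem le_maxPalLen {x : List ℕ} {k l : ℕ} (h : PalAt x k l) : l ≤ maxPalLen x k := by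
  refine Nat.le_findGreatest ?_ h
  obtain ⟨i, _, _, h, _⟩ := h
  omega

/-- Two halves of maximal palindromes with centers of the same parity that share `r` letters yield a
common palindrome. -/
theorem exists_common_palindrome {x y : List ℕ} {k k' r : ℕ} (hr : 1 ≤ r)
    (hk : k % 2 = k' % 2) (hx : r ≤ (maxPalLen x k + 1) / 2) (hy : r ≤ (maxPalLen y k' + 1) / 2)
    (he : factor x ((k + 1) / 2) r = factor y ((k' + 1) / 2) r) :
    ∃ p, p <:+: x ∧ p <:+: y ∧ IsPal p ∧ p.length = 2 * r - 1 + k % 2 := by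
  have key : ∀ (z : List ℕ) (q : ℕ), r ≤ (maxPalLen z q + 1) / 2 →
      ∃ i, i + (2 * r - 1 + q % 2) ≤ z.length ∧ IsPal (factor z i (2 * r - 1 + q % 2)) ∧
        (factor z i (2 * r - 1 + q % 2)).drop ((2 * r - 1 + q % 2) / 2) =
          factor z ((q + 1) / 2) r := by
    intro z q hz
    have h := palAt_maxPalLen (show maxPalLen z q ≠ 0 by omega)
    have hpar : 2 * r - 1 + q % 2 ≤ maxPalLen z q ∧
        maxPalLen z q = 2 * r - 1 + q % 2 + 2 * ((maxPalLen z q - (2 * r - 1 + q % 2)) / 2) := by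
      obtain ⟨i, _, h2, _⟩ := h
      omega
    rw [hpar.2] at h
    obtain ⟨i, _, h2, h3, h4⟩ := h.shrink
    refine ⟨i, h3, h4, ?_⟩
    rw [drop_factor]
    congr 1 <;> omega
  obtain ⟨i, hi, hpi, hdi⟩ := key x k hx
  obtain ⟨j, hj, hpj, hdj⟩ := key y k' hy
  rw [← hk] at hj hpj hdj
  have : factor x i (2 * r - 1 + k % 2) = factor y j (2 * r - 1 + k % 2) := by
    refine hpi.eq_of_drop_eq hpj ?_ ?_
    · rw [length_factor hi, length_factor hj]
    · rw [length_factor hi, length_factor hj, hdi, hdj, he]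
  exact ⟨_, factor_infix x _ _, this ▸ factor_infix y _ _, hpi, length_factor hi⟩

/-- The second half of a palindromic factor is an initial part of the half of the maximal
palindrome with the same center. -/
theorem exists_center {x p : List ℕ} (h : p <:+: x) (hp : IsPal p) (h0 : 1 ≤ p.length) :
    ∃ k, k + 1 < 2 * x.length ∧ k % 2 = (p.length + 1) % 2 ∧
      (p.length + 1) / 2 ≤ (maxPalLen x k + 1) / 2 ∧
      factor x ((k + 1) / 2) ((p.length + 1) / 2) = p.drop (p.length / 2) := by
  obtain ⟨i, hi, he⟩ := exists_factor_of_infix h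
  have hpal : PalAt x (2 * i + p.length - 1) p.length :=
    ⟨i, by omega, by omega, hi, by rw [he]; exact hp⟩
  have := le_maxPalLen hpal
  refine ⟨2 * i + p.length - 1, by omega, by omega, by omega, ?_⟩
  have := congrArg (List.drop (p.length / 2)) he
  rw [← this, drop_factor]
  congr 1 <;> omega

theorem mem_oddPieces {src : ℕ} {x : List ℕ} {f : Piece} : f ∈ oddPieces src x ↔
    ∃ k, k % 2 = 0 ∧ k + 1 < 2 * x.length ∧
      f = ⟨src, (k + 1) / 2, (maxPalLen x k + 1) / 2⟩ := by
  simp only [oddPieces, List.mem_map, List.mem_range]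
  constructor
  · rintro ⟨i, hi, rfl⟩
    exact ⟨2 * i, by omega, by omega, by rw [show (2 * i + 1) / 2 = i by omega]⟩
  · rintro ⟨k, hk, hlt, rfl⟩
    exact ⟨k / 2, by omega, by rw [show 2 * (k / 2) = k by omega,
        show (k + 1) / 2 = k / 2 by omega]⟩

theorem maxPalLen_even {x : List ℕ} {k : ℕ} (hk : k % 2 = 1) : maxPalLen x k % 2 = 0 := by
  by_cases h : maxPalLen x k = 0
  · rw [h]
  · obtain ⟨i, _, h2, _⟩ := palAt_maxPalLen h
    omega

theorem mem_evenPieces {src : ℕ} {x : List ℕ} {f : Piece} : f ∈ evenPieces src x ↔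
    ∃ k, k % 2 = 1 ∧ k + 1 < 2 * x.length ∧
      f = ⟨src, (k + 1) / 2, (maxPalLen x k + 1) / 2⟩ := by
  simp only [evenPieces, List.mem_map, List.mem_range]
  constructor
  · rintro ⟨i, hi, rfl⟩
    have := maxPalLen_even (x := x) (k := 2 * i + 1) (by omega)
    exact ⟨2 * i + 1, by omega, by omega, by congr 1 <;> omega⟩
  · rintro ⟨k, hk, hlt, rfl⟩
    have := maxPalLen_even (x := x) hk
    refine ⟨k / 2, by omega, ?_⟩
    rw [show 2 * (k / 2) + 1 = k by omega]
    congr 1 <;> omega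

/-- A common palindrome is found by the pieces of its parity: its second half is a common initial
part of two of them. The list `L` consists of all pieces with centers of parity `b`. -/
theorem le_of_common {x y p : List ℕ} {L : List Piece} {b : ℕ} (hb : b = (p.length + 1) % 2)
    (hL : ∀ f : Piece, f ∈ L ↔
      (∃ k, k % 2 = b ∧ k + 1 < 2 * x.length ∧
        f = ⟨0, (k + 1) / 2, (maxPalLen x k + 1) / 2⟩) ∨
      (∃ k, k % 2 = b ∧ k + 1 < 2 * y.length ∧
        f = ⟨1, (k + 1) / 2, (maxPalLen y k + 1) / 2⟩))
    (hx : p <:+: x) (hy : p <:+: y) (hp : IsPal p) (h0 : 1 ≤ p.length) :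
    (p.length + 1) / 2 ≤ maxCrossLcp x y L := by
  obtain ⟨k, h1, h2, h3, h4⟩ := exists_center hx hp h0
  obtain ⟨k', h1', h2', h3', h4'⟩ := exists_center hy hp h0
  refine le_trans ?_ (le_maxCrossLcp (x := x) (y := y)
    ((hL _).2 (Or.inl ⟨k, by omega, h1, rfl⟩)) ((hL _).2 (Or.inr ⟨k', by omega, h1', rfl⟩)) rfl rfl)
  have hlen : (p.drop (p.length / 2)).length = (p.length + 1) / 2 := by simp; omega
  have e : ∀ (z : List ℕ) (i l : ℕ), (p.length + 1) / 2 ≤ l →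
      factor z i ((p.length + 1) / 2) = p.drop (p.length / 2) →
      (p.length + 1) / 2 ≤ (factor z i l).length ∧
      (factor z i l).take ((p.length + 1) / 2) = p.drop (p.length / 2) := by
    intro z i l hl he
    refine ⟨?_, by rw [take_factor _ _ _ _ hl, he]⟩
    have := congrArg List.length he
    rw [hlen, ← take_factor z i l _ hl, List.length_take] at this
    omega
  have ex := e x _ _ h3 h4
  have ey := e y _ _ h3' h4'
  refine le_lcp_iff.2 ⟨?_, ?_, ?_⟩
  · simpa [Piece.str] using ex.1
  · simpa [Piece.str] using ey.1
  · simpa [Piece.str] using ex.2.trans ey.2.symm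

/-- Conversely, the second half that two pieces of different strings share belongs to a common
palindrome. Its length is `2 * r - 1` or `2 * r`, according to the parity `b` of the centers. -/
theorem exists_of_maxCrossLcp {x y : List ℕ} {L : List Piece} {b : ℕ}
    (hL : ∀ f : Piece, f ∈ L ↔
      (∃ k, k % 2 = b ∧ k + 1 < 2 * x.length ∧
        f = ⟨0, (k + 1) / 2, (maxPalLen x k + 1) / 2⟩) ∨
      (∃ k, k % 2 = b ∧ k + 1 < 2 * y.length ∧
        f = ⟨1, (k + 1) / 2, (maxPalLen y k + 1) / 2⟩))
    (h : maxCrossLcp x y L ≠ 0) :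
    ∃ p, p <:+: x ∧ p <:+: y ∧ IsPal p ∧ p.length = 2 * maxCrossLcp x y L - 1 + b := by
  obtain ⟨f, hf, g, hg, hf0, hg1, he⟩ := maxCrossLcp_attained h
  rw [← he] at h ⊢
  rcases (hL f).1 hf with ⟨k, hk, -, rfl⟩ | ⟨k, -, -, rfl⟩
  swap
  · simp at hf0
  rcases (hL g).1 hg with ⟨k', -, -, rfl⟩ | ⟨k', hk', -, rfl⟩
  · simp at hg1
  have h1 := lcp_le_left (factor x ((k + 1) / 2) ((maxPalLen x k + 1) / 2))
    (factor y ((k' + 1) / 2) ((maxPalLen y k' + 1) / 2))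
  have h2 := lcp_le_right (factor x ((k + 1) / 2) ((maxPalLen x k + 1) / 2))
    (factor y ((k' + 1) / 2) ((maxPalLen y k' + 1) / 2))
  have h3 := take_lcp (factor x ((k + 1) / 2) ((maxPalLen x k + 1) / 2))
    (factor y ((k' + 1) / 2) ((maxPalLen y k' + 1) / 2))
  simp only [Piece.str] at h ⊢
  simp only [if_true, one_ne_zero, if_false] at h ⊢
  have hl : ∀ (z : List ℕ) (i l : ℕ), (factor z i l).length ≤ l := by
    intro z i l; simp [factor]
  have h4 := h1.trans (hl _ _ _)
  have h5 := h2.trans (hl _ _ _)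
  rw [take_factor _ _ _ _ h4, take_factor _ _ _ _ h5] at h3
  have := exists_common_palindrome (by omega) (by omega) h4 h5 h3
  rwa [hk] at this

/-- Odd palindromes have centers of even parity and are covered by the odd list, even ones by the
even list. The empty palindrome accounts for the lists in which no two pieces of different strings
share a letter. -/
theorem Execution.IsLPalcf.correct {x y : List ℕ} {E : Execution} (h : E.IsLPalcf x y) :
    IsLPALCF x y E.result := by
  have hodd : ∀ f : Piece, f ∈ E.oddL ↔
      (∃ k, k % 2 = 0 ∧ k + 1 < 2 * x.length ∧
        f = ⟨0, (k + 1) / 2, (maxPalLen x k + 1) / 2⟩) ∨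
      (∃ k, k % 2 = 0 ∧ k + 1 < 2 * y.length ∧
        f = ⟨1, (k + 1) / 2, (maxPalLen y k + 1) / 2⟩) := by
    intro f
    rw [h.step3odd.1.mem_iff, h.step2odd, List.mem_append, mem_oddPieces, mem_oddPieces]
  have heven : ∀ f : Piece, f ∈ E.evenL ↔
      (∃ k, k % 2 = 1 ∧ k + 1 < 2 * x.length ∧
        f = ⟨0, (k + 1) / 2, (maxPalLen x k + 1) / 2⟩) ∨
      (∃ k, k % 2 = 1 ∧ k + 1 < 2 * y.length ∧
        f = ⟨1, (k + 1) / 2, (maxPalLen y k + 1) / 2⟩) := by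
    intro f
    rw [h.step3even.1.mem_iff, h.step2even, List.mem_append, mem_evenPieces, mem_evenPieces]
  have hnil : ∃ p : List ℕ, p <:+: x ∧ p <:+: y ∧ IsPal p ∧ p.length = 0 :=
    ⟨[], List.nil_infix, List.nil_infix, rfl, rfl⟩
  rw [h.step5]
  refine ⟨?_, ?_⟩
  · rcases max_choice (2 * maxCrossLcp x y E.oddL - 1) (2 * maxCrossLcp x y E.evenL) with hm | hm
    · rw [hm]
      by_cases h0 : maxCrossLcp x y E.oddL = 0
      · simpa [h0] using hnil
      · exact exists_of_maxCrossLcp hodd h0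
    · rw [hm]
      by_cases h0 : maxCrossLcp x y E.evenL = 0
      · simpa [h0] using hnil
      · obtain ⟨p, h1, h2, h3, h4⟩ := exists_of_maxCrossLcp heven h0
        exact ⟨p, h1, h2, h3, by omega⟩
  · rintro l ⟨p, hx, hy, hp, rfl⟩
    rcases Nat.eq_zero_or_pos p.length with h0 | h0
    · omega
    · rcases Nat.mod_two_eq_zero_or_one p.length with hpar | hpar
      · have := le_of_common (by omega) heven hx hy hp h0
        omega
      · have := le_of_common (by omega) hodd hx hy hp h0
        omega

end Palcf


namespace Palcf

/-! ### A structured language with arrays, and its compilation to the word RAM -/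

/-- The variables of the program; each is kept in the register `Var.idx`. The variables `out0` and
`out1` are the registers `0` and `1`. -/
inductive Var
  | out0 | out1 | n | m | N | i | A | sg | B | M | R | a | cur | k | k2 | q | cnt | t | key
  | h | u | d | pw | p | v | pos | mm | bo | be
  deriving DecidableEq

/-- The arrays of the program; `inp` is the input `x ++ y`. -/
inductive Arr
  | inp | str | nd | lam | lnk | par | ltr | tab | palX | palY | oddF | evenF | nx | bk | pre | head
  | pnx | oddL | evenL | oddC | evenC
  deriving DecidableEq

/-- The register of a variable. -/
def Var.idx (v : Var) : ℕ := v.ctorIdx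

/-- Array `A` is stored from the cell `A.idx * M` on, where `M` is the common size of the arrays. -/
def Arr.idx (A : Arr) : ℕ := A.ctorIdx

theorem Var.idx_inj {a b : Var} (h : a.idx = b.idx) : a = b := by
  cases a <;> cases b <;> first | rfl | cases h

theorem Arr.idx_inj {a b : Arr} (h : a.idx = b.idx) : a = b := by
  cases a <;> cases b <;> first | rfl | cases h

/-- Registers from `32` on are free for intermediate values; the compiled code uses those from `40`
on. -/
theorem Var.idx_lt (a : Var) : a.idx < 32 := by cases a <;> decide

theorem Arr.idx_lt (a : Arr) : a.idx < 32 := by cases a <;> decide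

/-- A state of the structured language: variables, arrays, and a clock that counts loop
iterations. -/
structure Store where
  v : Var → ℕ
  a : Arr → ℕ → ℕ
  clk : ℕ

/-- The operation on natural numbers, with truncated subtraction. -/
def BinOp.nat : BinOp → ℕ → ℕ → ℕ
  | .add, a, b => a + b
  | .sub, a, b => a - b
  | .mul, a, b => a * b
  | .div, a, b => a / b
  | .mod, a, b => a % b

/-- The condition under which the machine operation agrees with the one on natural numbers. -/
def BinOp.side (W : ℕ) : BinOp → ℕ → ℕ → Prop
  | .add, a, b => a + b < W
  | .sub, a, b => b ≤ a
  | .mul, a, b => a * b < W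
  | .div, _, _ => True
  | .mod, _, _ => True

/-- Expressions of the structured language, whose values are natural numbers; `get A e` is the cell
`e` of the array `A`. -/
inductive Expr
  | lit (n : ℕ)
  | var (v : Var)
  | bin (o : BinOp) (e f : Expr)
  | get (A : Arr) (e : Expr)

namespace Expr

instance (n : ℕ) : OfNat Expr n := ⟨Expr.lit n⟩
instance : Add Expr := ⟨Expr.bin .add⟩
instance : Sub Expr := ⟨Expr.bin .sub⟩
instance : Mul Expr := ⟨Expr.bin .mul⟩
instance : Div Expr := ⟨Expr.bin .div⟩
instance : Mod Expr := ⟨Expr.bin .mod⟩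

def eval (s : Store) : Expr → ℕ
  | lit n => n
  | var v => s.v v
  | bin o e f => o.nat (e.eval s) (f.eval s)
  | get A e => s.a A (e.eval s)

/-- Evaluation does not overflow words below `W`, does not truncate a subtraction, and accesses the
arrays, each of `M` cells, within their bounds. The input array starts at address `0`, so it can
be read before the variable `M` has been set. -/
def ok (W M : ℕ) (s : Store) : Expr → Prop
  | lit n => n < W
  | var _ => True
  | bin o e f => e.ok W M s ∧ f.ok W M s ∧ o.side W (e.eval s) (f.eval s)
  | get A e => e.ok W M s ∧ (A = .inp ∨ s.v .M = M) ∧ e.eval s < M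

/-- Code that evaluates an expression into the register `t`, using the registers from `t` on. -/
def code : Expr → ℕ → List Instr
  | lit n, t => [.const t n]
  | var v, t => [.move t v.idx]
  | bin o e f, t => e.code t ++ (f.code (t + 1) ++ [.op o t t (t + 1)])
  | get A e, t => e.code t ++ [.const (t + 1) A.idx, .op .mul (t + 1) (t + 1) Var.M.idx,
      .op .add t t (t + 1), .load t t]

end Expr

/-- Conditions of branches and loops. -/
inductive Cond
  | lt (e f : Expr)
  | eq (e f : Expr)
  | ne (e f : Expr)

namespace Cond

def holds (s : Store) : Cond → Prop
  | lt e f => e.eval s < f.eval s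
  | eq e f => e.eval s = f.eval s
  | ne e f => e.eval s ≠ f.eval s

def ok (W M : ℕ) (s : Store) : Cond → Prop
  | lt e f => e.ok W M s ∧ f.ok W M s
  | eq e f => e.ok W M s ∧ f.ok W M s
  | ne e f => e.ok W M s ∧ f.ok W M s

def lhs : Cond → Expr
  | lt e _ => e
  | eq e _ => e
  | ne e _ => e

def rhs : Cond → Expr
  | lt _ f => f
  | eq _ f => f
  | ne _ f => f

/-- Conditional jump on the registers `40` and `41`: to `T` if the condition holds, else to `F`. -/
def branch (T F : ℕ) : Cond → List Instr
  | lt _ _ => [.jumpLt 40 41 T, .jump F]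
  | eq _ _ => [.jumpEq 40 41 T, .jump F]
  | ne _ _ => [.jumpEq 40 41 F, .jump T]

/-- Code at address `pos` that falls through if the condition holds and jumps to `F` if not. -/
def code (g : Cond) (pos F : ℕ) : List Instr :=
  (g.lhs.code 40 ++ g.rhs.code 41) ++
    g.branch (pos + (g.lhs.code 40 ++ g.rhs.code 41).length + 2) F

def size (g : Cond) : ℕ := (g.lhs.code 40 ++ g.rhs.code 41).length + 2

@[simp] theorem length_code (g : Cond) (pos F : ℕ) : (g.code pos F).length = g.size := by
  cases g <;> simp [code, size, branch, Nat.add_assoc]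

end Cond

/-- Commands: assignment to a variable or to a cell of an array, sequence, branch, and loop. -/
inductive Cmd
  | skip
  | set (v : Var) (e : Expr)
  | put (A : Arr) (i e : Expr)
  | seq (c d : Cmd)
  | ite (g : Cond) (c d : Cmd)
  | loop (g : Cond) (c : Cmd)

infixr:30 " ;; " => Cmd.seq

namespace Cmd

/-- The number of instructions of the compiled command, on which its addresses depend. -/
def size : Cmd → ℕ
  | skip => 0
  | set _ e => (e.code 40).length + 1
  | put _ i e => (i.code 40).length + (e.code 41).length + 4
  | seq c d => c.size + d.size
  | ite g c d => g.size + c.size + d.size + 1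
  | loop g c => g.size + c.size + 1

/-- Code of a command at address `pos`. -/
def code : Cmd → ℕ → List Instr
  | skip, _ => []
  | set v e, _ => e.code 40 ++ [.move v.idx 40]
  | put A i e, _ => i.code 40 ++ (e.code 41 ++ [.const 42 A.idx, .op .mul 42 42 Var.M.idx,
      .op .add 40 40 42, .store 40 41])
  | seq c d, pos => c.code pos ++ d.code (pos + c.size)
  | ite g c d, pos =>
      g.code pos (pos + g.size + c.size + 1) ++ (c.code (pos + g.size) ++
        (.jump (pos + g.size + c.size + d.size + 1) :: d.code (pos + g.size + c.size + 1)))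
  | loop g c, pos =>
      g.code pos (pos + g.size + c.size + 1) ++ (c.code (pos + g.size) ++ [.jump pos])

@[simp] theorem length_code (c : Cmd) : ∀ pos, (c.code pos).length = c.size := by
  induction c with
  | skip => simp [code, size]
  | set => simp [code, size]
  | put => intro; simp [code, size]; omega
  | seq c d hc hd => intro; simp [code, size, hc, hd]
  | ite g c d hc hd => intro; simp [code, size, hc, hd]; omega
  | loop g c hc => intro; simp [code, size, hc]; omega

/-- Big-step semantics for words below `W` and arrays of `M` cells. A command that would overflow or
leave the bounds of an array has no execution. -/
inductive Exec (W M : ℕ) : Cmd → Store → Store → Prop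
  | skip (s) : Exec W M skip s s
  | set {v e} (s : Store) : e.ok W M s →
      Exec W M (set v e) s { s with v := Function.update s.v v (e.eval s) }
  | put {A i e} (s : Store) : i.ok W M s → e.ok W M s → s.v .M = M → i.eval s < M →
      Exec W M (put A i e) s
        { s with a := Function.update s.a A (Function.update (s.a A) (i.eval s) (e.eval s)) }
  | seq {c d s s' s''} : Exec W M c s s' → Exec W M d s' s'' → Exec W M (seq c d) s s''
  | iteT {g c d s s'} : g.ok W M s → g.holds s → Exec W M c s s' → Exec W M (ite g c d) s s'
  | iteF {g c d s s'} : g.ok W M s → ¬ g.holds s → Exec W M d s s' → Exec W M (ite g c d) s s'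
  | loopF {g c} (s) : g.ok W M s → ¬ g.holds s → Exec W M (loop g c) s s
  | loopT {g c} {s s' s'' : Store} : g.ok W M s → g.holds s →
      Exec W M c { s with clk := s.clk + 1 } s' → Exec W M (loop g c) s' s'' →
      Exec W M (loop g c) s s''

end Cmd

/-! ### The compiled code simulates the structured program -/

/-- The machine state `st` represents `s`: array `A` occupies the cells from `A.idx * M` on. -/
structure Represents (w M : ℕ) (s : Store) (st : State) : Prop where
  reg : ∀ v : Var, st.reg v.idx = s.v v
  mem : ∀ (A : Arr) i, i < M → st.mem (A.idx * M + i) = s.a A i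
  vlt : ∀ v, s.v v < 2 ^ w
  alt : ∀ A i, i < M → s.a A i < 2 ^ w

/-- The program `P` contains the instructions `l` from address `pos` on. -/
def CodeAt (P : Program) (pos : ℕ) (l : List Instr) : Prop :=
  ∀ i (h : i < l.length), P[pos + i]? = some l[i]

theorem CodeAt.left {P pos l l'} (h : CodeAt P pos (l ++ l')) : CodeAt P pos l := by
  intro i hi
  rw [h i (by simp; omega), List.getElem_append_left hi]

theorem CodeAt.right {P pos l l'} (h : CodeAt P pos (l ++ l')) :
    CodeAt P (pos + l.length) l' := by
  intro i hi
  have := h (l.length + i) (by simp; omega)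
  rw [List.getElem_append_right (by omega)] at this
  simpa [Nat.add_assoc] using this

theorem CodeAt.head {P pos a l} (h : CodeAt P pos (a :: l)) : P[pos]? = some a := by
  have := h 0 (by simp)
  rwa [Nat.add_zero, List.getElem_cons_zero] at this

theorem CodeAt.tail {P pos a l} (h : CodeAt P pos (a :: l)) : CodeAt P (pos + 1) l := by
  intro i hi
  have := h (i + 1) (by simp; omega)
  simpa [Nat.add_assoc, Nat.add_comm 1 i] using this

theorem step_of_getElem {w : ℕ} {P : Program} {st : State} {ins}
    (h : P[st.pc]? = some ins) : step w P st = ins.exec w st := by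
  simp [step, h]

theorem Expr.eval_lt {w M : ℕ} {s : Store} {st : State} (hr : Represents w M s st) :
    ∀ e : Expr, e.ok (2 ^ w) M s → e.eval s < 2 ^ w
  | .lit n, h => h
  | .var v, _ => hr.vlt v
  | .get A e, h => hr.alt A _ h.2.2
  | .bin o e f, h => by
      have he := Expr.eval_lt hr e h.1
      have hf := Expr.eval_lt hr f h.2.1
      have hs := h.2.2
      cases o with
      | add => exact hs
      | sub => exact lt_of_le_of_lt (Nat.sub_le _ _) he
      | mul => exact hs
      | div => exact lt_of_le_of_lt (Nat.div_le_self _ _) he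
      | mod => exact lt_of_le_of_lt (Nat.mod_le _ _) he

theorem BinOp.eval_eq_nat {w a b : ℕ} (o : BinOp) (ha : a < 2 ^ w)
    (hs : o.side (2 ^ w) a b) : o.eval w a b = o.nat a b := by
  cases o with
  | add => exact Nat.mod_eq_of_lt hs
  | sub =>
    have hs : b ≤ a := hs
    show (a + (2 ^ w - b)) % 2 ^ w = a - b
    rw [show a + (2 ^ w - b) = (a - b) + 2 ^ w by omega, Nat.add_mod_right]
    exact Nat.mod_eq_of_lt (by omega)
  | mul => exact Nat.mod_eq_of_lt hs
  | div => exact Nat.mod_eq_of_lt (lt_of_le_of_lt (Nat.div_le_self _ _) ha)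
  | mod => exact Nat.mod_eq_of_lt (lt_of_le_of_lt (Nat.mod_le _ _) ha)

theorem Represents.congr {w M s st st'} (hr : Represents w M s st) (hm : st'.mem = st.mem)
    (hg : ∀ r < 40, st'.reg r = st.reg r) : Represents w M s st' :=
  ⟨fun v => by rw [hg _ (by have := v.idx_lt; omega), hr.reg], fun A i hi => by
    rw [hm, hr.mem A i hi], hr.vlt, hr.alt⟩

/-- The base address of an array, and the addresses in the array, are words. -/
theorem Arr.addr_lt {w M i : ℕ} (hM : 32 * M ≤ 2 ^ w) (A : Arr) (hi : i < M) :
    A.idx * M + i < 2 ^ w := by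
  have : A.idx * M + M ≤ 32 * M := by
    have := Nat.mul_le_mul_right M (A.idx_lt : A.idx + 1 ≤ 32)
    linarith
  omega

/-- Computing an address: the base `A.idx * M` is added to an offset. -/
theorem Represents.base {w M s st i} (hM : 32 * M ≤ 2 ^ w) (hr : Represents w M s st) (A : Arr)
    (hA : A = .inp ∨ s.v .M = M) (hi : i < M) :
    BinOp.eval w .add i (BinOp.eval w .mul (A.idx % 2 ^ w) (st.reg Var.M.idx)) =
      A.idx * M + i := by
  have h1 := A.addr_lt hM hi
  have h2 : A.idx < 2 ^ w := by have := A.idx_lt; omega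
  rw [Nat.mod_eq_of_lt h2, hr.reg]
  rcases hA with rfl | hA
  · have : Arr.inp.idx = 0 := rfl
    simp only [BinOp.eval, this, Nat.zero_mul, Nat.zero_mod, Nat.add_zero, Nat.zero_add] at *
    exact Nat.mod_eq_of_lt h1
  · simp only [BinOp.eval, hA]
    rw [Nat.mod_eq_of_lt (show A.idx * M < 2 ^ w by omega), Nat.mod_eq_of_lt (by omega)]
    omega

/-- The code of an expression leaves its value in the register `t`; it changes neither the memory
nor the registers below `t`. -/
theorem Expr.code_correct {w M : ℕ} {P : Program} {s : Store} (hM : 32 * M ≤ 2 ^ w) :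
    ∀ (e : Expr) (t : ℕ) (st : State), 40 ≤ t → Represents w M s st →
      CodeAt P st.pc (e.code t) → e.ok (2 ^ w) M s →
      ∃ st', (step w P)^[(e.code t).length] st = st' ∧ st'.pc = st.pc + (e.code t).length ∧
        st'.mem = st.mem ∧ st'.reg t = e.eval s ∧ ∀ r < t, st'.reg r = st.reg r
  | .lit n, t, st, ht, hr, hc, hok => by
      refine ⟨_, rfl, ?_⟩
      have := step_of_getElem (w := w) hc.head
      simp only [code, List.length_singleton, Function.iterate_one, this, Instr.exec]
      refine ⟨trivial, trivial, by simpa [eval] using Nat.mod_eq_of_lt hok, fun r hr => ?_⟩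
      simp [Function.update_of_ne (show r ≠ t by omega)]
  | .var v, t, st, ht, hr, hc, hok => by
      refine ⟨_, rfl, ?_⟩
      have := step_of_getElem (w := w) hc.head
      simp only [code, List.length_singleton, Function.iterate_one, this, Instr.exec]
      refine ⟨trivial, trivial, by simpa [eval] using hr.reg v, fun r hr => ?_⟩
      simp [Function.update_of_ne (show r ≠ t by omega)]
  | .bin o e f, t, st, ht, hr, hc, hok => by
      obtain ⟨st1, h1, hp1, hm1, ht1, hg1⟩ := code_correct hM e t st ht hr hc.left hok.1
      have hr1 := hr.congr hm1 (fun r h => hg1 r (by omega))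
      have hc2 := hc.right
      rw [← hp1] at hc2
      obtain ⟨st2, h2, hp2, hm2, ht2, hg2⟩ :=
        code_correct hM f (t + 1) st1 (by omega) hr1 hc2.left hok.2.1
      have hc3 := hc2.right
      rw [← hp2] at hc3
      have h3 := step_of_getElem (w := w) hc3.head
      refine ⟨step w P st2, ?_, ?_⟩
      · simp only [code, List.length_append, List.length_singleton]
        rw [show (e.code t).length + ((f.code (t + 1)).length + 1) =
          1 + ((f.code (t + 1)).length + (e.code t).length) by omega, Function.iterate_add_apply,
          Function.iterate_add_apply, h1, h2]
        rfl
      · simp only [h3, Instr.exec, code, List.length_append, List.length_singleton]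
        refine ⟨by omega, by rw [hm2, hm1], ?_, fun r hr => ?_⟩
        · rw [Function.update_self, ht2, hg2 t (by omega), ht1,
            BinOp.eval_eq_nat o (Expr.eval_lt hr1 e hok.1) hok.2.2]
          rfl
        · rw [Function.update_of_ne (by omega), hg2 r (by omega), hg1 r hr]
  | .get A e, t, st, ht, hr, hc, hok => by
      obtain ⟨st1, h1, hp1, hm1, ht1, hg1⟩ := code_correct hM e t st ht hr hc.left hok.1
      have hr1 := hr.congr hm1 (fun r h => hg1 r (by omega))
      have hc1 := hc.right
      rw [← hp1] at hc1
      have s1 := step_of_getElem (w := w) hc1.head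
      generalize hst2 : step w P st1 = st2 at s1
      have hp2 : st2.pc = st1.pc + 1 := by rw [s1]; rfl
      have hc2 := hc1.tail
      rw [← hp2] at hc2
      have s2 := step_of_getElem (w := w) hc2.head
      generalize hst3 : step w P st2 = st3 at s2
      have hp3 : st3.pc = st2.pc + 1 := by rw [s2]; rfl
      have hc3 := hc2.tail
      rw [← hp3] at hc3
      have s3 := step_of_getElem (w := w) hc3.head
      generalize hst4 : step w P st3 = st4 at s3
      have hp4 : st4.pc = st3.pc + 1 := by rw [s3]; rfl
      have hc4 := hc3.tail
      rw [← hp4] at hc4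
      have s4 := step_of_getElem (w := w) hc4.head
      have hidx : Var.M.idx ≠ t + 1 := by have := Var.M.idx_lt; omega
      have haddr := hr1.base hM A hok.2.1 hok.2.2
      have hreg : st4.reg t = A.idx * M + e.eval s := by
        rw [← haddr, s3]
        simp [Instr.exec, s2, s1, ht1, hidx]
      refine ⟨step w P st4, ?_, ?_⟩
      · simp only [code, List.length_append, List.length_cons, List.length_nil]
        rw [show (e.code t).length + (0 + 1 + 1 + 1 + 1) = 4 + (e.code t).length by omega,
          Function.iterate_add_apply, h1]
        simp [Function.iterate_succ, hst2, hst3, hst4]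
      · have hmem : st4.mem = st.mem := by rw [s3, s2, s1]; exact hm1
        simp only [s4, Instr.exec, code, List.length_append, List.length_cons, List.length_nil]
        refine ⟨by omega, hmem, ?_, fun r hr => ?_⟩
        · rw [Function.update_self, hreg, hmem, hr.mem A _ hok.2.2]
          rfl
        · rw [Function.update_of_ne (by omega), s3]
          simp only [Instr.exec]
          rw [Function.update_of_ne (by omega), s2]
          simp only [Instr.exec]
          rw [Function.update_of_ne (by omega), s1]
          simp only [Instr.exec]
          rw [Function.update_of_ne (by omega), hg1 r hr]

/-- The code of a condition takes at most as many steps as it has instructions, and changes no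
variable and no array. -/
theorem Cond.code_correct {w M : ℕ} {P : Program} {s : Store} (hM : 32 * M ≤ 2 ^ w) (g : Cond)
    (F pos : ℕ) (st : State) (hpos : st.pc = pos) (hr : Represents w M s st)
    (hc : CodeAt P pos (g.code pos F)) (hok : g.ok (2 ^ w) M s) :
    ∃ st' k, k ≤ g.size ∧ (step w P)^[k] st = st' ∧ Represents w M s st' ∧
      (g.holds s → st'.pc = pos + g.size) ∧ (¬ g.holds s → st'.pc = F) := by
  subst hpos
  have hok' : g.lhs.ok (2 ^ w) M s ∧ g.rhs.ok (2 ^ w) M s := by cases g <;> exact hok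
  obtain ⟨st1, h1, hp1, hm1, ht1, hg1⟩ :=
    g.lhs.code_correct hM 40 st le_rfl hr hc.left.left hok'.1
  have hr1 := hr.congr hm1 hg1
  have hc2 := hc.left.right
  rw [← hp1] at hc2
  obtain ⟨st2, h2, hp2, hm2, ht2, hg2⟩ :=
    g.rhs.code_correct hM 41 st1 (by omega) hr1 hc2 hok'.2
  have hr2 := hr1.congr hm2 (fun r h => hg2 r (by omega))
  have h40 : st2.reg 40 = g.lhs.eval s := by rw [hg2 40 (by omega), ht1]
  have h12 : (step w P)^[(g.rhs.code 41).length + (g.lhs.code 40).length] st = st2 := by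
    rw [Function.iterate_add_apply, h1, h2]
  have hc3 := hc.right
  rw [List.length_append, ← Nat.add_assoc, ← hp1, ← hp2] at hc3
  set T := st2.pc + 2 with hT
  have hT' : st.pc + g.size = T := by simp [Cond.size, hT]; omega
  -- the first instruction of the branch either jumps, or is followed by a jump to the other target
  have key : ∀ (ins : Instr) (T' F' : ℕ) (b : Prop) [Decidable b],
      CodeAt P st2.pc [ins, .jump F'] →
      ins.exec w st2 = { st2 with pc := if b then T' else st2.pc + 1 } →
      ∃ st' k, k ≤ g.size ∧ (step w P)^[k] st = st' ∧ Represents w M s st' ∧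
        (b → st'.pc = T') ∧ (¬ b → st'.pc = F') := by
    intro ins T' F' b _ hcode hexec
    have s3 := step_of_getElem (w := w) hcode.head
    rw [hexec] at s3
    by_cases hb : b
    · refine ⟨_, 1 + ((g.rhs.code 41).length + (g.lhs.code 40).length), ?_, rfl, ?_, ?_, ?_⟩
      · simp [Cond.size]; omega
      · rw [Function.iterate_add_apply, h12, Function.iterate_one, s3]
        exact hr2.congr rfl (fun _ _ => rfl)
      · intro _
        rw [Function.iterate_add_apply, h12, Function.iterate_one, s3]
        simp [hb]
      · exact fun h => absurd hb h
    · simp only [hb, if_false] at s3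
      have s4 : step w P (step w P st2) = { st2 with pc := F' } := by
        rw [s3]
        exact step_of_getElem (w := w) (st := { st2 with pc := st2.pc + 1 }) hcode.tail.head
      refine ⟨_, 2 + ((g.rhs.code 41).length + (g.lhs.code 40).length), ?_, rfl, ?_, ?_, ?_⟩
      · simp [Cond.size]; omega
      · rw [Function.iterate_add_apply, h12]
        simp only [Function.iterate_succ, Function.iterate_zero, Function.comp, id, s4]
        exact hr2.congr rfl (fun _ _ => rfl)
      · exact fun h => absurd h hb
      · intro _
        rw [Function.iterate_add_apply, h12]
        simp only [Function.iterate_succ, Function.iterate_zero, Function.comp, id, s4]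
  rw [hT']
  cases g with
  | lt e f =>
    exact key _ _ _ (e.eval s < f.eval s) hc3 (by simp [Instr.exec, h40, ht2, Cond.lhs, Cond.rhs])
  | eq e f =>
    exact key _ _ _ (e.eval s = f.eval s) hc3 (by simp [Instr.exec, h40, ht2, Cond.lhs, Cond.rhs])
  | ne e f =>
    obtain ⟨st', k, a, b, c, d, e'⟩ := key _ F T (e.eval s = f.eval s) hc3
      (by simp [Instr.exec, h40, ht2, Cond.lhs, Cond.rhs])
    exact ⟨st', k, a, b, c, fun h => e' h, fun h => d (by simpa [Cond.holds] using h)⟩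

theorem Cmd.Exec.clk_le {W M c s s'} (h : Cmd.Exec W M c s s') : s.clk ≤ s'.clk := by
  induction h with
  | skip | set | put | loopF => exact le_rfl
  | seq _ _ h1 h2 => exact h1.trans h2
  | iteT _ _ _ h => exact h
  | iteF _ _ _ h => exact h
  | loopT _ _ _ _ h1 h2 => exact le_trans (Nat.le_succ _) (h1.trans h2)

/-- The compiled code runs through the states of the structured program. Between two iterations
of loops the program counter only increases, so the number of steps is at most the size of the code
for each iteration, and once more. -/
theorem Cmd.Exec.simulate {w M : ℕ} {P : Program} {c : Cmd} {s s' : Store} (hM : 32 * M ≤ 2 ^ w)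
    (h : Cmd.Exec (2 ^ w) M c s s') : ∀ (pos : ℕ) (st : State), st.pc = pos →
    Represents w M s st → CodeAt P pos (c.code pos) →
    ∃ st' k, k ≤ c.size * (s'.clk - s.clk + 1) ∧ (step w P)^[k] st = st' ∧
      st'.pc = pos + c.size ∧ Represents w M s' st' := by
  induction h with
  | skip s =>
    intro pos st hp hr _
    exact ⟨st, 0, by simp, rfl, by simpa [Cmd.size] using hp, hr⟩
  | @set v e s hok =>
    intro pos st hp hr hc
    subst hp
    obtain ⟨st1, h1, hp1, hm1, ht1, hg1⟩ := e.code_correct hM 40 st le_rfl hr hc.left hok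
    have hr1 := hr.congr hm1 hg1
    have hc2 := hc.right
    rw [← hp1] at hc2
    have s2 := step_of_getElem (w := w) hc2.head
    refine ⟨_, 1 + (e.code 40).length, by simp [Cmd.size]; omega, rfl, ?_, ?_⟩
    · rw [Function.iterate_add_apply, h1, Function.iterate_one, s2]
      simp [Instr.exec, Cmd.size, hp1]; omega
    · rw [Function.iterate_add_apply, h1, Function.iterate_one, s2]
      refine ⟨fun v' => ?_, fun A i hi => ?_, fun v' => ?_, hr.alt⟩
      · by_cases hv : v' = v
        · subst hv; simp [Instr.exec, ht1]
        · simp [Instr.exec, hv, hr1.reg, show v'.idx ≠ v.idx from fun h => hv (Var.idx_inj h)]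
      · simpa [Instr.exec] using hr1.mem A i hi
      · by_cases hv : v' = v
        · subst hv; simpa using e.eval_lt hr hok
        · simpa [hv] using hr.vlt v'
  | @put A i e s hi he hM' hlt =>
    intro pos st hp hr hc
    subst hp
    obtain ⟨st1, h1, hp1, hm1, ht1, hg1⟩ := i.code_correct hM 40 st le_rfl hr hc.left hi
    have hr1 := hr.congr hm1 hg1
    have hc2 := hc.right
    rw [← hp1] at hc2
    obtain ⟨st2, h2, hp2, hm2, ht2, hg2⟩ := e.code_correct hM 41 st1 (by omega) hr1 hc2.left he
    have hr2 := hr1.congr hm2 (fun r h => hg2 r (by omega))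
    have hc3 := hc2.right
    rw [← hp2] at hc3
    have s3 := step_of_getElem (w := w) hc3.head
    generalize hst3 : step w P st2 = st3 at s3
    have hp3 : st3.pc = st2.pc + 1 := by rw [s3]; rfl
    have hc4 := hc3.tail
    rw [← hp3] at hc4
    have s4 := step_of_getElem (w := w) hc4.head
    generalize hst4 : step w P st3 = st4 at s4
    have hp4 : st4.pc = st3.pc + 1 := by rw [s4]; rfl
    have hc5 := hc4.tail
    rw [← hp4] at hc5
    have s5 := step_of_getElem (w := w) hc5.head
    generalize hst5 : step w P st4 = st5 at s5
    have hp5 : st5.pc = st4.pc + 1 := by rw [s5]; rfl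
    have hc6 := hc5.tail
    rw [← hp5] at hc6
    have s6 := step_of_getElem (w := w) hc6.head
    generalize hst6 : step w P st5 = st6 at s6
    have hidx : Var.M.idx ≠ 42 := by decide
    have haddr := hr2.base hM A (Or.inr hM') hlt
    have h40 : st5.reg 40 = A.idx * M + i.eval s := by
      rw [← haddr, s5]
      simp [Instr.exec, s4, s3, hidx, hg2 40 (by omega), ht1]
    have h41 : st5.reg 41 = e.eval s := by
      rw [← ht2, s5]; simp [Instr.exec, s4, s3]
    have hr5 : Represents w M s st5 := by
      refine hr2.congr (by rw [s5, s4, s3]; rfl) (fun r h => ?_)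
      rw [s5]; simp only [Instr.exec]
      rw [Function.update_of_ne (by omega), s4]; simp only [Instr.exec]
      rw [Function.update_of_ne (by omega), s3]; simp only [Instr.exec]
      rw [Function.update_of_ne (by omega)]
    refine ⟨st6, 4 + ((e.code 41).length + (i.code 40).length),
      by simp [Cmd.size]; omega, ?_, ?_, ?_⟩
    · rw [Function.iterate_add_apply, Function.iterate_add_apply, h1, h2]
      simp [Function.iterate_succ, hst3, hst4, hst5, hst6]
    · rw [s6]; simp [Instr.exec, Cmd.size]; omega
    · rw [s6]
      refine ⟨fun v' => by simpa [Instr.exec] using hr5.reg v', fun A' j hj => ?_, hr.vlt,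
        fun A' j hj => ?_⟩
      · simp only [Instr.exec, h40, h41]
        by_cases hA : A' = A
        · subst hA
          by_cases hji : j = i.eval s
          · subst hji; simp
          · rw [Function.update_of_ne (by omega), hr5.mem A' j hj]
            simp [hji]
        · have hne : A'.idx ≠ A.idx := fun h => hA (Arr.idx_inj h)
          have : A'.idx * M + j ≠ A.idx * M + i.eval s := by
            rcases Nat.lt_or_gt_of_ne hne with h | h
            · have := Nat.mul_le_mul_right M (show A'.idx + 1 ≤ A.idx from h)
              rw [Nat.add_mul] at this; omega
            · have := Nat.mul_le_mul_right M (show A.idx + 1 ≤ A'.idx from h)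
              rw [Nat.add_mul] at this; omega
          rw [Function.update_of_ne this, hr5.mem A' j hj]
          simp [hA]
      · by_cases hA : A' = A
        · subst hA
          by_cases hji : j = i.eval s
          · subst hji; simpa using e.eval_lt hr he
          · simpa [hji] using hr.alt A' j hj
        · simpa [hA] using hr.alt A' j hj
  | @seq c d s s1 s2 h1 h2 ih1 ih2 =>
    intro pos st hp hr hc
    obtain ⟨st1, k1, hk1, e1, hp1, hr1⟩ := ih1 pos st hp hr hc.left
    have hc2 := hc.right
    rw [Cmd.length_code] at hc2
    obtain ⟨st2, k2, hk2, e2, hp2, hr2⟩ := ih2 _ st1 hp1 hr1 hc2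
    refine ⟨st2, k2 + k1, ?_, by rw [Function.iterate_add_apply, e1, e2],
      by simp [Cmd.size, hp2, Nat.add_assoc], hr2⟩
    have c1 := h1.clk_le
    have c2 := h2.clk_le
    have : s2.clk - s.clk = (s1.clk - s.clk) + (s2.clk - s1.clk) := by omega
    rw [this, Cmd.size]
    nlinarith [Nat.zero_le (c.size * (s2.clk - s1.clk)), Nat.zero_le (d.size * (s1.clk - s.clk))]
  | @iteT g c d s s1 hok hg h1 ih1 =>
    intro pos st hp hr hc
    obtain ⟨st0, k0, hk0, e0, hr0, hpT, -⟩ := g.code_correct hM _ pos st hp hr hc.left hok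
    have hc1 := hc.right
    rw [Cond.length_code] at hc1
    obtain ⟨st1, k1, hk1, e1, hp1, hr1⟩ := ih1 _ st0 (hpT hg) hr0 hc1.left
    have hc2 := hc1.right
    rw [Cmd.length_code, ← hp1] at hc2
    have s2 := step_of_getElem (w := w) hc2.head
    refine ⟨step w P st1, 1 + (k1 + k0), ?_, ?_, ?_, ?_⟩
    · have c1 := h1.clk_le
      rw [Cmd.size]
      nlinarith [Nat.zero_le (g.size * (s1.clk - s.clk)), Nat.zero_le (d.size * (s1.clk - s.clk))]
    · rw [Function.iterate_add_apply, Function.iterate_add_apply, e0, e1]; rfl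
    · rw [s2]; simp [Instr.exec, Cmd.size]; omega
    · rw [s2]; exact hr1.congr rfl (fun _ _ => rfl)
  | @iteF g c d s s1 hok hg h1 ih1 =>
    intro pos st hp hr hc
    obtain ⟨st0, k0, hk0, e0, hr0, -, hpF⟩ := g.code_correct hM _ pos st hp hr hc.left hok
    have hc1 := hc.right
    rw [Cond.length_code] at hc1
    have hc2 := hc1.right.tail
    rw [Cmd.length_code] at hc2
    obtain ⟨st1, k1, hk1, e1, hp1, hr1⟩ := ih1 _ st0 (hpF hg) hr0 hc2
    refine ⟨st1, k1 + k0, ?_, ?_, ?_, hr1⟩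
    · rw [Cmd.size]
      nlinarith [Nat.zero_le (g.size * (s1.clk - s.clk)), Nat.zero_le (c.size * (s1.clk - s.clk))]
    · rw [Function.iterate_add_apply, e0, e1]
    · rw [hp1]; simp [Cmd.size]; omega
  | @loopF g c s hok hg =>
    intro pos st hp hr hc
    obtain ⟨st0, k0, hk0, e0, hr0, -, hpF⟩ := g.code_correct hM _ pos st hp hr hc.left hok
    exact ⟨st0, k0, by simp [Cmd.size]; omega, e0, by rw [hpF hg]; simp [Cmd.size]; omega, hr0⟩
  | @loopT g c s s1 s2 hok hg h1 h2 ih1 ih2 =>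
    intro pos st hp hr hc
    obtain ⟨st0, k0, hk0, e0, hr0, hpT, -⟩ := g.code_correct hM _ pos st hp hr hc.left hok
    have hc1 := hc.right
    rw [Cond.length_code] at hc1
    have hr0' : Represents w M { s with clk := s.clk + 1 } st0 :=
      ⟨hr0.reg, hr0.mem, hr0.vlt, hr0.alt⟩
    obtain ⟨st1, k1, hk1, e1, hp1, hr1⟩ := ih1 _ st0 (hpT hg) hr0' hc1.left
    have hc2 := hc1.right
    rw [Cmd.length_code, ← hp1] at hc2
    have s3 := step_of_getElem (w := w) hc2.head
    have hr3 : Represents w M s1 (step w P st1) := by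
      rw [s3]; exact hr1.congr rfl (fun _ _ => rfl)
    obtain ⟨st4, k4, hk4, e4, hp4, hr4⟩ := ih2 pos (step w P st1) (by rw [s3]; rfl) hr3 hc
    refine ⟨st4, k4 + (1 + (k1 + k0)), ?_, ?_, hp4, hr4⟩
    · have c1 : s.clk + 1 ≤ s1.clk := h1.clk_le
      have c2 := h2.clk_le
      have : s2.clk - s.clk = 1 + (s1.clk - (s.clk + 1)) + (s2.clk - s1.clk) := by omega
      rw [this]
      simp only [Cmd.size] at hk1 hk4 ⊢
      nlinarith [Nat.zero_le (g.size * (s1.clk - (s.clk + 1)))]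
    · rw [Function.iterate_add_apply, Function.iterate_add_apply, Function.iterate_add_apply, e0,
        e1, Function.iterate_one, e4]

end Palcf

namespace Palcf

/-! ### Total correctness of structured programs -/

namespace Cmd

/-- Whether a variable is assigned somewhere in the command. -/
def writesV : Cmd → Var → Bool
  | skip, _ => false
  | set x _, y => x = y
  | put _ _ _, _ => false
  | seq c d, y => c.writesV y || d.writesV y
  | ite _ c d, y => c.writesV y || d.writesV y
  | loop _ c, y => c.writesV y

/-- Whether an array is assigned somewhere in the command. -/
def writesA : Cmd → Arr → Bool
  | skip, _ => false
  | set _ _, _ => false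
  | put x _ _, y => x = y
  | seq c d, y => c.writesA y || d.writesA y
  | ite _ c d, y => c.writesA y || d.writesA y
  | loop _ c, y => c.writesA y

/-- `s'` differs from `s` at most in the variables and arrays that `c` assigns, and in the clock. -/
structure Frame (c : Cmd) (s s' : Store) : Prop where
  v : ∀ x, c.writesV x = false → s'.v x = s.v x
  a : ∀ x, c.writesA x = false → s'.a x = s.a x

theorem Frame.refl (c : Cmd) (s : Store) : Frame c s s := ⟨fun _ _ => rfl, fun _ _ => rfl⟩

theorem Frame.trans {c : Cmd} {s s' s''} (h : Frame c s s') (h' : Frame c s' s'') :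
    Frame c s s'' :=
  ⟨fun x hx => (h'.v x hx).trans (h.v x hx), fun x hx => (h'.a x hx).trans (h.a x hx)⟩

theorem Exec.frame {W M c s s'} (h : Exec W M c s s') : Frame c s s' := by
  induction h with
  | skip s => exact Frame.refl _ _
  | set s _ =>
    exact ⟨fun x hx => Function.update_of_ne (by simpa [writesV, eq_comm] using hx) _ _,
      fun _ _ => rfl⟩
  | put s _ _ _ _ =>
    exact ⟨fun _ _ => rfl,
      fun x hx => Function.update_of_ne (by simpa [writesA, eq_comm] using hx) _ _⟩
  | seq _ _ h1 h2 =>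
    constructor <;> intro x hx
    · simp only [writesV, Bool.or_eq_false_iff] at hx
      exact (h2.v x hx.2).trans (h1.v x hx.1)
    · simp only [writesA, Bool.or_eq_false_iff] at hx
      exact (h2.a x hx.2).trans (h1.a x hx.1)
  | iteT _ _ _ h =>
    constructor <;> intro x hx
    · simp only [writesV, Bool.or_eq_false_iff] at hx
      exact h.v x hx.1
    · simp only [writesA, Bool.or_eq_false_iff] at hx
      exact h.a x hx.1
  | iteF _ _ _ h =>
    constructor <;> intro x hx
    · simp only [writesV, Bool.or_eq_false_iff] at hx
      exact h.v x hx.2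
    · simp only [writesA, Bool.or_eq_false_iff] at hx
      exact h.a x hx.2
  | loopF s _ _ => exact Frame.refl _ _
  | loopT _ _ _ _ h1 h2 =>
    exact ⟨fun x hx => (h2.v x hx).trans (h1.v x hx), fun x hx => (h2.a x hx).trans (h1.a x hx)⟩

/-- Total correctness: started in `s`, the command `c` ends in a state that satisfies `Q`. -/
def Run (W M : ℕ) (c : Cmd) (s : Store) (Q : Store → Prop) : Prop :=
  ∃ s', Exec W M c s s' ∧ Q s'

variable {W M : ℕ}

theorem Run.mono {c : Cmd} {s Q Q'} (h : Run W M c s Q) (hQ : ∀ s', Q s' → Q' s') :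
    Run W M c s Q' :=
  let ⟨s', h, q⟩ := h; ⟨s', h, hQ s' q⟩

/-- The rule of consequence, where the new postcondition may also use that everything the command
does not assign is unchanged. -/
theorem Run.frame {c : Cmd} {s Q Q'} (h : Run W M c s Q)
    (hQ : ∀ s', Frame c s s' → s.clk ≤ s'.clk → Q s' → Q' s') :
    Run W M c s Q' :=
  let ⟨s', h, q⟩ := h; ⟨s', h, hQ s' h.frame h.clk_le q⟩

theorem run_skip {s Q} (h : Q s) : Run W M skip s Q := ⟨s, .skip s, h⟩

theorem run_set {x e s Q} (h : e.ok W M s)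
    (hQ : Q { s with v := Function.update s.v x (e.eval s) }) : Run W M (set x e) s Q :=
  ⟨_, .set s h, hQ⟩

theorem run_put {A i e s Q} (hi : i.ok W M s) (he : e.ok W M s) (hM : s.v .M = M)
    (hl : i.eval s < M) (hQ : Q { s with
      a := Function.update s.a A (Function.update (s.a A) (i.eval s) (e.eval s)) }) :
    Run W M (put A i e) s Q :=
  ⟨_, .put s hi he hM hl, hQ⟩

theorem run_seq {c d : Cmd} {s Q} (h : Run W M c s (fun s' => Run W M d s' Q)) :
    Run W M (seq c d) s Q :=
  let ⟨_, h1, s'', h2, q⟩ := h; ⟨s'', .seq h1 h2, q⟩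

theorem run_ite {g c d s Q} (hg : g.ok W M s) (hc : g.holds s → Run W M c s Q)
    (hd : ¬ g.holds s → Run W M d s Q) : Run W M (ite g c d) s Q := by
  by_cases h : g.holds s
  · obtain ⟨s', h1, q⟩ := hc h
    exact ⟨s', .iteT hg h h1, q⟩
  · obtain ⟨s', h1, q⟩ := hd h
    exact ⟨s', .iteF hg h h1, q⟩

/-- The rule for loops, with invariant `I` and variant `μ`. -/
theorem run_loop {g c s Q} (I : Store → Prop) (μ : Store → ℕ) (h0 : I s)
    (hI : ∀ s1, Frame c s s1 → I s1 → g.ok W M s1 ∧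
      (g.holds s1 → Run W M c { s1 with clk := s1.clk + 1 } (fun s2 => I s2 ∧ μ s2 < μ s1)) ∧
      (¬ g.holds s1 → Q s1)) : Run W M (loop g c) s Q := by
  have main : ∀ n s1, μ s1 < n → Frame c s s1 → I s1 → Run W M (loop g c) s1 Q := by
    intro n
    induction n with
    | zero => intro s1 h; omega
    | succ n ih =>
      intro s1 hn hf h1
      obtain ⟨hok, hT, hF⟩ := hI s1 hf h1
      by_cases hg : g.holds s1
      · obtain ⟨s2, he, h2, hlt⟩ := hT hg
        have hf' : Frame c s1 s2 := ⟨he.frame.v, he.frame.a⟩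
        obtain ⟨s3, he3, q⟩ := ih s2 (by omega) (hf.trans hf') h2
        exact ⟨s3, .loopT hok hg he he3, q⟩
      · exact ⟨s1, .loopF s1 hok hg, hF hg⟩
  exact main (μ s + 1) s (by omega) (Frame.refl _ _) h0

/-- The loop `for (x = lo; g; x = x + 1) c`. -/
def for_ (x : Var) (lo : Expr) (g : Cond) (c : Cmd) : Cmd :=
  set x lo ;; loop g (c ;; set x (.var x + 1))

/-- The rule for counting loops: the body leads from `I j` to `I (j + 1)`, for `a ≤ j < b`. The
guard only has to be equivalent to `x < b`, so that it may be written with expressions such as `x +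
1 < n`. -/
theorem run_for {x lo g c s} {Q : Store → Prop} (I : ℕ → Store → Prop) (a b : ℕ)
    (hx : c.writesV x = false) (hlo : lo.ok W M s) (hev : lo.eval s = a) (hab : a ≤ b)
    (hW : b < W) (h0 : I a { s with v := Function.update s.v x a })
    (hg : ∀ j s1, a ≤ j → j ≤ b → Frame (for_ x lo g c) s s1 → s1.v x = j → I j s1 →
      g.ok W M s1 ∧ (g.holds s1 ↔ j < b))
    (hI : ∀ j s1, a ≤ j → j < b → Frame (for_ x lo g c) s s1 → s1.v x = j → I j s1 →
      Run W M c { s1 with clk := s1.clk + 1 }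
        (fun s2 => I (j + 1) { s2 with v := Function.update s2.v x (j + 1) }))
    (hQ : ∀ s1, Frame (for_ x lo g c) s s1 → s1.v x = b → I b s1 → Q s1) :
    Run W M (for_ x lo g c) s Q := by
  have hfr : ∀ s1 s2, Frame (c ;; set x (.var x + 1)) s1 s2 →
      Frame (for_ x lo g c) s s1 → Frame (for_ x lo g c) s s2 := by
    intro s1 s2 h h1
    refine h1.trans ⟨fun y hy => h.v y ?_, fun y hy => h.a y ?_⟩
    · simp only [for_, writesV, Bool.or_eq_false_iff] at hy
      simp only [writesV, Bool.or_eq_false_iff]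
      exact hy.2
    · simp only [for_, writesA, Bool.or_eq_false_iff] at hy
      simp only [writesA, Bool.or_eq_false_iff]
      exact hy.2
  have h1 : Frame (for_ x lo g c) s { s with v := Function.update s.v x a } :=
    ⟨fun y hy => Function.update_of_ne (by
      simp only [for_, writesV, Bool.or_eq_false_iff, decide_eq_false_iff_not] at hy
      exact fun h => hy.1 h.symm) _ _, fun _ _ => rfl⟩
  refine run_seq (run_set hlo ?_)
  rw [hev]
  refine run_loop (fun s1 => a ≤ s1.v x ∧ s1.v x ≤ b ∧ I (s1.v x) s1) (fun s1 => b - s1.v x)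
    (by simpa using ⟨hab, h0⟩) ?_
  rintro s1 hf ⟨ha, hb, h⟩
  have hf1 := hfr _ _ hf h1
  obtain ⟨hok, hiff⟩ := hg _ s1 ha hb hf1 rfl h
  refine ⟨hok, fun hh => ?_, fun hh => ?_⟩
  · have hlt := hiff.1 hh
    refine run_seq ((hI _ s1 ha hlt hf1 rfl h).frame fun s2 hf2 _ h2 => ?_)
    have hxx : s2.v x = s1.v x := hf2.v x hx
    refine run_set ⟨trivial, show 1 < W by omega, ?_⟩ ?_
    · show s2.v x + 1 < W
      omega
    · have hev2 : (Expr.var x + 1 : Expr).eval s2 = s1.v x + 1 := by rw [← hxx]; rfl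
      rw [hev2]
      simp only [Function.update_self]
      exact ⟨⟨by omega, by omega, h2⟩, by omega⟩
  · have : s1.v x = b := by
      by_contra hne
      exact hh (hiff.2 (by omega))
    exact hQ s1 hf1 this (this ▸ h)

end Cmd

namespace Expr

variable {W M : ℕ} {s : Store} {e f : Expr}

@[simp] theorem eval_add : (e + f).eval s = e.eval s + f.eval s := rfl
@[simp] theorem eval_sub : (e - f).eval s = e.eval s - f.eval s := rfl
@[simp] theorem eval_mul : (e * f).eval s = e.eval s * f.eval s := rfl
@[simp] theorem eval_div : (e / f).eval s = e.eval s / f.eval s := rfl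
@[simp] theorem eval_mod : (e % f).eval s = e.eval s % f.eval s := rfl
@[simp] theorem eval_num {k : ℕ} : (no_index (OfNat.ofNat k) : Expr).eval s = k := rfl
@[simp] theorem ok_add : (e + f).ok W M s ↔ e.ok W M s ∧ f.ok W M s ∧ e.eval s + f.eval s < W :=
    Iff.rfl
@[simp] theorem ok_sub : (e - f).ok W M s ↔ e.ok W M s ∧ f.ok W M s ∧ f.eval s ≤ e.eval s := Iff.rfl
@[simp] theorem ok_mul : (e * f).ok W M s ↔ e.ok W M s ∧ f.ok W M s ∧ e.eval s * f.eval s < W :=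
    Iff.rfl
@[simp] theorem ok_div : (e / f).ok W M s ↔ e.ok W M s ∧ f.ok W M s ∧ True := Iff.rfl
@[simp] theorem ok_mod : (e % f).ok W M s ↔ e.ok W M s ∧ f.ok W M s ∧ True := Iff.rfl
@[simp] theorem ok_num {k : ℕ} : (no_index (OfNat.ofNat k) : Expr).ok W M s ↔ k < W := Iff.rfl

@[simp] theorem eval_lit {k : ℕ} : (lit k).eval s = k := rfl
@[simp] theorem eval_var {x : Var} : (var x).eval s = s.v x := rfl
@[simp] theorem eval_get {A : Arr} : (get A e).eval s = s.a A (e.eval s) := rfl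
@[simp] theorem ok_lit {k : ℕ} : (lit k).ok W M s ↔ k < W := Iff.rfl
@[simp] theorem ok_var {x : Var} : (var x).ok W M s ↔ True := Iff.rfl
@[simp] theorem ok_get {A : Arr} : (get A e).ok W M s ↔
    e.ok W M s ∧ (A = .inp ∨ s.v .M = M) ∧ e.eval s < M := Iff.rfl

end Expr

attribute [simp] Cond.holds Cond.ok

namespace Cmd

variable {W M : ℕ} {s : Store} {Q : Store → Prop}

@[simp] theorem run_skip_iff : Run W M skip s Q ↔ Q s :=
  ⟨fun ⟨_, h, q⟩ => by cases h; exact q, run_skip⟩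

@[simp] theorem run_set_iff {x e} : Run W M (set x e) s Q ↔
    e.ok W M s ∧ Q { s with v := Function.update s.v x (e.eval s) } :=
  ⟨fun ⟨_, h, q⟩ => by cases h with | set _ h => exact ⟨h, q⟩, fun h => run_set h.1 h.2⟩

@[simp] theorem run_put_iff {A i e} : Run W M (put A i e) s Q ↔
    i.ok W M s ∧ e.ok W M s ∧ s.v .M = M ∧ i.eval s < M ∧ Q { s with
      a := Function.update s.a A (Function.update (s.a A) (i.eval s) (e.eval s)) } :=
  ⟨fun ⟨_, h, q⟩ => by cases h with | put _ a b c d => exact ⟨a, b, c, d, q⟩,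
    fun h => run_put h.1 h.2.1 h.2.2.1 h.2.2.2.1 h.2.2.2.2⟩

@[simp] theorem run_seq_iff {c d : Cmd} :
    Run W M (seq c d) s Q ↔ Run W M c s (fun s' => Run W M d s' Q) :=
  ⟨fun ⟨_, h, q⟩ => by cases h with | seq a b => exact ⟨_, a, _, b, q⟩, run_seq⟩

@[simp] theorem run_ite_iff {g c d} : Run W M (ite g c d) s Q ↔
    g.ok W M s ∧ (g.holds s → Run W M c s Q) ∧ (¬ g.holds s → Run W M d s Q) := by
  refine ⟨fun ⟨_, h, q⟩ => ?_, fun h => run_ite h.1 h.2.1 h.2.2⟩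
  cases h with
  | iteT a b h => exact ⟨a, fun _ => ⟨_, h, q⟩, fun hn => absurd b hn⟩
  | iteF a b h => exact ⟨a, fun hn => absurd hn b, fun _ => ⟨_, h, q⟩⟩

end Cmd

end Palcf

namespace Palcf

/-! ### Palindromes in a sequence -/

/-- The factor of `S` of length `l - 1` that ends before position `j` is a palindrome, and it starts
at a position `≥ 1`. Position `0` holds a sentinel. The shift of the length by one gives a place to
the virtual palindrome of length `-1`, whose extension by one letter on both sides is a single
letter. -/
def Pl (S : ℕ → ℕ) (j l : ℕ) : Prop := l ≤ j ∧ ∀ t, t + 1 < l → S (j - 1 - t) = S (j + 1 - l + t)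

/-- The factors of length `l - 1` that end before positions `i` and `j` are equal. -/
def Same (S : ℕ → ℕ) (i j l : ℕ) : Prop := ∀ t, t + 1 < l → S (i - 1 - t) = S (j - 1 - t)

section
variable {S : ℕ → ℕ} {i j l l' R : ℕ}

theorem Same.symm (h : Same S i j l) : Same S j i l := fun t ht => (h t ht).symm

theorem Same.trans {k : ℕ} (h : Same S i j l) (h' : Same S j k l) : Same S i k l :=
  fun t ht => (h t ht).trans (h' t ht)

theorem Same.mono (h : Same S i j l) (hl : l' ≤ l) : Same S i j l' := fun t ht => h t (by omega)

theorem Same.pred (h : Same S i j (l + 1)) : Same S (i - 1) (j - 1) l := fun t ht => by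
  have := h (t + 1) (by omega)
  rwa [show i - 1 - (t + 1) = i - 1 - 1 - t by omega,
    show j - 1 - (t + 1) = j - 1 - 1 - t by omega] at this

theorem Pl.reflect (h : Pl S R l) {p : ℕ} (h1 : R - l < p) (h2 : p < R) :
    S p = S (2 * R - l - p) := by
  have hl := h.1
  have := h.2 (R - 1 - p) (by omega)
  rwa [show R - 1 - (R - 1 - p) = p by omega,
    show R + 1 - l + (R - 1 - p) = 2 * R - l - p by omega] at this

theorem Pl.of_reflect (hl : l ≤ R) (h : ∀ p, R - l < p → p < R → S p = S (2 * R - l - p)) :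
    Pl S R l := by
  refine ⟨hl, fun t ht => ?_⟩
  have := h (R - 1 - t) (by omega) (by omega)
  rwa [show 2 * R - l - (R - 1 - t) = R + 1 - l + t by omega] at this

theorem pl_zero : Pl S j 0 := ⟨by omega, fun t ht => by omega⟩

theorem pl_one (hj : 1 ≤ j) : Pl S j 1 := ⟨by omega, fun t ht => by omega⟩

/-- A palindrome extends by one letter on both sides if these letters agree and the left one is not
the sentinel at position `0`. -/
theorem pl_succ : Pl S (j + 1) (l + 2) ↔ Pl S j l ∧ l + 1 ≤ j ∧ S (j - l) = S j := by
  constructor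
  · intro h
    have hl := h.1
    refine ⟨Pl.of_reflect (by omega) fun p h1 h2 => ?_, by omega, ?_⟩
    · have := h.reflect (p := p) (by omega) (by omega)
      rwa [show 2 * (j + 1) - (l + 2) - p = 2 * j - l - p by omega] at this
    · have := h.reflect (p := j - l) (by omega) (by omega)
      rwa [show 2 * (j + 1) - (l + 2) - (j - l) = j by omega] at this
  · rintro ⟨h, hl, he⟩
    refine Pl.of_reflect (by omega) fun p h1 h2 => ?_
    rw [show 2 * (j + 1) - (l + 2) - p = 2 * j - l - p by omega]
    rcases Nat.lt_or_ge p j with hp | hp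
    · rcases Nat.eq_or_lt_of_le (show j - l ≤ p by omega) with hq | hq
      · rw [← hq, show 2 * j - l - (j - l) = j by omega, he]
      · exact h.reflect hq hp
    · rw [show p = j by omega, show 2 * j - l - j = j - l by omega, he]

/-- Removal of `d` letters on both sides. -/
theorem Pl.shrink {d : ℕ} (h : Pl S (j + d) (l + 2 * d)) : Pl S j l := by
  have hl := h.1
  refine Pl.of_reflect (by omega) fun p h1 h2 => ?_
  have := h.reflect (p := p) (by omega) (by omega)
  rwa [show 2 * (j + d) - (l + 2 * d) - p = 2 * j - l - p by omega] at this

/-- A palindromic suffix of a palindrome is also a prefix. -/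
theorem Pl.same_initial (h : Pl S R l) (h' : Pl S R l') (hl : l' ≤ l) :
    Same S (R - l + l') R l' := fun t ht => by
  have := h.1
  rw [h.reflect (p := R - l + l' - 1 - t) (by omega) (by omega),
    h'.reflect (p := R - 1 - t) (by omega) (by omega)]
  congr 1; omega

theorem Pl.congr (h : Pl S i l) (hs : Same S i j l) (hl : l ≤ j) : Pl S j l := by
  refine ⟨hl, fun t ht => ?_⟩
  have := h.1
  rw [← hs t ht, h.2 t ht, show i + 1 - l + t = i - 1 - (l - 2 - t) by omega,
    hs _ (by omega)]
  congr 1; omega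

/-- A palindromic prefix of a palindrome is also a suffix. -/
theorem Pl.of_initial (h : Pl S R l) (h' : Pl S (R - l + l') l') (hl : l' ≤ l) :
    Pl S R l' := by
  have := h.1
  refine Pl.of_reflect (by omega) fun p h1 h2 => ?_
  rw [h.reflect (p := p) (by omega) (by omega),
    h.reflect (p := 2 * R - l' - p) (by omega) (by omega),
    h'.reflect (p := 2 * R - l - p) (by omega) (by omega)]
  congr 1; omega

theorem Same.extend (h : Same S i j l) (hi : Pl S (i + 1) (l + 2)) (hj : Pl S (j + 1) (l + 2))
    (he : S i = S j) : Same S (i + 1) (j + 1) (l + 2) := by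
  intro t ht
  rcases t with _ | t
  · simpa using he
  · rcases Nat.lt_or_ge (t + 1) l with h1 | h1
    · have := h t h1
      rwa [show i + 1 - 1 - (t + 1) = i - 1 - t by omega,
        show j + 1 - 1 - (t + 1) = j - 1 - t by omega]
    · have h2 := hi.2 (t + 1) ht
      have h3 := hj.2 (t + 1) ht
      have h4 := hi.1
      have h5 := hj.1
      rw [h2, h3, show i + 1 + 1 - (l + 2) + (t + 1) = i by omega,
        show j + 1 + 1 - (l + 2) + (t + 1) = j by omega, he]

end

/-! ### The palindromic tree -/

/-- The palindromic tree of a prefix of a sequence. The nodes are `1, …, cnt - 1`: node `1` is the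
virtual palindrome of length `-1`, node `2` is the empty palindrome, and every other node is a
nonempty palindrome, obtained from its parent `par u` by adding the letter `ltr u` on both sides.
Its length is `lam u - 1`, and `lnk u` is its longest proper palindromic suffix. `tab` is the
table of children, addressed by `parent * sg + letter`, with `0` for a missing child. An occurrence
of the palindrome ends before position `pos u`; the program does not store it. -/
structure PTree where
  cnt : ℕ
  par : ℕ → ℕ
  ltr : ℕ → ℕ
  lam : ℕ → ℕ
  lnk : ℕ → ℕ
  tab : ℕ → ℕ
  pos : ℕ → ℕ

namespace PTree

/-- The palindrome of node `v` occurs before position `j`. -/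
structure Occ (T : PTree) (S : ℕ → ℕ) (v j : ℕ) : Prop where
  pos : 1 ≤ v
  lt : v < T.cnt
  pl : Pl S j (T.lam v)
  same : Same S (T.pos v) j (T.lam v)

/-- The node `u` is the extension of its parent by the letter `ltr u`, is registered in the table of
children, and occurs before `pos u`. -/
structure IsNode (T : PTree) (S : ℕ → ℕ) (sg u : ℕ) : Prop where
  par_pos : 1 ≤ T.par u
  par_lt : T.par u < u
  lam : T.lam u = T.lam (T.par u) + 2
  ltr_lt : T.ltr u < sg
  tab : T.tab (T.par u * sg + T.ltr u) = u
  pl : Pl S (T.pos u) (T.lam u)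
  ltr : S (T.pos u - 1) = T.ltr u
  same : Same S (T.pos (T.par u)) (T.pos u - 1) (T.lam (T.par u))

/-- `w` is the longest palindromic suffix, shorter than `l - 1`, of the prefix that ends
before `j`. -/
structure IsLink (T : PTree) (S : ℕ → ℕ) (j l w : ℕ) : Prop where
  occ : T.Occ S w j
  lt : T.lam w < l
  max : ∀ l' < l, Pl S j l' → l' ≤ T.lam w

/-- The data of all nodes, the table and the suffix links are correct. An entry of the table is not
`0` only if it is a node, and then its address determines the parent and the letter. -/
structure Valid (T : PTree) (S : ℕ → ℕ) (sg : ℕ) : Prop where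
  cnt : 3 ≤ T.cnt
  lam1 : T.lam 1 = 0
  lam2 : T.lam 2 = 1
  pos2 : 1 ≤ T.pos 2
  node : ∀ u, 3 ≤ u → u < T.cnt → T.IsNode S sg u
  tab : ∀ i, T.tab i ≠ 0 → 3 ≤ T.tab i ∧ T.tab i < T.cnt ∧
    i = T.par (T.tab i) * sg + T.ltr (T.tab i)
  link : ∀ u, 2 ≤ u → u < T.cnt → T.IsLink S (T.pos u) (T.lam u) (T.lnk u)

/-- Every nonempty palindrome that ends before a position `≤ R` is a node. -/
def Complete (T : PTree) (S : ℕ → ℕ) (R : ℕ) : Prop :=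
  ∀ j ≤ R, ∀ l, 2 ≤ l → Pl S j l → ∃ u, T.lam u = l ∧ T.Occ S u j

/-- `v` is the longest palindrome that ends before `R`. -/
structure IsTop (T : PTree) (S : ℕ → ℕ) (R v : ℕ) : Prop where
  occ : T.Occ S v R
  max : ∀ l, Pl S R l → l ≤ T.lam v

/-- State of the search, along suffix links, for a palindrome before `R` that the letter `S R`
extends; only candidates with `lam < b` are considered. -/
structure Search (T : PTree) (S : ℕ → ℕ) (R b v : ℕ) : Prop where
  occ : T.Occ S v R
  max : ∀ l < b, Pl S (R + 1) (l + 2) → l ≤ T.lam v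

/-- `v` is the maximal palindrome with center `k / 2`. -/
def MaxAt (T : PTree) (S : ℕ → ℕ) (k v : ℕ) : Prop :=
  ∃ j, 2 * j = k + T.lam v ∧ T.Occ S v j ∧ S (j - T.lam v) ≠ S j

variable {T : PTree} {S : ℕ → ℕ} {sg R u v w j j' l : ℕ}

theorem Occ.le (h : T.Occ S v j) : T.lam v ≤ j := h.pl.1

theorem Valid.lam_pos (hT : T.Valid S sg) (hv : 2 ≤ v) (hc : v < T.cnt) : 1 ≤ T.lam v := by
  rcases Nat.eq_or_lt_of_le hv with rfl | h
  · exact hT.lam2.ge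
  · have := (hT.node v h hc).lam; omega

theorem Valid.lam_ge (hT : T.Valid S sg) (hv : 3 ≤ v) (hc : v < T.cnt) : 2 ≤ T.lam v := by
  have := (hT.node v hv hc).lam; omega

theorem Valid.three_le (hT : T.Valid S sg) (h : 2 ≤ T.lam v) (hv : 1 ≤ v) : 3 ≤ v := by
  by_contra hlt
  have : v = 1 ∨ v = 2 := by omega
  rcases this with rfl | rfl
  · rw [hT.lam1] at h; omega
  · rw [hT.lam2] at h; omega

theorem Valid.pos_ge (hT : T.Valid S sg) (hv : 2 ≤ v) (hc : v < T.cnt) :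
    T.lam v ≤ T.pos v := by
  rcases Nat.eq_or_lt_of_le hv with rfl | h
  · rw [hT.lam2]; exact hT.pos2
  · exact (hT.node v h hc).pl.1

/-- The longest proper palindromic suffix does not depend on the occurrence. -/
theorem Valid.isLink (hT : T.Valid S sg) (hv : 2 ≤ v) (h : T.Occ S v j) :
    T.IsLink S j (T.lam v) (T.lnk v) := by
  have hl := hT.link v hv h.lt
  have hle := h.le
  refine ⟨⟨hl.occ.pos, hl.occ.lt, hl.occ.pl.congr (h.same.mono hl.lt.le) ?_,
    hl.occ.same.trans (h.same.mono hl.lt.le)⟩, hl.lt, fun l' hl' hp => ?_⟩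
  · have := hl.lt; omega
  · refine hl.max l' hl' (hp.congr (h.same.symm.mono hl'.le) ?_)
    have := hT.pos_ge hv h.lt; omega

theorem Valid.occ_parent (hT : T.Valid S sg) (hv : 3 ≤ v) (h : T.Occ S v (j + 1)) :
    T.Occ S (T.par v) j ∧ S j = T.ltr v := by
  have hn := hT.node v hv h.lt
  have hp := h.pl
  rw [hn.lam] at hp
  have hs := h.same
  rw [hn.lam] at hs
  refine ⟨⟨hn.par_pos, hn.par_lt.trans h.lt, (pl_succ.1 hp).1,
    hn.same.trans (hs.mono (Nat.le_succ _)).pred⟩, ?_⟩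
  rw [← hn.ltr]
  simpa using (hs 0 (by omega)).symm

/-- Equal palindromes are the same node. -/
theorem Valid.unique (hT : T.Valid S sg) :
    ∀ l u u' j, T.lam u = l → T.lam u' = l → T.Occ S u j → T.Occ S u' j → u = u' := by
  intro l
  induction l using Nat.strong_induction_on with
  | _ l ih =>
    intro u u' j hu hu' ho ho'
    rcases Nat.lt_or_ge l 2 with hl | hl
    · have h1 : ∀ v, T.lam v = l → T.Occ S v j → v = l + 1 := by
        intro v hv h
        have hp := h.pos
        rcases Nat.lt_or_ge v 3 with h3 | h3
        · have : v = 1 ∨ v = 2 := by omega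
          rcases this with rfl | rfl
          · rw [hT.lam1] at hv; omega
          · rw [hT.lam2] at hv; omega
        · have := hT.lam_ge h3 h.lt; omega
      rw [h1 u hu ho, h1 u' hu' ho']
    · have h3 := hT.three_le (hu ▸ hl) ho.pos
      have h3' := hT.three_le (hu' ▸ hl) ho'.pos
      have hj := ho.le
      obtain ⟨j, rfl⟩ : ∃ i, j = i + 1 := ⟨j - 1, by omega⟩
      obtain ⟨hp, hc⟩ := hT.occ_parent h3 ho
      obtain ⟨hp', hc'⟩ := hT.occ_parent h3' ho'
      have hn := hT.node u h3 ho.lt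
      have hn' := hT.node u' h3' ho'.lt
      have := hn.lam
      have := hn'.lam
      have hpp := ih (T.lam (T.par u)) (by omega) _ _ j rfl (by omega) hp hp'
      rw [← hn.tab, ← hn'.tab, hpp, ← hc, ← hc']

/-- A child found in the table is the extension of its parent. -/
theorem Valid.child (hT : T.Valid S sg) (hu : T.tab (v * sg + S R) ≠ 0) (hsg : S R < sg)
    (hv : T.Occ S v R) (hp : Pl S (R + 1) (T.lam v + 2)) :
    3 ≤ T.tab (v * sg + S R) ∧ T.lam (T.tab (v * sg + S R)) = T.lam v + 2 ∧
      T.Occ S (T.tab (v * sg + S R)) (R + 1) := by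
  obtain ⟨h3, hc, he⟩ := hT.tab _ hu
  set u := T.tab (v * sg + S R) with hudef
  have hn := hT.node u h3 hc
  have hpar : T.par u = v ∧ T.ltr u = S R := by
    have hs : 0 < sg := by omega
    have h1 := congrArg (· / sg) he
    have h2 := congrArg (· % sg) he
    simp only [Nat.mul_comm _ sg, Nat.mul_add_div hs, Nat.div_eq_of_lt hsg,
      Nat.div_eq_of_lt hn.ltr_lt, Nat.mul_add_mod, Nat.mod_eq_of_lt hsg,
      Nat.mod_eq_of_lt hn.ltr_lt] at h1 h2
    omega
  have hlam : T.lam u = T.lam v + 2 := by rw [hn.lam, hpar.1]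
  refine ⟨h3, hlam, by omega, hc, hlam ▸ hp, ?_⟩
  have hge := hn.pl.1
  obtain ⟨i, hi⟩ : ∃ i, T.pos u = i + 1 := ⟨T.pos u - 1, by omega⟩
  have hs := hn.same
  have hpl := hn.pl
  have hlt := hn.ltr
  rw [hi, hpar.1, Nat.add_sub_cancel] at hs
  rw [hi, Nat.add_sub_cancel, hpar.2] at hlt
  rw [hi, hlam] at hpl ⊢
  exact (hs.symm.trans hv.same).extend hpl hp hlt

/-- A candidate that the letter `S R` does not extend is replaced by its suffix link. The search
terminates, because the virtual palindrome of length `-1` is always extended. -/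
theorem Search.next (hT : T.Valid S sg) {b : ℕ} (h : T.Search S R b v)
    (hne : S (R - T.lam v) ≠ S R) :
    2 ≤ v ∧ T.Search S R b (T.lnk v) ∧ T.lam (T.lnk v) < T.lam v := by
  have hv : 2 ≤ v := by
    by_contra hlt
    have : v = 1 := by have := h.occ.pos; omega
    rw [this, hT.lam1] at hne
    exact hne rfl
  have hl := hT.isLink hv h.occ
  refine ⟨hv, ⟨hl.occ, fun l hb hp => ?_⟩, hl.lt⟩
  have h1 := h.max l hb hp
  obtain ⟨h2, -, h3⟩ := pl_succ.1 hp
  refine hl.max l (lt_of_le_of_ne h1 fun he => ?_) h2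
  exact hne (he ▸ h3)

/-- The search ends with the longest palindromic suffix that can be extended. The hypothesis on `S
0` excludes an extension across the sentinel. -/
theorem Search.extends {b : ℕ} (h : T.Search S R b v) (he : S (R - T.lam v) = S R)
    (h0 : S 0 ≠ S R) : Pl S (R + 1) (T.lam v + 2) := by
  refine pl_succ.2 ⟨h.occ.pl, ?_, he⟩
  have := h.occ.le
  by_contra hlt
  rw [show R - T.lam v = 0 by omega] at he
  exact h0 he

theorem IsTop.search (h : T.IsTop S R v) (b : ℕ) : T.Search S R b v :=
  ⟨h.occ, fun _ _ hp => h.max _ (pl_succ.1 hp).1⟩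

/-- A palindromic suffix, of the prefix up to `R`, that is shorter than another one has occurred
before. -/
theorem Complete.suffix (hC : T.Complete S R) (hl : Pl S (R + 1) l) {l' : ℕ}
    (hl' : Pl S (R + 1) l') (hlt : l' < l) (h2 : 2 ≤ l') : ∃ u, T.lam u = l' ∧
        T.Occ S u (R + 1) := by
  have hs := hl.same_initial hl' hlt.le
  have h1 := hl.1
  obtain ⟨u, hu, ho⟩ := hC (R + 1 - l + l') (by omega) l' h2 (hl'.congr hs.symm (by omega))
  exact ⟨u, hu, ho.pos, ho.lt, hu ▸ hl', ho.same.trans (hu ▸ hs)⟩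

/-- The child of a node exists already if its palindrome is a proper palindromic suffix. -/
theorem Complete.child_ne_zero (hC : T.Complete S R) (hT : T.Valid S sg)
    (hl : Pl S (R + 1) (l + 2)) (hv : T.Occ S v R) (hp : Pl S (R + 1) (T.lam v + 2))
    (hlt : T.lam v < l) : T.tab (v * sg + S R) ≠ 0 := by
  obtain ⟨u, hu, ho⟩ := hC.suffix hl hp (by omega) (by omega)
  have h3 := hT.three_le (hu ▸ Nat.le_add_left 2 _) ho.pos
  obtain ⟨hpar, hc⟩ := hT.occ_parent h3 ho
  have hn := hT.node u h3 ho.lt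
  have : T.par u = v := hT.unique (T.lam v) _ _ R (by have := hn.lam; omega) rfl hpar hv
  rw [← this, hc, hn.tab]
  omega

/-- The tree with a new node: `v` extended by the letter `S R`, with suffix link `w`. -/
def insert (T : PTree) (S : ℕ → ℕ) (sg R v w : ℕ) : PTree where
  cnt := T.cnt + 1
  par := Function.update T.par T.cnt v
  ltr := Function.update T.ltr T.cnt (S R)
  lam := Function.update T.lam T.cnt (T.lam v + 2)
  lnk := Function.update T.lnk T.cnt w
  tab := Function.update T.tab (v * sg + S R) T.cnt
  pos := Function.update T.pos T.cnt (R + 1)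

theorem Occ.insert (h : T.Occ S u j) : (T.insert S sg R v w).Occ S u j := by
  have hne : u ≠ T.cnt := h.lt.ne
  refine ⟨h.pos, Nat.lt_succ_of_lt h.lt, ?_, ?_⟩
  · simpa [PTree.insert, hne] using h.pl
  · simpa [PTree.insert, hne] using h.same

theorem insert_lam (h : u < T.cnt) : (T.insert S sg R v w).lam u = T.lam u := by
  simp [PTree.insert, h.ne]

theorem IsLink.insert (h : T.IsLink S j l u) : (T.insert S sg R v w).IsLink S j l u := by
  refine ⟨h.occ.insert, ?_, ?_⟩ <;> rw [insert_lam h.occ.lt]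
  exacts [h.lt, h.max]

theorem occ_insert (hp : Pl S (R + 1) (T.lam v + 2)) (hc : 3 ≤ T.cnt) :
    (T.insert S sg R v w).Occ S T.cnt (R + 1) := by
  refine ⟨by omega, Nat.lt_succ_self _, by simpa [PTree.insert] using hp, ?_⟩
  simp only [PTree.insert, Function.update_self]
  exact fun _ _ => rfl

/-- The new node keeps the tree valid, provided that `v` had no child with the letter `S R`. -/
theorem Valid.insert (hT : T.Valid S sg) (h0 : T.tab (v * sg + S R) = 0) (hsg : S R < sg)
    (hv : T.Occ S v R) (hp : Pl S (R + 1) (T.lam v + 2))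
    (hw : T.IsLink S (R + 1) (T.lam v + 2) w) : (T.insert S sg R v w).Valid S sg := by
  have hc := hT.cnt
  have hvl := hv.lt
  refine ⟨Nat.le_succ_of_le hc, ?_, ?_, ?_, ?_, ?_, ?_⟩
  · rw [insert_lam (by omega), hT.lam1]
  · rw [insert_lam (by omega), hT.lam2]
  · simpa [PTree.insert, show 2 ≠ T.cnt by omega] using hT.pos2
  · intro u h3 hu
    rcases Nat.lt_succ_iff_lt_or_eq.1 hu with h | rfl
    · have hn := hT.node u h3 h
      have hpl := hn.par_lt
      have hne : T.par u * sg + T.ltr u ≠ v * sg + S R := by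
        intro he
        have := hn.tab
        rw [he, h0] at this; omega
      refine ⟨?_, ?_, ?_, ?_, ?_, ?_, ?_, ?_⟩ <;>
        simp only [PTree.insert, Function.update_of_ne h.ne,
          Function.update_of_ne (hpl.trans h).ne, Function.update_of_ne hne]
      exacts [hn.par_pos, hn.par_lt, hn.lam, hn.ltr_lt, hn.tab, hn.pl, hn.ltr, hn.same]
    · refine ⟨?_, ?_, ?_, ?_, ?_, ?_, ?_, ?_⟩ <;>
        simp only [PTree.insert, Function.update_self, Function.update_of_ne hvl.ne,
          Nat.add_sub_cancel]
      exacts [hv.pos, hvl, hsg, hp, hv.same]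
  · intro i hi
    by_cases h : i = v * sg + S R
    · subst h
      simp only [PTree.insert, Function.update_self]
      exact ⟨hc, Nat.lt_succ_self _, trivial⟩
    · simp only [PTree.insert, Function.update_of_ne h] at hi ⊢
      obtain ⟨a, b, c⟩ := hT.tab i hi
      rw [Function.update_of_ne b.ne, Function.update_of_ne b.ne]
      exact ⟨a, Nat.lt_succ_of_lt b, c⟩
  · intro u h2 hu
    rcases Nat.lt_succ_iff_lt_or_eq.1 hu with h | rfl
    · have := (hT.link u h2 h).insert (sg := sg) (R := R) (v := v) (w := w)
      rw [insert_lam h]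
      simpa [PTree.insert, h.ne] using this
    · have := hw.insert (sg := sg) (R := R) (v := v) (w := w)
      simpa [PTree.insert] using this

theorem Complete.insert (hC : T.Complete S R) : (T.insert S sg R v w).Complete S R := by
  intro j hj l hl hp
  obtain ⟨u, hu, ho⟩ := hC j hj l hl hp
  exact ⟨u, by rw [insert_lam ho.lt, hu], ho.insert⟩

theorem MaxAt.insert {k : ℕ} (h : T.MaxAt S k u) : (T.insert S sg R v w).MaxAt S k u := by
  obtain ⟨j, hj, ho, hne⟩ := h
  exact ⟨j, by rw [insert_lam ho.lt, hj], ho.insert, by rwa [insert_lam ho.lt]⟩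

/-- Only the longest palindromic suffix can be new after one more letter. -/
theorem Complete.succ (hC : T.Complete S R) (h : T.IsTop S (R + 1) v) :
    T.Complete S (R + 1) := by
  intro j hj l hl hp
  rcases Nat.lt_or_ge j (R + 1) with h1 | h1
  · exact hC j (by omega) l hl hp
  · obtain rfl : j = R + 1 := by omega
    rcases Nat.eq_or_lt_of_le (h.max l hp) with h2 | h2
    · exact ⟨v, h2.symm, h.occ⟩
    · exact hC.suffix h.occ.pl hp h2 hl

/-- The extension of the result of the search is the longest palindromic suffix after the letter `S
R`. -/
theorem Search.isTop {b : ℕ} (h : T.Search S R b v) (hb : R ≤ b) (hu : T.Occ S u (R + 1))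
    (hlam : T.lam u = T.lam v + 2) : T.IsTop S (R + 1) u := by
  refine ⟨hu, fun l hp => ?_⟩
  rw [hlam]
  rcases Nat.lt_or_ge l 2 with h2 | h2
  · omega
  · have := hp.1
    have := h.max (l - 2) (by omega) (by rwa [Nat.sub_add_cancel h2])
    omega

/-- The suffix link of the longest palindromic suffix grows by at most one letter on each side. -/
theorem Valid.lam_lnk_le (hT : T.Valid S sg) (hv : 2 ≤ v) (ho : T.Occ S v R) (hu : 2 ≤ u)
    (hou : T.Occ S u (R + 1)) (hlam : T.lam u = T.lam v + 2) :
    T.lam (T.lnk u) ≤ T.lam (T.lnk v) + 2 := by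
  have hl := hT.isLink hu hou
  have hl' := hT.isLink hv ho
  have := hl.lt
  rcases Nat.lt_or_ge (T.lam (T.lnk u)) 2 with h2 | h2
  · omega
  · have hp := hl.occ.pl
    rw [← Nat.sub_add_cancel h2] at hp
    have := hl'.max _ (by omega) (pl_succ.1 hp).1
    omega

/-- Manacher's observation: between the center of the longest palindromic suffix `v` and that of its
suffix link, the maximal palindromes are the mirror images of those on the left of the center
of `v`. -/
theorem MaxAt.mirror (hT : T.Valid S sg) (hv : 2 ≤ v) (ho : T.Occ S v R) {q : ℕ}
    (hq : 2 * R - T.lam v < q) (hq' : q < 2 * R - T.lam (T.lnk v))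
    (h : T.MaxAt S (2 * (2 * R - T.lam v) - q) u) : T.MaxAt S q u := by
  obtain ⟨j, hj, hu, hne⟩ := h
  have hl := hT.isLink hv ho
  have hle := ho.le
  have hlu := hu.le
  set d := q - (2 * R - T.lam v) with hd
  have hjR : j + d < R := by
    by_contra hge
    -- truncated to the factor `v`, the palindrome at the mirrored center is a prefix of `v`
    have h1 : Pl S (j - (j + d - R)) (2 * R - q) := by
      refine Pl.shrink (d := j + d - R) ?_
      rw [show j - (j + d - R) + (j + d - R) = j by omega,
        show 2 * R - q + 2 * (j + d - R) = T.lam u by omega]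
      exact hu.pl
    have h2 : Pl S R (2 * R - q) := by
      refine ho.pl.of_initial ?_ (by omega)
      rwa [show R - T.lam v + (2 * R - q) = j - (j + d - R) by omega]
    have := hl.max (2 * R - q) (by omega) h2
    omega
  have hs : Same S j (j + d) (T.lam u) := by
    intro t ht
    rw [hu.pl.reflect (p := j - 1 - t) (by omega) (by omega),
      ho.pl.reflect (p := j + d - 1 - t) (by omega) (by omega)]
    congr 1; omega
  refine ⟨j + d, by omega, ⟨hu.pos, hu.lt, hu.pl.congr hs (by omega), hu.same.trans hs⟩, ?_⟩
  rw [ho.pl.reflect (p := j + d) (by omega) (by omega),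
    ho.pl.reflect (p := j + d - T.lam u) (by omega) (by omega),
    show 2 * R - T.lam v - (j + d - T.lam u) = j by omega,
    show 2 * R - T.lam v - (j + d) = j - T.lam u by omega]
  exact hne.symm

end PTree
end Palcf

namespace Palcf

/-! ### The program -/

namespace Prog
open Var Arr Cmd

local prefix:max "§" => Expr.var
local notation:max A "⟦" e "⟧" => Expr.get A e
local infix:35 " ⟵ " => Cmd.set

/-- The largest letter, and the sizes that depend on it. -/
def sizes : Cmd :=
  n ⟵ §out0 ;; m ⟵ §out1 ;; N ⟵ §n + §m ;; A ⟵ 0 ;;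
  for_ i 0 (.lt §i §N) (a ⟵ inp⟦§i⟧ ;; ite (.lt §A §a) (A ⟵ §a) skip) ;;
  sg ⟵ §A + 3 ;; B ⟵ §N + 8 ;; M ⟵ 8 * (§B * §sg)

/-- The string `x` and `y` with sentinels around them: `0 x (A + 1) y (A + 2)`. -/
def sentinels : Cmd :=
  for_ i 0 (.lt §i §n) (put str (§i + 1) inp⟦§i⟧) ;;
  put str (§n + 1) (§A + 1) ;;
  for_ i §n (.lt §i §N) (put str (§i + 2) inp⟦§i⟧) ;;
  put str (§N + 2) (§A + 2)

/-- The palindrome `x` of the tree is not extended by the letter `a` at position `R`. -/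
def mismatch (x : Var) : Cond := .ne str⟦§R - lam⟦§x⟧⟧ §a

/-- The longest palindromic suffix `cur` is not extended: its center, and those up to the center of
its suffix link, get their maximal palindromes. -/
def retreat : Cmd :=
  k ⟵ 2 * §R - lam⟦§cur⟧ ;; put nd §k §cur ;; cur ⟵ lnk⟦§cur⟧ ;; k2 ⟵ 2 * §R - lam⟦§cur⟧ ;;
  for_ q (§k + 1) (.lt §q §k2) (put nd §q nd⟦2 * §k - §q⟧)

/-- A new node for the extension of `cur` by the letter `a`. -/
def newNode : Cmd :=
  ite (.eq §cur 1) (put lnk §cnt 2)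
    (t ⟵ lnk⟦§cur⟧ ;; loop (mismatch t) (t ⟵ lnk⟦§t⟧) ;; put lnk §cnt tab⟦§t * §sg + §a⟧) ;;
  put par §cnt §cur ;; put ltr §cnt §a ;; put lam §cnt (lam⟦§cur⟧ + 2) ;;
  put tab §key §cnt ;; cnt ⟵ §cnt + 1

/-- The palindromic tree and the node of the maximal palindrome at every center. -/
def build : Cmd :=
  put lam 2 1 ;; put lnk 2 1 ;; cnt ⟵ 3 ;; cur ⟵ 2 ;;
  for_ R 1 (.lt §R (§N + 3))
    (a ⟵ str⟦§R⟧ ;; loop (mismatch cur) retreat ;; key ⟵ §cur * §sg + §a ;;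
      ite (.eq tab⟦§key⟧ 0) newNode skip ;; cur ⟵ tab⟦§key⟧)

/-- The lengths of the maximal palindromes of a block of length `len` of the string `str`, which
starts at position `off`. -/
def palLens (P : Arr) (off len : Expr) : Cmd :=
  for_ i 0 (.lt (§i + 1) (2 * len)) (put P §i (lam⟦nd⟦§i + 2 * off⟧⟧ - 1))

/-- The maximal palindromes of `x` start at position `1` of the text, those of `y` at position `n +
2`. -/
def step1 : Cmd :=
  sizes ;; sentinels ;; build ;;
  palLens palX 1 §n ;; palLens palY (§n + 2) §m ;;
  out0 ⟵ .lit palX.idx * §M ;; out1 ⟵ .lit palY.idx * §M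

/-- Appends, from the word `pos` on, pieces of the string number `src` to the array `P`. Piece `i`
starts at `i + c`, and `2 * i + shift` is its center in `str`. -/
def putPieces (P : Arr) (src c : ℕ) (shift : Expr) (g : Cond) : Cmd :=
  for_ i 0 g
    (put P §pos (.lit src) ;; put P (§pos + 1) (§i + .lit c) ;;
      put P (§pos + 2) (lam⟦nd⟦2 * §i + shift⟧⟧ / 2) ;; pos ⟵ §pos + 3)

def step2 : Cmd :=
  pos ⟵ 0 ;; putPieces oddF 0 0 2 (.lt §i §n) ;;
  putPieces oddF 1 0 (2 * §n + 4) (.lt §i §m) ;;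
  pos ⟵ 0 ;; putPieces evenF 0 1 3 (.lt (§i + 1) §n) ;;
  putPieces evenF 1 1 (2 * §n + 5) (.lt (§i + 1) §m) ;;
  out0 ⟵ .lit oddF.idx * §M ;; out1 ⟵ .lit evenF.idx * §M

/-- Distributes the list of nodes `h` over the buckets `bk` by the key of the node `u`. -/
def distribute (key : Expr) : Cmd :=
  loop (.ne §h 0)
    (u ⟵ §h ;; h ⟵ nx⟦§u⟧ ;; d ⟵ key ;; put nx §u bk⟦§d⟧ ;; put bk §d §u)

/-- Moves the bucket `d` to the front of the list `h`, in reverse order. -/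
def moveBucket : Cmd :=
  loop (.ne bk⟦§d⟧ 0) (u ⟵ bk⟦§d⟧ ;; put bk §d nx⟦§u⟧ ;; put nx §u §h ;; h ⟵ §u)

/-- Collects the buckets into the list `h`. -/
def collect : Cmd :=
  d ⟵ §B ;; loop (.lt 0 §d) (d ⟵ §d - 1 ;; moveBucket)

/-- Radix sort of the nodes by descending letters, and then by parents. -/
def sortNodes : Cmd :=
  h ⟵ 0 ;; for_ u 3 (.lt §u §cnt) (put nx §u §h ;; h ⟵ §u) ;;
  pw ⟵ 1 ;;
  loop (.lt §pw §sg)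
    (distribute ((§sg - 1 - ltr⟦§u⟧) / §pw % §B) ;; collect ;; pw ⟵ §pw * §B) ;;
  distribute par⟦§u⟧ ;; collect

/-- Inserts each node into the list `pre` behind its parent. -/
def preorder : Cmd :=
  put pre 1 2 ;;
  loop (.ne §h 0) (p ⟵ par⟦§h⟧ ;; put pre §h pre⟦§p⟧ ;; put pre §p §h ;; h ⟵ nx⟦§h⟧)

/-- Attaches the pieces, given by their centers `k` in `str`, to the nodes. -/
def attach (lo hi : Expr) : Cmd :=
  for_ k lo (.lt §k hi) (put pnx §k head⟦nd⟦§k⟧⟧ ;; put head nd⟦§k⟧ §k)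

/-- Writes the pieces of the node `v`, and their longest common prefixes with the preceding
pieces. -/
def emitNode (P C : Arr) : Cmd :=
  loop (.ne §k 0)
    (ite (.lt §k (2 * §n + 3))
        (put P (3 * §pos) 0 ;; put P (3 * §pos + 1) ((§k - 1) / 2))
        (put P (3 * §pos) 1 ;; put P (3 * §pos + 1) ((§k - 1) / 2 - (§n + 1))) ;;
      put P (3 * §pos + 2) (lam⟦§v⟧ / 2) ;; put C §pos §mm ;; mm ⟵ lam⟦§v⟧ / 2 ;;
      pos ⟵ §pos + 1 ;; k ⟵ pnx⟦§k⟧)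

/-- Writes the pieces of all nodes from `root` up to `last` in preorder. -/
def emit (root last : ℕ) (P C : Arr) : Cmd :=
  v ⟵ .lit root ;; pos ⟵ 0 ;; mm ⟵ 0 ;;
  loop (.ne §v (.lit last))
    (k ⟵ head⟦§v⟧ ;; emitNode P C ;; v ⟵ pre⟦§v⟧ ;;
      ite (.eq §v (.lit last)) skip
        (ite (.lt §mm (lam⟦§v⟧ / 2)) skip (mm ⟵ lam⟦§v⟧ / 2 - 1)))

def step3 : Cmd :=
  sortNodes ;; preorder ;; attach 2 (2 * §n + 1) ;;
  attach (2 * §n + 4) (2 * §n + 2 * §m + 3) ;;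
  emit 1 2 oddL oddC ;; emit 2 0 evenL evenC ;;
  out0 ⟵ .lit oddL.idx * §M ;; out1 ⟵ .lit evenL.idx * §M

/-- The first word of the arrays `oddC` and `evenC` belongs to the first piece, which has no
predecessor. -/
def step4 : Cmd :=
  out0 ⟵ .lit oddC.idx * §M + 1 ;; out1 ⟵ .lit evenC.idx * §M + 1

/-- The maximum of the longest common prefixes of consecutive pieces of different strings. -/
def crossMax (b : Var) (P C : Arr) (len : Expr) : Cmd :=
  b ⟵ 0 ;;
  for_ i 1 (.lt §i len)
    (ite (.eq P⟦3 * §i⟧ P⟦3 * §i - 3⟧) skip (ite (.lt §b C⟦§i⟧) (b ⟵ C⟦§i⟧) skip))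

def step5 : Cmd :=
  crossMax bo oddL oddC §N ;; crossMax be evenL evenC §pos ;;
  ite (.eq §bo 0) skip (bo ⟵ 2 * §bo - 1) ;; be ⟵ 2 * §be ;;
  ite (.lt §bo §be) (out0 ⟵ §be) (out0 ⟵ §bo)

/-- The registers `out0` and `out1` point to the two resulting arrays after each of the commands but
the last, which leaves the result in `out0`. -/
def main : Cmd := step1 ;; step2 ;; step3 ;; step4 ;; step5

end Prog
end Palcf

namespace Palcf

/-! ### The input and its text with sentinels -/

/-- The largest letter of the input. -/
def maxLetter (x y : List ℕ) : ℕ := (x ++ y).foldr max 0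

/-- The number of cells of each array suffices for all arrays, and words suffice for all
addresses. -/
structure Dims (W M n m A : ℕ) : Prop where
  def_M : M = 8 * ((n + m + 8) * (A + 3))
  le : 32 * M ≤ W

namespace Dims
variable {W M n m A : ℕ}

theorem len_le (h : Dims W M n m A) : 24 * (n + m + 8) ≤ M := by
  rw [h.def_M]
  have : (n + m + 8) * 3 ≤ (n + m + 8) * (A + 3) := Nat.mul_le_mul_left _ (by omega)
  omega

theorem letter_le (h : Dims W M n m A) : 64 * (A + 3) ≤ M := by
  rw [h.def_M]
  have : 8 * (A + 3) ≤ (n + m + 8) * (A + 3) := Nat.mul_le_mul_right _ (by omega)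
  omega

theorem tab_lt (h : Dims W M n m A) {v a : ℕ} (hv : v < n + m + 8) (ha : a < A + 3) :
    v * (A + 3) + a < M := by
  rw [h.def_M]
  have : (v + 1) * (A + 3) ≤ (n + m + 8) * (A + 3) := Nat.mul_le_mul_right _ (by omega)
  rw [Nat.add_mul] at this
  omega

end Dims

/-- The variables that are constant after the first loop. -/
structure Consts (M n m A : ℕ) (s : Store) : Prop where
  vn : s.v .n = n
  vm : s.v .m = m
  vN : s.v .N = n + m
  vA : s.v .A = A
  vsg : s.v .sg = A + 3
  vB : s.v .B = n + m + 8
  vM : s.v .M = M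

/-- `S` is the text `0 x (A + 1) y (A + 2)`, followed by zeros. -/
structure IsText (x y : List ℕ) (A : ℕ) (S : ℕ → ℕ) : Prop where
  zero : S 0 = 0
  left : ∀ i (h : i < x.length), S (i + 1) = x[i]
  mid : S (x.length + 1) = A + 1
  right : ∀ i (h : i < y.length), S (x.length + 2 + i) = y[i]
  last : S (x.length + y.length + 2) = A + 2
  out : ∀ i, x.length + y.length + 3 ≤ i → S i = 0
  letter : ∀ a ∈ x ++ y, 1 ≤ a ∧ a ≤ A

namespace Consts

theorem frame {M n m A : ℕ} {c : Cmd} {s s' : Store} (h : Consts M n m A s) (hf : c.Frame s s')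
    (hc : (c.writesV .n || c.writesV .m || c.writesV .N || c.writesV .A || c.writesV .sg ||
      c.writesV .B || c.writesV .M) = false) : Consts M n m A s' := by
  simp only [Bool.or_eq_false_iff] at hc
  obtain ⟨⟨⟨⟨⟨⟨h1, h2⟩, h3⟩, h4⟩, h5⟩, h6⟩, h7⟩ := hc
  exact ⟨(hf.v _ h1).trans h.vn, (hf.v _ h2).trans h.vm, (hf.v _ h3).trans h.vN,
    (hf.v _ h4).trans h.vA, (hf.v _ h5).trans h.vsg, (hf.v _ h6).trans h.vB,
    (hf.v _ h7).trans h.vM⟩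

end Consts

namespace IsText

variable {x y : List ℕ} {A : ℕ} {S : ℕ → ℕ}

/-- Each letter of the text is `0` outside, one of the two letters `A + 1` and `A + 2` that occur
only once, or a letter of the input. -/
theorem cases (h : IsText x y A S) (i : ℕ) : (i = 0 ∨ x.length + y.length + 3 ≤ i) ∧ S i = 0 ∨
    i = x.length + 1 ∧ S i = A + 1 ∨ i = x.length + y.length + 2 ∧ S i = A + 2 ∨
    (1 ≤ i ∧ i ≤ x.length ∨ x.length + 2 ≤ i ∧ i < x.length + 2 + y.length) ∧ 1 ≤ S i ∧
      S i ≤ A := by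
  rcases Nat.eq_zero_or_pos i with rfl | h0
  · exact Or.inl ⟨Or.inl rfl, h.zero⟩
  rcases Nat.lt_or_ge x.length i with h1 | h1
  · rcases Nat.eq_or_lt_of_le (show x.length + 1 ≤ i from h1) with rfl | h2
    · exact Or.inr (Or.inl ⟨rfl, h.mid⟩)
    rcases Nat.lt_or_ge i (x.length + 2 + y.length) with h3 | h3
    · obtain ⟨j, rfl⟩ : ∃ j, i = x.length + 2 + j := ⟨i - (x.length + 2), by omega⟩
      have := h.letter _ (List.mem_append_right x (y.getElem_mem (show j < y.length by omega)))
      rw [← h.right j (by omega)] at this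
      exact Or.inr (Or.inr (Or.inr ⟨Or.inr ⟨by omega, h3⟩, this⟩))
    rcases Nat.eq_or_lt_of_le h3 with rfl | h4
    · refine Or.inr (Or.inr (Or.inl ⟨by omega, ?_⟩))
      rw [← h.last]; congr 1; omega
    · exact Or.inl ⟨Or.inr (by omega), h.out i (by omega)⟩
  · obtain ⟨j, rfl⟩ : ∃ j, i = j + 1 := ⟨i - 1, by omega⟩
    have := h.letter _ (List.mem_append_left y (x.getElem_mem (show j < x.length by omega)))
    rw [← h.left j (by omega)] at this
    exact Or.inr (Or.inr (Or.inr ⟨Or.inl ⟨by omega, h1⟩, this⟩))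

theorem lt (h : IsText x y A S) (i : ℕ) : S i < A + 3 := by
  have := h.cases i; omega

theorem ne_zero (h : IsText x y A S) {i : ℕ} (h1 : 1 ≤ i) (h2 : i < x.length + y.length + 3) :
    S 0 ≠ S i := by
  have := h.cases i
  have := h.zero
  omega

end IsText

namespace Prog
open Cmd

variable {W M : ℕ} {x y : List ℕ}

theorem run_sizes {s : Store} (hD : Dims W M x.length y.length (maxLetter x y))
    (hn : s.v .out0 = x.length) (hm : s.v .out1 = y.length)
    (hi : ∀ i, s.a .inp i = (x ++ y).getD i 0) :
    Run W M sizes s (fun s' => Consts M x.length y.length (maxLetter x y) s' ∧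
      s'.clk ≤ s.clk + (x.length + y.length)) := by
  have h1 := hD.len_le
  have h2 := hD.letter_le
  have h3 := hD.le
  unfold sizes
  simp only [run_seq_iff, run_set_iff]
  refine ⟨by simp, by simp, by simp [hn, hm]; omega, by simp; omega, ?_⟩
  apply run_for (fun j s1 => s1.clk = s.clk + j ∧ (∀ i < j, s.a .inp i ≤ s1.v .A) ∧
      (s1.v .A = 0 ∨ ∃ i < j, s.a .inp i = s1.v .A)) 0 (x.length + y.length) rfl
  · simp; omega
  · simp
  · omega
  · omega
  · simp
  · intro j s1 _ hj hf hi _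
    have := hf.v .N rfl
    simp_all
  · intro j s1 _ hj hf hi ⟨hc, hall, hex⟩
    have := hf.a .inp rfl
    simp at this
    simp [this, hi]
    refine ⟨by omega, fun hlt => ⟨by omega, fun i hij => ?_, Or.inr ⟨j, by omega, rfl⟩⟩,
      fun hle => ⟨by omega, fun i hij => ?_, ?_⟩⟩
    · rcases Nat.lt_or_eq_of_le hij with h | rfl
      · exact (hall i h).trans hlt.le
      · exact le_rfl
    · rcases Nat.lt_or_eq_of_le hij with h | rfl
      · exact hall i h
      · exact hle
    · rcases hex with h | ⟨i, h, h'⟩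
      · exact Or.inl h
      · exact Or.inr ⟨i, by omega, h'⟩
  · intro s1 hf _ ⟨hc, hall, hex⟩
    have hA : s1.v .A = maxLetter x y := by
      refine le_antisymm ?_ ?_
      · rcases hex with h | ⟨i, h, h'⟩
        · omega
        · rw [← h', hi, List.getD_eq_getElem _ _ (by simpa using h)]
          exact le_foldr_max (List.getElem_mem _)
      · rcases foldr_max_mem (x ++ y) with h | h
        · rw [maxLetter, h]; omega
        · obtain ⟨i, hlt, he⟩ := List.getElem_of_mem h
          have := hall i (by simpa using hlt)
          rwa [hi, List.getD_eq_getElem _ _ hlt, he] at this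
    have e1 := hf.v .n rfl
    have e2 := hf.v .m rfl
    have e3 := hf.v .N rfl
    simp [hn, hm] at e1 e2 e3
    have h8 := hD.def_M
    have : (x.length + y.length + 8) * (maxLetter x y + 3) < W := by omega
    simp [e3, hA, hc]
    refine ⟨by omega, by omega, by omega, ⟨?_, ?_, ?_, ?_, ?_, ?_, ?_⟩⟩ <;> simp_all

theorem run_sentinels {s : Store} (hD : Dims W M x.length y.length (maxLetter x y))
    (hs : Consts M x.length y.length (maxLetter x y) s) (hl : ∀ a ∈ x ++ y, 1 ≤ a)
    (hi : ∀ i, s.a .inp i = (x ++ y).getD i 0) (h0 : ∀ i, s.a .str i = 0) :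
    Run W M sentinels s (fun s' => IsText x y (maxLetter x y) (s'.a .str) ∧
      s'.clk ≤ s.clk + (x.length + y.length)) := by
  have h1 := hD.len_le
  have h2 := hD.letter_le
  have h3 := hD.le
  generalize hA : maxLetter x y = A at *
  unfold sentinels
  refine run_seq ?_
  apply run_for (fun j s1 => s1.clk = s.clk + j ∧
      s1.a .str = fun i => if 1 ≤ i ∧ i ≤ j then s.a .inp (i - 1) else 0) 0 x.length rfl
  · simp; omega
  · simp
  · omega
  · omega
  · refine ⟨rfl, funext fun i => ?_⟩
    simp only [h0]
    rw [if_neg (by omega)]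
  · intro j s1 _ hj hf hi _
    have := hf.v .n rfl
    simp_all [hs.vn]
  · intro j s1 _ hj hf hi ⟨hc, hstr⟩
    have := hf.a .inp rfl
    have hM := hf.v .M rfl
    simp [this, hi, hM, hs.vM]
    refine ⟨by omega, by omega, by omega, by omega, funext fun i => ?_⟩
    by_cases h : i = j + 1
    · subst h; simp
    · rw [Function.update_of_ne h, hstr]
      simp only
      congr 1; rw [eq_iff_iff]; omega
  intro s1 hf _ ⟨hc1, hstr1⟩
  have hs1 := hs.frame hf rfl
  have hinp := hf.a .inp rfl
  simp only [run_seq_iff, run_put_iff]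
  refine ⟨by simp [hs1.vn]; omega, by simp [hs1.vA]; omega, hs1.vM, by simp [hs1.vn]; omega, ?_⟩
  apply run_for (fun j s2 => s2.clk = s.clk + j ∧
      s2.a .str = fun i => if 1 ≤ i ∧ i ≤ x.length then s.a .inp (i - 1) else
        if i = x.length + 1 then A + 1 else
          if x.length + 2 ≤ i ∧ i < j + 2 then s.a .inp (i - 2) else 0)
      x.length (x.length + y.length) rfl
  · simp
  · simp [hs1.vn]
  · omega
  · omega
  · refine ⟨hc1, funext fun i => ?_⟩
    simp only [Expr.eval_add, Expr.eval_var, Expr.eval_num, hs1.vn, hs1.vA, Function.update_self]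
    by_cases h : i = x.length + 1
    · subst h; simp
    · rw [Function.update_of_ne h, hstr1]
      simp only [if_neg h]
      rw [if_neg (show ¬ (x.length + 2 ≤ i ∧ i < x.length + 2) by omega)]
  · intro j s2 _ hj hf2 hi _
    have := hf2.v .N rfl
    simp_all [hs1.vN]
  · intro j s2 _ hj hf2 hi ⟨hc, hstr⟩
    have h5 := hf2.a .inp rfl
    have hM := hf2.v .M rfl
    simp at h5 hM
    simp [h5, hi, hM, hs1.vM, hinp]
    refine ⟨by omega, by omega, by omega, by omega, funext fun i => ?_⟩
    by_cases h : i = j + 2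
    · subst h
      simp
      rw [if_neg (by omega), if_neg (by omega), if_pos (by omega)]
    · rw [Function.update_of_ne h, hstr]
      simp only
      congr 3; rw [eq_iff_iff]; omega
  intro s2 hf2 _ ⟨hc2, hstr2⟩
  have e1 : s2.v .N = x.length + y.length := (hf2.v .N rfl).trans hs1.vN
  have e2 : s2.v .A = A := (hf2.v .A rfl).trans hs1.vA
  have e3 : s2.v .M = M := (hf2.v .M rfl).trans hs1.vM
  simp [e1, e2, e3]
  refine ⟨by omega, by omega, by omega, ⟨?_, ?_, ?_, ?_, ?_, ?_, ?_⟩, by omega⟩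
  · simp [hstr2]
  · intro i hlt
    rw [Function.update_of_ne (by omega), hstr2]
    simp only
    rw [if_pos (by omega), Nat.add_sub_cancel, hi, List.getD_eq_getElem _ _ (by simp; omega),
      List.getElem_append_left hlt]
  · rw [Function.update_of_ne (by omega), hstr2]; simp
  · intro i hlt
    rw [Function.update_of_ne (by omega), hstr2]
    simp only
    rw [if_neg (by omega), if_neg (by omega), if_pos (by omega), hi,
      List.getD_eq_getElem _ _ (by simp; omega), List.getElem_append_right (by omega)]
    congr 1; omega
  · simp
  · intro i hlt
    rw [Function.update_of_ne (by omega), hstr2]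
    simp only
    rw [if_neg (by omega), if_neg (by omega), if_neg (by omega)]
  · exact fun a ha => ⟨hl a ha, hA ▸ le_foldr_max ha⟩

end Prog
end Palcf

namespace Palcf

/-! ### Building the palindromic tree -/

/-- The palindromic tree held by the arrays of the program; `pos` is not stored. -/
def treeOf (s : Store) (pos : ℕ → ℕ) : PTree where
  cnt := s.v .cnt
  par := s.a .par
  ltr := s.a .ltr
  lam := s.a .lam
  lnk := s.a .lnk
  tab := s.a .tab
  pos := pos

theorem treeOf_congr {s s' : Store} {pos : ℕ → ℕ} (h : s'.v .cnt = s.v .cnt)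
    (h1 : s'.a .par = s.a .par) (h2 : s'.a .ltr = s.a .ltr) (h3 : s'.a .lam = s.a .lam)
    (h4 : s'.a .lnk = s.a .lnk) (h5 : s'.a .tab = s.a .tab) : treeOf s' pos = treeOf s pos := by
  simp [treeOf, h, h1, h2, h3, h4, h5]

/-- All centers below `k` have got their maximal palindromes. -/
def Settled (T : PTree) (S nd : ℕ → ℕ) (k : ℕ) : Prop := ∀ q, 1 ≤ q → q < k → T.MaxAt S q (nd q)

namespace Prog
open Cmd

variable {W M : ℕ} {x y : List ℕ} {A : ℕ} {pos : ℕ → ℕ} {S : ℕ → ℕ} {T : PTree}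

/-- One step along the suffix links settles the centers from that of `cur` up to that of its suffix
link. The centers advance by as much as the length of `cur` drops, which pays for the loop. -/
theorem run_retreat {s : Store} (hD : Dims W M x.length y.length A)
    (hM : s.v .M = M) (hT : T.Valid S (A + 3)) (hlam : s.a .lam = T.lam)
    (hlnk : s.a .lnk = T.lnk) (hR : s.v .R < x.length + y.length + 3)
    (hcur : 2 ≤ s.v .cur) (ho : T.Occ S (s.v .cur) (s.v .R))
    (hne : S (s.v .R - T.lam (s.v .cur)) ≠ S (s.v .R)) (hcnt : T.cnt < M)
    (hset : Settled T S (s.a .nd) (2 * s.v .R - T.lam (s.v .cur))) :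
    Run W M retreat s (fun s' => s'.v .cur = T.lnk (s.v .cur) ∧
      Settled T S (s'.a .nd) (2 * s.v .R - T.lam (s'.v .cur)) ∧
      s'.clk + T.lam (s'.v .cur) + 1 = s.clk + T.lam (s.v .cur)) := by
  have h1 := hD.len_le
  have h3 := hD.le
  have hl := hT.isLink hcur ho
  have hle := ho.le
  have hlt := hl.lt
  have hclt := ho.lt
  have hwlt := hl.occ.lt
  generalize hRR : s.v .R = R at *
  generalize hc : s.v .cur = c at *
  unfold retreat
  simp only [run_seq_iff, run_set_iff, run_put_iff]
  refine ⟨by simp [hlam, hM, hRR, hc]; omega, trivial, trivial, by simpa using hM,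
    by simp [hlam, hRR, hc]; omega, ?_, ?_, ?_⟩
  · simp [hc, hM]; omega
  · simp [hM, hlnk, hlam, hRR, hc]; omega
  apply run_for (fun j s1 => s1.clk = s.clk + (j - (2 * R - T.lam c + 1)) ∧
    Settled T S (s1.a .nd) j) (2 * R - T.lam c + 1) (2 * R - T.lam (T.lnk c)) rfl
  · simp [hlam, hRR, hc]; omega
  · simp [hlam, hRR, hc]
  · omega
  · omega
  · refine ⟨by simp, fun q hq hq' => ?_⟩
    simp only [Expr.eval_sub, Expr.eval_mul, Expr.eval_num, Expr.eval_var, Expr.eval_get, hlam, hRR,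
      hc, Function.update_self, ne_eq, reduceCtorEq, not_false_eq_true, Function.update_of_ne]
    by_cases h : q = 2 * R - T.lam c
    · subst h
      rw [Function.update_self]
      exact ⟨R, by omega, ho, hne⟩
    · rw [Function.update_of_ne h]
      exact hset q hq (by omega)
  · intro j s1 _ hj hf hi _
    have := hf.v .k2 rfl
    simp [hlam, hlnk, hRR, hc] at this
    simp [this, hi]
  · intro j s1 hj0 hj hf hi ⟨hclk, hset1⟩
    have hk := hf.v .k rfl
    have hM1 := hf.v .M rfl
    simp [hlam, hRR, hc] at hk hM1
    have hwl : 1 ≤ T.lam (T.lnk c) ∨ T.lam c = 1 := by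
      rcases Nat.eq_zero_or_pos (T.lam (T.lnk c)) with h0 | h0
      · refine Or.inr (le_antisymm ?_ (hT.lam_pos hcur hclt))
        by_contra hlt
        have := hl.max 1 (by omega) (pl_one (by omega))
        omega
      · exact Or.inl h0
    simp [hk, hM1, hM, hi]
    refine ⟨by omega, by omega, by omega, fun q hq hq' => ?_⟩
    by_cases h : q = j
    · subst h
      rw [Function.update_self]
      refine PTree.MaxAt.mirror hT hcur ho (by omega) (by omega) ?_
      exact hset1 _ (by omega) (by omega)
    · rw [Function.update_of_ne h]
      exact hset1 q hq (by omega)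
  · intro s1 hf _ ⟨hclk, hset1⟩
    have := hf.v .cur rfl
    simp [hlnk, hc] at this
    rw [this]
    exact ⟨rfl, hset1, by omega⟩

/-- The new node is the extension of `cur` by the letter at `R`. Its suffix link is the extension of
a shorter palindromic suffix, found by a second search that starts at the suffix link of `cur`; this
extension is a node already, as it has occurred before. The time of the search is paid by the drop
of the length of the suffix link. If `cur` is the virtual palindrome, the new node is a single
letter, and its suffix link is the empty palindrome. -/
theorem run_newNode {s : Store} (hD : Dims W M x.length y.length A)
    (hM : s.v .M = M) (hsg : s.v .sg = A + 3) (ha : s.v .a = S (s.v .R)) (hstr : s.a .str = S)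
    (hT : (treeOf s pos).Valid S (A + 3)) (hS : S (s.v .R) < A + 3) (h0 : S 0 ≠ S (s.v .R))
    (hR : s.v .R < x.length + y.length + 3) (hcnt : s.v .cnt ≤ s.v .R + 2)
    (hC : (treeOf s pos).Complete S (s.v .R))
    (ho : (treeOf s pos).Occ S (s.v .cur) (s.v .R))
    (hp : Pl S (s.v .R + 1) (s.a .lam (s.v .cur) + 2))
    (hkey : s.v .key = s.v .cur * (A + 3) + S (s.v .R)) (_ : s.a .tab (s.v .key) = 0) :
    Run W M newNode s (fun s' => ∃ w, treeOf s' (Function.update pos (s.v .cnt) (s.v .R + 1)) =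
        (treeOf s pos).insert S (A + 3) (s.v .R) (s.v .cur) w ∧
      (treeOf s pos).IsLink S (s.v .R + 1) (s.a .lam (s.v .cur) + 2) w ∧
      (s.v .cur = 1 ∧ s'.clk = s.clk ∨ 2 ≤ s.v .cur ∧
        s'.clk + s.a .lam w ≤ s.clk + s.a .lam (s.a .lnk (s.v .cur)) + 2)) := by
  have h1 := hD.len_le
  have h2 := hD.letter_le
  have h3 := hD.le
  have hlt : s.v .cur < s.v .cnt := ho.lt
  have hle : s.a .lam (s.v .cur) ≤ s.v .R := ho.le
  have htlt : ∀ v, v < s.v .cnt → v * (A + 3) + S (s.v .R) < M :=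
    fun v hv => hD.tab_lt (by omega) hS
  have htc := htlt _ hlt
  -- the state after the suffix link has been found
  suffices key : ∀ s1 : Store, ∀ w, (treeOf s1 pos) = { treeOf s pos with
        lnk := Function.update (s.a .lnk) (s.v .cnt) w } → s1.v .M = M → s1.v .a = s.v .a →
      s1.v .cur = s.v .cur → s1.v .key = s.v .key →
      (treeOf s pos).IsLink S (s.v .R + 1) (s.a .lam (s.v .cur) + 2) w →
      (s.v .cur = 1 ∧ s1.clk = s.clk ∨ 2 ≤ s.v .cur ∧
        s1.clk + s.a .lam w ≤ s.clk + s.a .lam (s.a .lnk (s.v .cur)) + 2) →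
      Run W M (put .par (.var .cnt) (.var .cur) ;; put .ltr (.var .cnt) (.var .a) ;;
        put .lam (.var .cnt) (.get .lam (.var .cur) + 2) ;; put .tab (.var .key) (.var .cnt) ;;
        set .cnt (.var .cnt + 1)) s1
      (fun s' => ∃ w, treeOf s' (Function.update pos (s.v .cnt) (s.v .R + 1)) =
        (treeOf s pos).insert S (A + 3) (s.v .R) (s.v .cur) w ∧
      (treeOf s pos).IsLink S (s.v .R + 1) (s.a .lam (s.v .cur) + 2) w ∧
      (s.v .cur = 1 ∧ s'.clk = s.clk ∨ 2 ≤ s.v .cur ∧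
        s'.clk + s.a .lam w ≤ s.clk + s.a .lam (s.a .lnk (s.v .cur)) + 2)) by
    unfold newNode
    refine run_seq (run_ite (by simp; omega) (fun hc => ?_) (fun hc => ?_))
    · simp only [Cond.holds, Expr.eval_var, Expr.eval_num] at hc
      refine run_put (by simp) (by simp; omega) hM (by simp; omega) ?_
      refine key _ 2 rfl hM rfl rfl rfl ?_ (Or.inl ⟨hc, rfl⟩)
      have hl1 : s.a .lam 1 = 0 := hT.lam1
      have hl2 : s.a .lam 2 = 1 := hT.lam2
      refine ⟨⟨by omega, hT.cnt, ?_, ?_⟩, ?_, fun l hl _ => ?_⟩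
      · show Pl S _ (s.a .lam 2)
        rw [hl2]; exact pl_one (by omega)
      · show Same S _ _ (s.a .lam 2)
        rw [hl2]; exact fun t ht => by omega
      · show s.a .lam 2 < _
        rw [hl2]; omega
      · show l ≤ s.a .lam 2
        rw [hl2]
        rw [hc, hl1] at hl
        omega
    · simp only [Cond.holds, Expr.eval_var, Expr.eval_num] at hc
      have hc2 : 2 ≤ s.v .cur := by have : 1 ≤ s.v .cur := ho.pos; omega
      have hlk := hT.isLink hc2 ho
      have hlklt : s.a .lam (s.a .lnk (s.v .cur)) < s.a .lam (s.v .cur) := hlk.lt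
      refine run_seq (run_set (by simp [hM]; omega) (run_seq ?_))
      simp only [Expr.eval_get, Expr.eval_var]
      refine run_loop (fun s1 => (treeOf s pos).Search S (s.v .R) (s.a .lam (s.v .cur)) (s1.v .t) ∧
        s.a .lam (s1.v .t) < s.a .lam (s.v .cur) ∧
        s1.clk + s.a .lam (s1.v .t) ≤ s.clk + s.a .lam (s.a .lnk (s.v .cur)))
        (fun s1 => s.a .lam (s1.v .t)) ?_ ?_
      · simp only [Function.update_self]
        exact ⟨⟨hlk.occ, fun l hl hpl => hlk.max l hl (pl_succ.1 hpl).1⟩, hlk.lt, le_rfl⟩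
      · intro s1 hf ⟨hs, hlt1, hck⟩
        have hle1 : s.a .lam (s1.v .t) ≤ s.v .R := hs.occ.le
        have htcnt : s1.v .t < s.v .cnt := hs.occ.lt
        have e1 := hf.v .R rfl
        have e2 := hf.v .a rfl
        have e3 := hf.v .M rfl
        have e4 := hf.v .cnt rfl
        have e5 := hf.v .sg rfl
        have a1 := hf.a .lam rfl
        have a2 := hf.a .str rfl
        have a3 := hf.a .tab rfl
        have a4 := hf.a .lnk rfl
        have a5 := hf.a .par rfl
        have a6 := hf.a .ltr rfl
        have e6 := hf.v .cur rfl
        have e7 := hf.v .key rfl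
        simp at e1 e2 e3 e4 e5 e6 e7 a1 a2 a3 a4 a5 a6
        have hmul : s1.v .t * (A + 3) + S (s.v .R) < M := htlt _ htcnt
        refine ⟨?_, ?_, ?_⟩
        · simp [mismatch, e1, e3, hM, a1]; omega
        · intro hh
          simp [mismatch, e1, e2, ha, a1, a2, hstr] at hh
          obtain ⟨h2, hs', hlt'⟩ := hs.next hT hh
          have hlt'' : s.a .lam (s.a .lnk (s1.v .t)) < s.a .lam (s1.v .t) := hlt'
          refine run_set (by simp [e3, hM]; omega) ?_
          simp only [Expr.eval_get, Expr.eval_var, Function.update_self, a4]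
          exact ⟨⟨hs', by omega, by omega⟩, hlt''⟩
        · intro hh
          simp [mismatch, e1, e2, ha, a1, a2, hstr] at hh
          have hex := hs.extends hh h0
          have hch := hC.child_ne_zero hT hp hs.occ hex hlt1
          obtain ⟨c3, clam, cocc⟩ := hT.child hch hS hs.occ hex
          have clam' : s.a .lam (s.a .tab (s1.v .t * (A + 3) + S (s.v .R))) =
            s.a .lam (s1.v .t) + 2 := clam
          refine run_put (by simp) (by simp [e2, e3, e5, hM, hsg, ha]; omega) (by rw [e3, hM])
            (by simp [e4]; omega) ?_
          refine key _ (s.a .tab (s1.v .t * (A + 3) + S (s.v .R))) ?_ (by rw [← hM, ← e3]) e2 e6 e7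
            ⟨cocc, ?_, fun l hl hpl => ?_⟩ (Or.inr ⟨hc2, ?_⟩)
          · simp [treeOf, e2, e4, e5, hsg, ha, a1, a3, a4, a5, a6]
          · show s.a .lam (s.a .tab _) < _
            omega
          · refine le_trans ?_ clam.ge
            rcases Nat.lt_or_ge l 2 with hl2 | hl2
            · omega
            · have := hs.max (l - 2) (by omega) (by rwa [Nat.sub_add_cancel hl2])
              omega
          · rw [clam']; simp only; omega
  intro s1 w ht hM1 ha1 hcur1 hkey1 hlink hclk
  simp only [treeOf, PTree.mk.injEq] at ht
  obtain ⟨t1, t2, t3, t4, t5, t6, -⟩ := ht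
  simp [hM1, ha1, hcur1, hkey1, t1, t4]
  refine ⟨by omega, by omega, by omega, by omega, ⟨by omega, by omega⟩, w, ?_, hlink, hclk⟩
  simp [treeOf, PTree.insert, t2, t3, t5, t6, hkey, ha]

/-- The loop invariant: the tree of the prefix before `R` is complete, `cur` is its longest
palindromic suffix, and all centers on the left of the center of `cur` are settled. The clock is
bounded with the lengths of `cur` and of its suffix link as potential. -/
structure Built (S : ℕ → ℕ) (sg c0 R : ℕ) (pos : ℕ → ℕ) (s : Store) : Prop where
  valid : (treeOf s pos).Valid S sg
  complete : (treeOf s pos).Complete S R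
  top : (treeOf s pos).IsTop S R (s.v .cur)
  two_le : 2 ≤ s.v .cur
  cnt_le : s.v .cnt ≤ R + 2
  settled : Settled (treeOf s pos) S (s.a .nd) (2 * R - s.a .lam (s.v .cur))
  clk : s.clk + s.a .lam (s.v .cur) + s.a .lam (s.a .lnk (s.v .cur)) ≤ c0 + 5 * R

/-- One more letter of the text: the search by `retreat` loses as much length of `cur` as it takes
time, the second search loses as much length of the suffix link, and each of these lengths grows by
at most two. -/
theorem run_build_step {s : Store} {c0 R : ℕ} (hD : Dims W M x.length y.length A)
    (hs : Consts M x.length y.length A s) (hstr : s.a .str = S) (hS : IsText x y A S)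
    (hvR : s.v .R = R) (hR1 : 1 ≤ R) (hR : R < x.length + y.length + 3)
    (h : Built S (A + 3) c0 R pos s) :
    Run W M (set .a (.get .str (.var .R)) ;; loop (mismatch .cur) retreat ;;
      set .key (.var .cur * .var .sg + .var .a) ;;
      ite (.eq (.get .tab (.var .key)) 0) newNode skip ;; set .cur (.get .tab (.var .key)))
      { s with clk := s.clk + 1 } (fun s' => ∃ pos, Built S (A + 3) c0 (R + 1) pos s') := by
  have h1 := hD.len_le
  have h2 := hD.letter_le
  have h3 := hD.le
  have hSR := hS.lt R
  have hS0 := hS.ne_zero hR1 hR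
  have hcnt := h.cnt_le
  have hT := h.valid
  refine run_seq (run_set (by simp [hvR, hs.vM]; omega) (run_seq ?_))
  simp only [Expr.eval_get, Expr.eval_var, hstr, hvR]
  refine run_loop (fun s1 => (treeOf s pos).Search S R R (s1.v .cur) ∧
    Settled (treeOf s pos) S (s1.a .nd) (2 * R - s.a .lam (s1.v .cur)) ∧
    s1.clk + s.a .lam (s1.v .cur) ≤ s.clk + 1 + s.a .lam (s.v .cur) ∧
    (2 ≤ s1.v .cur → s.a .lam (s.a .lnk (s1.v .cur)) ≤ s.a .lam (s.a .lnk (s.v .cur))))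
    (fun s1 => s.a .lam (s1.v .cur)) ?_ ?_
  · simp only [ne_eq, reduceCtorEq, not_false_eq_true, Function.update_of_ne]
    exact ⟨h.top.search R, h.settled, le_rfl, fun _ => le_rfl⟩
  intro s1 hf ⟨hsr, hset, hclk, hlk⟩
  have e1 : s1.v .R = R := by rw [hf.v .R rfl]; simpa using hvR
  have e2 : s1.v .a = S R := by rw [hf.v .a rfl]; simp
  have e3 : s1.v .M = M := by rw [hf.v .M rfl]; simpa using hs.vM
  have e4 : s1.v .cnt = s.v .cnt := by rw [hf.v .cnt rfl]; simp
  have e5 : s1.v .sg = A + 3 := by rw [hf.v .sg rfl]; simpa using hs.vsg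
  have a1 : s1.a .lam = s.a .lam := by rw [hf.a .lam rfl]
  have a2 : s1.a .str = S := by rw [hf.a .str rfl, hstr]
  have a3 : s1.a .lnk = s.a .lnk := by rw [hf.a .lnk rfl]
  have a4 : s1.a .par = s.a .par := by rw [hf.a .par rfl]
  have a5 : s1.a .ltr = s.a .ltr := by rw [hf.a .ltr rfl]
  have a6 : s1.a .tab = s.a .tab := by rw [hf.a .tab rfl]
  have ht1 : treeOf s1 pos = treeOf s pos := treeOf_congr e4 a4 a5 a1 a3 a6
  have hle : s.a .lam (s1.v .cur) ≤ R := hsr.occ.le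
  have hclt : s1.v .cur < s.v .cnt := hsr.occ.lt
  refine ⟨by simp [mismatch, e1, e3, a1]; omega, fun hh => ?_, fun hh => ?_⟩
  · simp [mismatch, e1, e2, a1, a2] at hh
    obtain ⟨hc2, hsr', hlt'⟩ := hsr.next hT hh
    have hlt'' : s.a .lam (s.a .lnk (s1.v .cur)) < s.a .lam (s1.v .cur) := hlt'
    refine (run_retreat (s := { s1 with clk := s1.clk + 1 }) (A := A) (T := treeOf s pos)
      (S := S) hD e3 hT a1 a3
      (by show s1.v .R < _; rw [e1]; omega) hc2
      (by show PTree.Occ _ _ _ (s1.v .R); rw [e1]; exact hsr.occ)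
      (by show S (s1.v .R - s.a .lam (s1.v .cur)) ≠ S (s1.v .R); rw [e1]; exact hh)
      (show s.v .cnt < M by omega)
      (by show Settled _ _ _ (2 * s1.v .R - s.a .lam (s1.v .cur)); rw [e1]; exact hset)).mono ?_
    rintro s2 ⟨hcur, hset2, hclk2⟩
    simp only [treeOf] at hcur hclk2 hset2
    rw [hcur] at hclk2 hset2 ⊢
    refine ⟨⟨hsr', by rw [← e1]; exact hset2, by omega, fun hge => ?_⟩, hlt''⟩
    have := (hT.isLink hge hsr'.occ).lt
    simp only [treeOf] at this
    have := hlk hc2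
    omega
  · simp [mismatch, e1, e2, a1, a2] at hh
    have hex := hsr.extends hh hS0
    have hex' : Pl S (R + 1) (s.a .lam (s1.v .cur) + 2) := hex
    have htab : s1.v .cur * (A + 3) + S R < M := hD.tab_lt (by omega) hSR
    have hmul : s1.v .cur * (A + 3) < M := by omega
    refine run_seq (run_set (by simp [e2, e5]; omega) (run_seq ?_))
    simp only [Expr.eval_add, Expr.eval_mul, Expr.eval_var, e2, e5]
    refine run_ite (by simp [e3]; omega) (fun h0 => ?_) (fun h0 => run_skip ?_)
    · simp [a6] at h0
      set s2 : Store := { s1 with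
        v := Function.update s1.v .key (s1.v .cur * (A + 3) + S R) } with hs2
      have ht2 : treeOf s2 pos = treeOf s pos := by rw [← ht1]; simp [treeOf, s2]
      have hrun := run_newNode (A := A) (s := s2) (pos := pos) (S := S) hD (by simpa [s2] using e3)
        (by simpa [s2] using e5) (by simpa [s2, e1] using e2) (by simpa [s2] using a2)
        (by rw [ht2]; exact hT) (by simpa [s2, e1] using hSR) (by simpa [s2, e1] using hS0)
        (by simpa [s2, e1] using hR) (by simpa [s2, e1, e4] using hcnt)
        (by rw [ht2]; simpa [s2, e1] using h.complete)
        (by rw [ht2]; simpa [s2, e1] using hsr.occ)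
        (by simpa [s2, e1, a1] using hex') (by simp [s2, e1]) (by simpa [s2, a6] using h0)
      refine hrun.frame ?_
      rintro s3 hf3 - ⟨w, ht3, hlink, hclk3⟩
      rw [ht2] at ht3 hlink
      simp [s2, e1, e4, a1, a3] at ht3 hlink hclk3
      have b1 : s3.v .key = s1.v .cur * (A + 3) + S R := by rw [hf3.v .key rfl]; simp [s2]
      have b2 : s3.v .M = M := by rw [hf3.v .M rfl]; simpa [s2] using e3
      have b3 : s3.v .R = R := by rw [hf3.v .R rfl]; simpa [s2] using e1
      have c1 : s3.a .tab (s1.v .cur * (A + 3) + S R) = s.v .cnt := by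
        have := congrArg PTree.tab ht3
        simp only [treeOf, PTree.insert] at this
        rw [this, Function.update_self]
      have c2 := congrArg PTree.lam ht3
      have c3 := congrArg PTree.lnk ht3
      have c4 := congrArg PTree.cnt ht3
      simp only [treeOf, PTree.insert] at c2 c3 c4
      have hw : w < s.v .cnt := hlink.occ.lt
      have hlw : s.a .lam w < s.a .lam (s1.v .cur) + 2 := hlink.lt
      refine run_set (by simp [b1, b2]; omega) ?_
      simp only [Expr.eval_get, Expr.eval_var, b1, c1]
      refine ⟨Function.update pos (s.v .cnt) (R + 1), ?_⟩
      have ht4 : ∀ v', treeOf { s3 with v := Function.update s3.v .cur v' }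
          (Function.update pos (s.v .cnt) (R + 1)) =
          (treeOf s pos).insert S (A + 3) R (s1.v .cur) w := by
        intro v'
        rw [← ht3]
        simp [treeOf]
      have hV : ((treeOf s pos).insert S (A + 3) R (s1.v .cur) w).Valid S (A + 3) :=
        hT.insert h0 hSR hsr.occ hex hlink
      have htop : ((treeOf s pos).insert S (A + 3) R (s1.v .cur) w).IsTop S (R + 1) (s.v .cnt) := by
        refine ⟨PTree.occ_insert hex hT.cnt, fun l hl => ?_⟩
        have he : ((treeOf s pos).insert S (A + 3) R (s1.v .cur) w).lam (s.v .cnt) =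
          s.a .lam (s1.v .cur) + 2 := by simp [PTree.insert, treeOf]
        rw [he]
        rcases Nat.lt_or_ge l 2 with h2l | h2l
        · omega
        · have := hl.1
          have h5 : l - 2 ≤ s.a .lam (s1.v .cur) :=
            hsr.max (l - 2) (by omega) (by rwa [Nat.sub_add_cancel h2l])
          omega
      have hc3 : 3 ≤ s.v .cnt := hT.cnt
      refine ⟨?_, ?_, ?_, ?_, ?_, ?_, ?_⟩
      · rw [ht4]; exact hV
      · rw [ht4]; exact (h.complete.insert).succ htop
      · rw [ht4]; simpa using htop
      · simp only [Function.update_self]; omega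
      · simp [c4]; omega
      · rw [ht4]
        simp only [Function.update_self, c2]
        have hnd : s3.a .nd = s1.a .nd := hf3.a .nd rfl
        rw [hnd]
        intro q hq hq'
        exact (hset q hq (by omega)).insert
      · simp only [Function.update_self, c2, c3, Function.update_of_ne hw.ne]
        have := h.clk
        have h11 : s.a .lam 1 = 0 := hT.lam1
        rcases hclk3 with ⟨hc, hk⟩ | ⟨hc, hk⟩
        · rw [hc] at hlw ⊢
          omega
        · have := hlk hc
          omega
    · simp [a6] at h0
      obtain ⟨u3, ulam, uocc⟩ := hT.child h0 hSR hsr.occ hex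
      refine run_set (by simp [e3]; omega) ?_
      refine ⟨pos, ?_⟩
      simp only [Expr.eval_get, Expr.eval_var, Function.update_self, a6]
      have ht4 : ∀ f g, treeOf { s1 with
          v := Function.update (Function.update s1.v .key f) .cur g } pos = treeOf s pos := by
        intro f g
        rw [← ht1]
        simp [treeOf]
      have htop := hsr.isTop le_rfl uocc ulam
      have ulam' : s.a .lam (s.a .tab (s1.v .cur * (A + 3) + S R)) =
        s.a .lam (s1.v .cur) + 2 := ulam
      have u3' : 3 ≤ s.a .tab (s1.v .cur * (A + 3) + S R) := u3
      refine ⟨?_, ?_, ?_, ?_, ?_, ?_, ?_⟩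
      · rw [ht4]; exact hT
      · rw [ht4]; exact h.complete.succ htop
      · rw [ht4]; simp only [Function.update_self]; exact htop
      · simp only [Function.update_self]; omega
      · simp [e4]; omega
      · rw [ht4]
        simp only [Function.update_self, a1, ulam']
        intro q hq hq'
        exact hset q hq (by omega)
      · simp only [Function.update_self, a1, a3, ulam']
        have := h.clk
        have h11 : s.a .lam 1 = 0 := hT.lam1
        have hul := (hT.isLink (by omega) uocc).lt
        simp only [treeOf] at hul
        rcases Nat.lt_or_ge (s1.v .cur) 2 with hc | hc
        · have hp : 1 ≤ s1.v .cur := hsr.occ.pos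
          have hc1 : s1.v .cur = 1 := by omega
          rw [hc1] at hul ulam' ⊢
          omega
        · have h6 := hT.lam_lnk_le hc hsr.occ (by omega) uocc ulam
          simp only [treeOf] at h6
          have := hlk hc
          omega

/-- The last letter of the text occurs only once, so in the end the longest palindromic suffix has
length one, and all centers before the last position are settled. -/
theorem run_build {s : Store} (hD : Dims W M x.length y.length A)
    (hs : Consts M x.length y.length A s) (hstr : s.a .str = S) (hS : IsText x y A S)
    (hlam : ∀ i, s.a .lam i = 0) (htab : ∀ i, s.a .tab i = 0) :
    Run W M build s (fun s' => ∃ pos, (treeOf s' pos).Valid S (A + 3) ∧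
      s'.v .cnt ≤ x.length + y.length + 5 ∧
      Settled (treeOf s' pos) S (s'.a .nd) (2 * (x.length + y.length + 2)) ∧
      s'.clk ≤ s.clk + 5 * (x.length + y.length + 3)) := by
  have h1 := hD.len_le
  have h3 := hD.le
  unfold build
  simp only [run_seq_iff, run_put_iff, run_set_iff]
  refine ⟨by simp; omega, by simp; omega, hs.vM, by simp; omega, by simp; omega, by simp; omega,
    hs.vM, by simp; omega, by simp; omega, by simp; omega, ?_⟩
  apply run_for (fun R s1 => ∃ pos, Built S (A + 3) s.clk R pos s1) 1 (x.length + y.length + 3) rfl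
  · simp; omega
  · simp
  · omega
  · omega
  · refine ⟨fun _ => 1, ⟨le_rfl, ?_, ?_, le_rfl, ?_, ?_, ?_⟩, ?_, ⟨⟨?_, ?_, ?_, ?_⟩, ?_⟩, ?_, ?_,
        ?_, ?_⟩
    · simp [treeOf, hlam]
    · simp [treeOf]
    · intro u h3 hu; simp [treeOf] at hu; omega
    · intro i hi; simp [treeOf, htab] at hi
    · intro u h2 hu
      obtain rfl : u = 2 := by simp [treeOf] at hu; omega
      refine ⟨⟨?_, ?_, ?_, ?_⟩, ?_, ?_⟩
      · simp [treeOf]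
      · simp [treeOf]
      · simpa [treeOf, hlam] using pl_zero
      · intro t ht; simp [treeOf, hlam] at ht
      · simp [treeOf, hlam]
      · intro l hl _; simp [treeOf, hlam] at hl ⊢; omega
    · intro j hj l hl hp; have := hp.1; omega
    · simp
    · simp [treeOf]
    · simpa [treeOf] using pl_one le_rfl
    · intro t ht; simp [treeOf] at ht
    · intro l hl; simpa [treeOf] using hl.1
    · simp
    · simp
    · intro q hq hq'; simp at hq'; omega
    · simp [hlam]
  · intro j s1 _ hj hf hR _
    have := hf.v .N rfl
    simp [hs.vN] at this
    simp [hR, this]; omega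
  · intro R s1 hR1 hR hf hvR ⟨pos, hb⟩
    have hs1 := Consts.frame (n := x.length) (m := y.length) (A := A) ⟨by simpa using hs.vn,
      by simpa using hs.vm, by simpa using hs.vN, by simpa using hs.vA, by simpa using hs.vsg,
      by simpa using hs.vB, by simpa using hs.vM⟩ hf rfl
    refine (run_build_step hD hs1 ((hf.a .str rfl).trans (by simpa using hstr)) hS hvR hR1 hR
      hb).mono ?_
    rintro s2 ⟨pos', h⟩
    have ht : treeOf { s2 with v := Function.update s2.v .R (R + 1) } pos' = treeOf s2 pos' := by
      simp [treeOf]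
    exact ⟨pos', h.valid, h.complete, by rw [ht]; simpa using h.top, by simpa using h.two_le,
      by simpa using h.cnt_le, by rw [ht]; simpa using h.settled, by simpa using h.clk⟩
  · intro s1 hf _ ⟨pos, h⟩
    have hc := h.cnt_le
    have hk := h.clk
    refine ⟨pos, h.valid, by omega, ?_, by omega⟩
    have hle : s1.a .lam (s1.v .cur) ≤ 2 := by
      by_contra hgt
      have hp : Pl S (x.length + y.length + 3) (s1.a .lam (s1.v .cur)) := h.top.occ.pl
      have hpl := hp.1
      have := hp.reflect (p := x.length + y.length + 2) (by omega) (by omega)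
      have h1 := hS.cases (2 * (x.length + y.length + 3) - s1.a .lam (s1.v .cur) -
        (x.length + y.length + 2))
      rw [← this, hS.last] at h1
      omega
    intro q hq hq'
    exact h.settled q hq (by omega)

end Prog
end Palcf

namespace Palcf

/-! ### Maximal palindromes of the input strings -/

/-- The string `z` occurs in the text `S` at position `off`, between letters that occur only once.
For `off = 1` the letter on the left is the one at position `0`, where no palindrome starts. -/
structure IsBlock (S : ℕ → ℕ) (off : ℕ) (z : List ℕ) : Prop where
  pos : 1 ≤ off
  get : ∀ i (h : i < z.length), S (off + i) = z[i]
  right : ∀ i, S i = S (off + z.length) → i = off + z.length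
  left : off = 1 ∨ ∀ i, S i = S (off - 1) → i = off - 1

theorem IsText.block_left {x y : List ℕ} {A : ℕ} {S : ℕ → ℕ} (h : IsText x y A S) :
    IsBlock S 1 x := by
  refine ⟨le_rfl, fun i hi => by rw [Nat.add_comm, h.left i hi], fun i hi => ?_, Or.inl rfl⟩
  rw [Nat.add_comm 1, h.mid] at hi
  have := h.cases i
  omega

theorem IsText.block_right {x y : List ℕ} {A : ℕ} {S : ℕ → ℕ} (h : IsText x y A S) :
    IsBlock S (x.length + 2) y := by
  refine ⟨by omega, h.right, fun i hi => ?_, Or.inr fun i hi => ?_⟩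
  · rw [show x.length + 2 + y.length = x.length + y.length + 2 by omega, h.last] at hi
    have := h.cases i
    omega
  · rw [show x.length + 2 - 1 = x.length + 1 by omega, h.mid] at hi
    have := h.cases i
    omega

/-- The second half, including the central letter, of the palindrome of a node. These are the
strings that the paths of the tree spell. -/
def PTree.half (T : PTree) (S : ℕ → ℕ) (v : ℕ) : List ℕ :=
  (List.range (T.lam v / 2)).map fun t => S (T.pos v - T.lam v / 2 + t)

theorem PTree.length_half (T : PTree) (S : ℕ → ℕ) (v : ℕ) :
    (T.half S v).length = T.lam v / 2 := by simp [half]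

section
variable {T : PTree} {S : ℕ → ℕ} {off k v j i l : ℕ} {z : List ℕ}

/-- The half of a palindrome may be read off at any occurrence. -/
theorem PTree.Occ.half_eq (h : T.Occ S v j) (hp : T.lam v ≤ T.pos v) :
    T.half S v = (List.range (T.lam v / 2)).map fun t => S (j - T.lam v / 2 + t) := by
  refine List.map_congr_left fun t ht => ?_
  rw [List.mem_range] at ht
  have hle := h.le
  have := h.same (T.lam v / 2 - 1 - t) (by omega)
  rwa [show T.pos v - 1 - (T.lam v / 2 - 1 - t) = T.pos v - T.lam v / 2 + t by omega,
    show j - 1 - (T.lam v / 2 - 1 - t) = j - T.lam v / 2 + t by omega] at this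

/-- Palindromic factors of a block in the two notations: in the text they are given by their end,
and their length is shifted by one. -/
theorem IsBlock.isPal_iff (hB : IsBlock S off z) (h : i + l ≤ z.length) :
    IsPal (factor z i l) ↔ Pl S (off + i + l) (l + 1) := by
  have hg : ∀ t, t < z.length → z.getD t 0 = S (off + t) := fun t ht => by
    rw [List.getD_eq_getElem _ _ ht, hB.get t ht]
  have hp := hB.pos
  rw [isPal_factor_iff h]
  constructor
  · intro hp
    refine ⟨by omega, fun t ht => ?_⟩
    have := hp (l - 1 - t) (by omega)
    rw [hg _ (by omega), hg _ (by omega)] at this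
    rw [show off + i + l - 1 - t = off + (i + (l - 1 - t)) by omega, this]
    congr 1; omega
  · intro hp t ht
    rw [hg _ (by omega), hg _ (by omega)]
    have := hp.2 (l - 1 - t) (by omega)
    rw [show off + i + l - 1 - (l - 1 - t) = off + (i + t) by omega] at this
    rw [this]
    congr 1; omega

/-- A palindrome with its center in a block lies in the block. -/
theorem IsBlock.within (hB : IsBlock S off z) (hk : k + 1 < 2 * z.length) (hp : Pl S j l)
    (hj : 2 * j = k + 2 * off + l) : off + l ≤ j + 1 ∧ j ≤ off + z.length := by
  have hl := hp.1
  constructor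
  · by_contra hlt
    rcases hB.left with h | h
    · omega
    · have := h _ (hp.reflect (p := off - 1) (by omega) (by omega)).symm
      omega
  · by_contra hlt
    have := hB.right _ (hp.reflect (p := off + z.length) (by omega) (by omega)).symm
    omega

/-- The maximal palindromes of the text with centers in a block are those of the string in the
block. -/
theorem PTree.MaxAt.maxPalLen_eq (hB : IsBlock S off z) (hk : k + 1 < 2 * z.length)
    (h : T.MaxAt S (k + 2 * off) v) : 1 ≤ T.lam v ∧ maxPalLen z k = T.lam v - 1 := by
  obtain ⟨j, hj, ho, hne⟩ := h
  have hpos := hB.pos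
  have h1 : 1 ≤ T.lam v := by
    rcases Nat.eq_zero_or_pos (T.lam v) with h0 | h0
    · rw [h0] at hne; exact absurd rfl hne
    · exact h0
  have hin := hB.within hk ho.pl hj
  refine ⟨h1, le_antisymm ?_ (le_maxPalLen ⟨j + 1 - T.lam v - off, by omega, by omega, by omega,
      ?_⟩)⟩
  · by_contra hlt
    obtain ⟨i, _, h2, h3, h4⟩ := palAt_maxPalLen (x := z) (k := k) (by omega)
    set l := maxPalLen z k with hl
    rw [hB.isPal_iff h3] at h4
    -- a longer palindrome with the same center contains the extension by one letter
    have h5 : Pl S (j + 1) (T.lam v + 2) := by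
      refine Pl.shrink (d := off + i + l - (j + 1)) ?_
      rw [show j + 1 + (off + i + l - (j + 1)) = off + i + l by omega,
        show T.lam v + 2 + 2 * (off + i + l - (j + 1)) = l + 1 by omega]
      exact h4
    exact hne (pl_succ.1 h5).2.2
  · rw [hB.isPal_iff (by omega), show off + (j + 1 - T.lam v - off) + (T.lam v - 1) = j by omega,
      Nat.sub_add_cancel h1]
    exact ho.pl

/-- The piece of a center is the half of the palindrome of its node, so it is determined by the
node. -/
theorem PTree.MaxAt.factor_eq {sg : ℕ} (hT : T.Valid S sg) (hB : IsBlock S off z)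
    (hk : k + 1 < 2 * z.length) (h : T.MaxAt S (k + 2 * off) v) :
    factor z ((k + 1) / 2) (T.lam v / 2) = T.half S v := by
  have h1 := (h.maxPalLen_eq hB hk).1
  obtain ⟨j, hj, ho, hne⟩ := h
  have hin := hB.within hk ho.pl hj
  have hpos := hB.pos
  have hv : 2 ≤ v := by
    by_contra hlt
    have := ho.pos
    obtain rfl : v = 1 := by omega
    rw [hT.lam1] at h1; omega
  rw [ho.half_eq (hT.pos_ge hv ho.lt)]
  refine List.ext_getElem ?_ fun t h2 h3 => ?_
  · rw [length_factor (by omega)]; simp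
  · rw [getElem_factor]
    rw [length_factor (by omega)] at h2
    rw [List.getElem_map, List.getElem_range, List.getD_eq_getElem _ _ (by omega), ← hB.get]
    congr 1; omega

end

/-! ### Output of the maximal palindromes and of the pieces -/

/-- The array `f` starts with the list `l`. -/
def Holds (f : ℕ → ℕ) (l : List ℕ) : Prop := ∀ i (h : i < l.length), f i = l[i]

theorem Holds.snoc {f : ℕ → ℕ} {l : List ℕ} {a : ℕ} (h : Holds f l) :
    Holds (Function.update f l.length a) (l ++ [a]) := fun j hj => by
  rcases Nat.lt_or_ge j l.length with h1 | h1
  · rw [Function.update_of_ne (by omega), List.getElem_append_left h1]; exact h j h1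
  · obtain rfl : j = l.length := by simp at hj; omega
    simp

theorem encode_append (l l' : List Piece) : encode (l ++ l') = encode l ++ encode l' := by
  simp [encode]

theorem length_encode (l : List Piece) : (encode l).length = 3 * l.length := by
  induction l with
  | nil => rfl
  | cons f l ih =>
    have : (encode (f :: l)).length = 3 + (encode l).length := by simp [encode]; omega
    rw [this, ih, List.length_cons]; ring

/-- The state after the construction of the tree. -/
structure TreeState (M : ℕ) (x y : List ℕ) (A : ℕ) (pos : ℕ → ℕ) (s : Store) : Prop where
  consts : Consts M x.length y.length A s
  text : IsText x y A (s.a .str)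
  valid : (treeOf s pos).Valid (s.a .str) (A + 3)
  cnt_le : s.v .cnt ≤ x.length + y.length + 5
  settled : Settled (treeOf s pos) (s.a .str) (s.a .nd) (2 * (x.length + y.length + 2))

theorem TreeState.frame {M A : ℕ} {x y : List ℕ} {pos : ℕ → ℕ} {c : Cmd} {s s' : Store}
    (h : TreeState M x y A pos s) (hf : c.Frame s s')
    (hc : (c.writesV .n || c.writesV .m || c.writesV .N || c.writesV .A || c.writesV .sg ||
      c.writesV .B || c.writesV .M) = false) (hcnt : c.writesV .cnt = false)
    (ha : (c.writesA .str || c.writesA .nd || c.writesA .lam || c.writesA .lnk || c.writesA .par ||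
      c.writesA .ltr || c.writesA .tab) = false) : TreeState M x y A pos s' := by
  simp only [Bool.or_eq_false_iff] at ha
  obtain ⟨⟨⟨⟨⟨⟨h1, h2⟩, h3⟩, h4⟩, h5⟩, h6⟩, h7⟩ := ha
  have ht : treeOf s' pos = treeOf s pos := treeOf_congr (hf.v _ hcnt) (hf.a _ h5) (hf.a _ h6)
    (hf.a _ h3) (hf.a _ h4) (hf.a _ h7)
  have e1 := hf.a _ h1
  have e2 := hf.a _ h2
  refine ⟨h.consts.frame hf hc, by rw [e1]; exact h.text, by rw [ht, e1]; exact h.valid,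
    by rw [hf.v _ hcnt]; exact h.cnt_le, by rw [ht, e1, e2]; exact h.settled⟩

theorem TreeState.node {M A : ℕ} {x y : List ℕ} {pos : ℕ → ℕ} {s : Store}
    (h : TreeState M x y A pos s) {q : ℕ} (h1 : 1 ≤ q) (h2 : q < 2 * (x.length + y.length + 2)) :
    1 ≤ s.a .nd q ∧ s.a .nd q < s.v .cnt := by
  obtain ⟨j, -, ho, -⟩ := h.settled q h1 h2
  exact ⟨ho.pos, ho.lt⟩

namespace Prog
open Cmd

variable {W M A : ℕ} {x y : List ℕ} {pos : ℕ → ℕ}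

theorem run_palLens {s : Store} {P : Arr} {offE lenE : Expr} {off : ℕ} {z : List ℕ}
    (hD : Dims W M x.length y.length A) (hs : TreeState M x y A pos s)
    (hB : IsBlock (s.a .str) off z) (hz : off + z.length ≤ x.length + y.length + 2)
    (hP : P = .palX ∨ P = .palY)
    (hoff : ∀ s1 : Store, Consts M x.length y.length A s1 → offE.ok W M s1 ∧ offE.eval s1 = off)
    (hlen : ∀ s1 : Store, Consts M x.length y.length A s1 →
      lenE.ok W M s1 ∧ lenE.eval s1 = z.length) :
    Run W M (palLens P offE lenE) s (fun s' => Holds (s'.a P) (maxPals z) ∧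
      s'.clk ≤ s.clk + 2 * z.length) := by
  have h1 := hD.len_le
  have h3 := hD.le
  have hpos := hB.pos
  have hw : ∀ B : Arr, B ≠ P → (palLens P offE lenE).writesA B = false := by
    intro B hBP
    simp [palLens, for_, writesA, Ne.symm hBP]
  unfold palLens
  apply run_for (fun j s1 => s1.clk = s.clk + j ∧ ∀ i < j, s1.a P i = maxPalLen z i) 0
    (2 * z.length - 1) rfl
  · simp; omega
  · simp
  · omega
  · omega
  · simp
  · intro j s1 _ hj hf hi _
    have hc := hs.consts.frame hf rfl
    obtain ⟨a, b⟩ := hlen s1 hc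
    simp [a, b, hi]; omega
  · intro j s1 _ hj hf hi ⟨hclk, hpal⟩
    have hc := hs.consts.frame hf rfl
    obtain ⟨a, b⟩ := hoff _ (hc.frame (c := .skip) (s' := { s1 with clk := s1.clk + 1 })
      ⟨fun _ _ => rfl, fun _ _ => rfl⟩ rfl)
    have e1 : s1.a .nd = s.a .nd := hf.a _ (hw _ (by rcases hP with rfl | rfl <;> simp))
    have e2 : s1.a .lam = s.a .lam := hf.a _ (hw _ (by rcases hP with rfl | rfl <;> simp))
    have hn := hs.node (q := j + 2 * off) (by omega) (by omega)
    have hcnt := hs.cnt_le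
    obtain ⟨hl1, hl2⟩ :=
      (hs.settled (j + 2 * off) (by omega) (by omega)).maxPalLen_eq hB (by omega)
    simp only [treeOf] at hl1 hl2
    simp [a, b, hi, hc.vM, e1, e2]
    refine ⟨by omega, by omega, by omega, fun i hij => ?_⟩
    rcases Nat.lt_or_ge i j with h | h
    · rw [Function.update_of_ne (by omega), hpal i h]
    · obtain rfl : i = j := by omega
      rw [Function.update_self, hl2]
  · intro s1 hf hi ⟨hclk, hpal⟩
    refine ⟨fun i hi => ?_, by omega⟩
    simp only [maxPals, List.length_map, List.length_range] at hi
    rw [hpal i hi]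
    simp [maxPals]

/-- The array `P` holds the list `l`, and the pieces of the string `z` are appended. For odd lengths
`c = 0`, for even lengths `c = 1`. -/
theorem run_putPieces {s : Store} {P : Arr} {src c len sh off : ℕ} {shE : Expr} {g : Cond}
    {l : List Piece} {z : List ℕ} (hD : Dims W M x.length y.length A)
    (hs : TreeState M x y A pos s) (hB : IsBlock (s.a .str) off z)
    (hz : off + z.length ≤ x.length + y.length + 2)
    (hP : P = .oddF ∨ P = .evenF) (hsrc : src ≤ 1) (hc1 : c ≤ 1)
    (hsh : ∀ s1 : Store, Consts M x.length y.length A s1 → shE.ok W M s1 ∧ shE.eval s1 = sh)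
    (hsh' : sh = c + 2 * off)
    (hg : ∀ s1 : Store, Consts M x.length y.length A s1 → s1.v .i ≤ len →
      g.ok W M s1 ∧ (g.holds s1 ↔ s1.v .i < len))
    (hlen : len = z.length - c) (hp : s.v .pos = 3 * l.length) (hl : l.length ≤ x.length)
    (hH : Holds (s.a P) (encode l)) :
    Run W M (putPieces P src c shE g) s (fun s' =>
      Holds (s'.a P) (encode (l ++ (List.range len).map fun i =>
        ⟨src, i + c, (maxPalLen z (2 * i + c) + 1) / 2⟩)) ∧
      s'.v .pos = 3 * (l.length + len) ∧ s'.clk ≤ s.clk + len) := by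
  have h1 := hD.len_le
  have h3 := hD.le
  have hpos := hB.pos
  have hw : ∀ B : Arr, B ≠ P → (putPieces P src c shE g).writesA B = false := by
    intro B hBP
    simp [putPieces, for_, writesA, Ne.symm hBP]
  unfold putPieces
  apply run_for (fun j s1 => s1.clk = s.clk + j ∧ s1.v .pos = 3 * (l.length + j) ∧
    Holds (s1.a P) (encode (l ++ (List.range j).map fun i =>
        ⟨src, i + c, (maxPalLen z (2 * i + c) + 1) / 2⟩))) 0 len rfl
  · simp; omega
  · simp
  · omega
  · omega
  · simpa using ⟨hp, hH⟩
  · intro j s1 _ hj hf hi _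
    rw [← hi] at hj ⊢
    exact hg s1 (hs.consts.frame hf rfl) hj
  · intro j s1 _ hj hf hi ⟨hclk, hpos1, hH1⟩
    have hc := hs.consts.frame hf rfl
    have hsh2 := fun (a : Arr → ℕ → ℕ) (k : ℕ) => hsh { s1 with a := a, clk := k }
      (hc.frame (c := .skip) (s' := { s1 with a := s1.a, clk := k })
        ⟨fun _ _ => rfl, fun _ _ => rfl⟩ rfl |> fun h => ⟨h.vn, h.vm, h.vN, h.vA, h.vsg, h.vB,
            h.vM⟩)
    have e1 : s1.a .nd = s.a .nd := hf.a _ (hw _ (by rcases hP with rfl | rfl <;> simp))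
    have e2 : s1.a .lam = s.a .lam := hf.a _ (hw _ (by rcases hP with rfl | rfl <;> simp))
    have p1 : Arr.nd ≠ P := by rcases hP with rfl | rfl <;> simp
    have p2 : Arr.lam ≠ P := by rcases hP with rfl | rfl <;> simp
    have hn := hs.node (q := 2 * j + sh) (by omega) (by omega)
    have hcnt := hs.cnt_le
    have hset := hs.settled (2 * j + sh) (by omega) (by omega)
    rw [hsh', ← Nat.add_assoc] at hset
    obtain ⟨hl1, hl2⟩ := hset.maxPalLen_eq hB (by omega)
    rw [Nat.add_assoc, ← hsh'] at hl1 hl2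
    simp only [treeOf] at hl1 hl2
    simp [hsh2, hi, hc.vM, e1, e2, hpos1, p1, p2]
    refine ⟨by omega, by omega, by omega, by omega, by omega, by omega, by omega, by omega,
      by omega, by omega, by omega, ?_⟩
    have hlen1 : 3 * (l.length + j) = (encode (l ++ (List.range j).map fun i =>
        (⟨src, i + c, (maxPalLen z (2 * i + c) + 1) / 2⟩ : Piece))).length := by
      rw [length_encode]; simp
    rw [List.range_succ, List.map_append, ← List.append_assoc, encode_append]
    have e : encode ([j].map fun i => (⟨src, i + c, (maxPalLen z (2 * i + c) + 1) / 2⟩ : Piece)) =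
        [src] ++ [j + c] ++ [s.a .lam (s.a .nd (2 * j + sh)) / 2] := by
      simp [encode]
      omega
    rw [e, ← List.append_assoc, ← List.append_assoc, hlen1]
    have := ((hH1.snoc (a := src)).snoc (a := j + c)).snoc
      (a := s.a .lam (s.a .nd (2 * j + sh)) / 2)
    simpa using this
  · intro s1 hf hi ⟨hclk, hpos1, hH1⟩
    exact ⟨hH1, hpos1, by omega⟩

/-- The initial store: the input, the lengths of the strings, and zeros. -/
structure Initial (x y : List ℕ) (s : Store) : Prop where
  out0 : s.v .out0 = x.length
  out1 : s.v .out1 = y.length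
  inp : ∀ i, s.a .inp i = (x ++ y).getD i 0
  zero : ∀ B, B ≠ .inp → ∀ i, s.a B i = 0

theorem run_step1 {s : Store} (hD : Dims W M x.length y.length (maxLetter x y))
    (hs : Initial x y s) (hl : ∀ a ∈ x ++ y, 1 ≤ a) :
    Run W M step1 s (fun s' => (∃ pos, TreeState M x y (maxLetter x y) pos s') ∧
      Holds (s'.a .palX) (maxPals x) ∧ Holds (s'.a .palY) (maxPals y) ∧
      s'.v .out0 = Arr.palX.idx * M ∧ s'.v .out1 = Arr.palY.idx * M ∧
      s'.clk ≤ s.clk + 9 * (x.length + y.length + 3)) := by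
  have h1 := hD.len_le
  have h3 := hD.le
  unfold step1
  refine run_seq ((run_sizes hD hs.out0 hs.out1 hs.inp).frame fun s1 f1 _ ⟨c1, k1⟩ => ?_)
  refine run_seq ((run_sentinels hD c1 hl (fun i => by rw [f1.a .inp rfl]; exact hs.inp i)
    (fun i => by rw [f1.a .str rfl]; exact hs.zero _ (by simp) i)).frame
      fun s2 f2 _ ⟨t2, k2⟩ => ?_)
  have c2 := c1.frame f2 rfl
  refine run_seq ((run_build hD c2 rfl t2
    (fun i => by rw [f2.a .lam rfl, f1.a .lam rfl]; exact hs.zero _ (by simp) i)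
    (fun i => by rw [f2.a .tab rfl, f1.a .tab rfl]; exact hs.zero _ (by simp) i)).frame
      fun s3 f3 _ ⟨pos, v3, n3, m3, k3⟩ => ?_)
  have e3 : s3.a .str = s2.a .str := f3.a .str rfl
  have hT3 : TreeState M x y (maxLetter x y) pos s3 :=
    ⟨c2.frame f3 rfl, by rw [e3]; exact t2, by rw [e3]; exact v3, n3, by rw [e3]; exact m3⟩
  refine run_seq ((run_palLens (P := .palX) (lenE :=
      .var .n) hD hT3 hT3.text.block_left (by omega) (by simp)
    (fun s1 _ => ⟨by simp; omega, rfl⟩) (fun s1 h => ⟨by simp, h.vn⟩)).frame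
      fun s4 f4 _ ⟨p4, k4⟩ => ?_)
  have hT4 := hT3.frame f4 rfl rfl rfl
  refine run_seq ((run_palLens (P := .palY) (lenE :=
      .var .m) hD hT4 hT4.text.block_right (by omega) (by simp)
    (fun s1 h => ⟨by simp [h.vn]; omega, by simp [h.vn]⟩)
    (fun s1 h => ⟨by simp, h.vm⟩)).frame fun s5 f5 _ ⟨p5, k5⟩ => ?_)
  have hT5 := hT4.frame f5 rfl rfl rfl
  have hM := hT5.consts.vM
  have hx : Arr.palX.idx * M + 0 < W := by
    have : Arr.palX.idx * M ≤ 31 * M := Nat.mul_le_mul_right _ (by decide)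
    omega
  have hy : Arr.palY.idx * M + 0 < W := by
    have : Arr.palY.idx * M ≤ 31 * M := Nat.mul_le_mul_right _ (by decide)
    omega
  have i1 := Arr.palX.idx_lt
  have i2 := Arr.palY.idx_lt
  refine run_seq (run_set (by simp [hM]; omega) (run_set (by simp [hM]; omega) ?_))
  refine ⟨⟨pos, ?_⟩, ?_, p5, by simp [hM], by simp [hM], ?_⟩
  · refine hT5.frame (c := .set .out0 0 ;; .set .out1 0) ⟨fun v hv => ?_, fun a _ => rfl⟩
      rfl rfl rfl
    simp [writesV] at hv
    simp [Ne.symm hv.1, Ne.symm hv.2]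
  · show Holds (s5.a .palX) _
    rw [f5.a .palX rfl]; exact p4
  · show s5.clk ≤ _
    omega

theorem run_step2 {s : Store} {pos : ℕ → ℕ} (hD : Dims W M x.length y.length A)
    (hs : TreeState M x y A pos s) :
    Run W M step2 s (fun s' => Holds (s'.a .oddF) (encode (oddPieces 0 x ++ oddPieces 1 y)) ∧
      Holds (s'.a .evenF) (encode (evenPieces 0 x ++ evenPieces 1 y)) ∧
      s'.v .out0 = Arr.oddF.idx * M ∧ s'.v .out1 = Arr.evenF.idx * M ∧
      s'.clk ≤ s.clk + 2 * (x.length + y.length)) := by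
  have h1 := hD.len_le
  have h3 := hD.le
  have hodd : ∀ src (z : List ℕ), ((List.range z.length).map fun i =>
      (⟨src, i + 0, (maxPalLen z (2 * i + 0) + 1) / 2⟩ : Piece)) = oddPieces src z := by
    intro src z; rfl
  have heven : ∀ src (z : List ℕ), ((List.range (z.length - 1)).map fun i =>
      (⟨src, i + 1, (maxPalLen z (2 * i + 1) + 1) / 2⟩ : Piece)) = evenPieces src z := by
    intro src z
    refine List.map_congr_left fun i _ => ?_
    have := maxPalLen_even (x := z) (k := 2 * i + 1) (by omega)
    congr 1; omega
  unfold step2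
  refine run_seq (run_set (by simp; omega) ?_)
  have hs0 : TreeState M x y A pos { s with v := Function.update s.v .pos ((0 :
      Expr).eval s) } := by
    refine hs.frame (c := .set .pos 0) ⟨fun v hv => ?_, fun a _ => rfl⟩ rfl rfl rfl
    simp [writesV] at hv
    simp [Ne.symm hv]
  refine run_seq ((run_putPieces (P := .oddF) (sh := 2) (len := x.length) (l := []) hD hs0
    hs0.text.block_left (by omega) (by simp) (by simp) (by simp)
    (fun s1 _ => ⟨by simp; omega, rfl⟩) rfl
    (fun s1 h _ => ⟨by simp, by simp [h.vn]⟩) rfl (by simp) (by simp)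
    (fun i hi => by simp [encode] at hi)).frame fun s1 f1 _ ⟨p1, q1, k1⟩ => ?_)
  rw [hodd, List.nil_append] at p1
  have hs1 := hs0.frame f1 rfl rfl rfl
  refine run_seq ((run_putPieces (P := .oddF) (sh := 2 * x.length + 4) (len := y.length)
    (l := oddPieces 0 x) hD hs1
    hs1.text.block_right (by omega) (by simp) (by simp) (by simp)
    (fun s1 h => ⟨by simp [h.vn]; omega, by simp [h.vn]⟩) (by omega)
    (fun s1 h _ => ⟨by simp, by simp [h.vm]⟩) rfl (by simpa [oddPieces] using q1)
    (by simp [oddPieces]) p1).frame fun s2 f2 _ ⟨p2, q2, k2⟩ => ?_)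
  rw [hodd] at p2
  have hs2 := hs1.frame f2 rfl rfl rfl
  refine run_seq (run_set (by simp; omega) ?_)
  have hs3 : TreeState M x y A pos
      { s2 with v := Function.update s2.v .pos ((0 : Expr).eval s2) } := by
    refine hs2.frame (c := .set .pos 0) ⟨fun v hv => ?_, fun a _ => rfl⟩ rfl rfl rfl
    simp [writesV] at hv
    simp [Ne.symm hv]
  refine run_seq ((run_putPieces (P := .evenF) (sh := 3) (len := x.length - 1) (l := []) hD hs3
    hs3.text.block_left (by omega) (by simp) (by simp) (by simp)
    (fun s1 _ => ⟨by simp; omega, rfl⟩) rfl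
    (fun s1 h hi => ⟨by simp; omega, by simp [h.vn]; omega⟩) rfl (by simp) (by simp)
    (fun i hi => by simp [encode] at hi)).frame fun s4 f4 _ ⟨p4, q4, k4⟩ => ?_)
  rw [heven, List.nil_append] at p4
  have hs4 := hs3.frame f4 rfl rfl rfl
  refine run_seq ((run_putPieces (P := .evenF) (sh := 2 * x.length + 5) (len := y.length - 1)
    (l := evenPieces 0 x) hD hs4
    hs4.text.block_right (by omega) (by simp) (by simp) (by simp)
    (fun s1 h => ⟨by simp [h.vn]; omega, by simp [h.vn]⟩) (by omega)
    (fun s1 h hi => ⟨by simp; omega, by simp [h.vm]; omega⟩) rfl (by simpa [evenPieces] using q4)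
    (by simp [evenPieces]) p4).frame fun s5 f5 _ ⟨p5, q5, k5⟩ => ?_)
  rw [heven] at p5
  have hM := (hs4.frame f5 rfl rfl rfl).consts.vM
  have i1 : Arr.oddF.idx * M ≤ 31 * M := Nat.mul_le_mul_right _ (by decide)
  have i2 : Arr.evenF.idx * M ≤ 31 * M := Nat.mul_le_mul_right _ (by decide)
  have i3 := Arr.oddF.idx_lt
  have i4 := Arr.evenF.idx_lt
  refine run_seq (run_set (by simp [hM]; omega) (run_set (by simp [hM]; omega) ?_))
  refine ⟨?_, p5, by simp [hM], by simp [hM], ?_⟩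
  · show Holds (s5.a .oddF) _
    rw [f5.a .oddF rfl, f4.a .oddF rfl]; exact p2
  · show s5.clk ≤ _
    simp only at k4 k1
    omega

end Prog
end Palcf

namespace Palcf

/-! ### Linked lists and radix sort -/

/-- From `h` on, the pointers `nx` run through the list `l` and end at `z`. -/
def Chain (nx : ℕ → ℕ) (z : ℕ) : ℕ → List ℕ → Prop
  | h, [] => h = z
  | h, a :: l => h = a ∧ Chain nx z (nx a) l

theorem Chain.congr {nx nx' : ℕ → ℕ} {z : ℕ} : ∀ {l : List ℕ} {h : ℕ}, Chain nx z h l →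
    (∀ u ∈ l, nx' u = nx u) → Chain nx' z h l
  | [], _, hc, _ => hc
  | a :: _, _, hc, he => ⟨hc.1, by
      rw [he a List.mem_cons_self]
      exact hc.2.congr fun u hu => he u (List.mem_cons_of_mem _ hu)⟩

theorem Chain.update {nx : ℕ → ℕ} {z : ℕ} {l : List ℕ} {h u b : ℕ} (hc : Chain nx z h l)
    (hu : u ∉ l) : Chain (Function.update nx u b) z h l :=
  hc.congr fun v hv => Function.update_of_ne (fun he => hu (by rw [← he]; exact hv)) _ _

theorem Chain.eq_nil {nx : ℕ → ℕ} {z : ℕ} {l : List ℕ} (hc : Chain nx z z l) (hz : z ∉ l) :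
    l = [] := by
  cases l with
  | nil => rfl
  | cons a l => exact absurd (hc.1 ▸ List.mem_cons_self) hz

theorem Chain.exists_cons {nx : ℕ → ℕ} {z h : ℕ} {l : List ℕ} (hc : Chain nx z h l) (hz : h ≠ z) :
    ∃ l', l = h :: l' ∧ Chain nx z (nx h) l' := by
  cases l with
  | nil => exact absurd hc hz
  | cons a l => obtain ⟨rfl, hc⟩ := hc; exact ⟨l, rfl, hc⟩

/-- The list `l` stably sorted by the value of `key`, for the values in `[d, B)`. -/
def bucketSort (key : ℕ → ℕ) (l : List ℕ) (d B : ℕ) : List ℕ :=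
  (List.range' d (B - d)).flatMap fun e => l.filter (key · = e)

theorem bucketSort_succ {key : ℕ → ℕ} {l : List ℕ} {d B : ℕ} (h : d < B) :
    bucketSort key l d B = l.filter (key · = d) ++ bucketSort key l (d + 1) B := by
  rw [bucketSort, show B - d = (B - (d + 1)) + 1 by omega, List.range'_succ, List.flatMap_cons]
  rfl

theorem mem_bucketSort {key : ℕ → ℕ} {l : List ℕ} {d B u : ℕ} (h : d ≤ B) :
    u ∈ bucketSort key l d B ↔ u ∈ l ∧ d ≤ key u ∧ key u < B := by
  simp only [bucketSort, List.mem_flatMap, List.mem_range'_1, List.mem_filter, decide_eq_true_eq]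
  constructor
  · rintro ⟨e, h1, h2, rfl⟩
    exact ⟨h2, h1.1, by omega⟩
  · rintro ⟨h1, h2, h3⟩
    exact ⟨key u, ⟨h2, by omega⟩, h1, rfl⟩

/-- Sorting is stable: elements with equal keys stay in the order `r`. -/
theorem pairwise_bucketSort {key : ℕ → ℕ} {l : List ℕ} {d B : ℕ} {r : ℕ → ℕ → Prop}
    (h : l.Pairwise r) :
    (bucketSort key l d B).Pairwise fun a b => key a < key b ∨ key a = key b ∧ r a b := by
  rw [bucketSort, List.pairwise_flatMap]
  constructor
  · intro e _
    refine (h.filter _).imp_of_mem fun ha hb hab => Or.inr ⟨?_, hab⟩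
    simp only [List.mem_filter, decide_eq_true_eq] at ha hb
    rw [ha.2, hb.2]
  · refine (List.pairwise_lt_range' (s := d) (n := B - d)).imp fun hab u hu v hv => Or.inl ?_
    simp only [List.mem_filter, decide_eq_true_eq] at hu hv
    omega

theorem nodup_bucketSort {key : ℕ → ℕ} {l : List ℕ} {d B : ℕ} (h : l.Nodup) :
    (bucketSort key l d B).Nodup :=
  (pairwise_bucketSort h).imp fun hab => by
    rcases hab with hab | hab
    · exact fun he => by rw [he] at hab; omega
    · exact hab.2

theorem bucketSort_perm {key : ℕ → ℕ} {l : List ℕ} {B : ℕ} (h : l.Nodup)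
    (hk : ∀ u ∈ l, key u < B) : (bucketSort key l 0 B).Perm l := by
  rw [List.perm_ext_iff_of_nodup (nodup_bucketSort h) h]
  intro u
  rw [mem_bucketSort (Nat.zero_le _)]
  exact ⟨fun h => h.1, fun hu => ⟨hu, Nat.zero_le _, hk u hu⟩⟩

theorem TreeState.set {M A : ℕ} {x y : List ℕ} {pos : ℕ → ℕ} {s : Store}
    (h : TreeState M x y A pos s) (v : Var) (e : ℕ)
    (hc :
        (v = .n || v = .m || v = .N || v = .A || v = .sg || v = .B || v = .M || v = .cnt) = false) :
    TreeState M x y A pos { s with v := Function.update s.v v e } := by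
  have hc' := hc
  simp only [Bool.or_eq_false_iff] at hc'
  refine h.frame (c := .set v 0) ⟨fun u hu => ?_, fun _ _ => rfl⟩ ?_ ?_ rfl
  · simp only [Cmd.writesV, decide_eq_false_iff_not] at hu
    exact Function.update_of_ne (Ne.symm hu) _ _
  · simp only [Cmd.writesV, hc', Bool.or_self]
  · simp only [Cmd.writesV, hc']

namespace Prog
open Cmd

variable {W M A : ℕ} {x y : List ℕ} {pos : ℕ → ℕ}

/-- Each bucket is a stack, so it holds its part of the list in reverse order. -/
theorem run_distribute {s : Store} {keyE : Expr} {key : ℕ → ℕ} {l : List ℕ} {B : ℕ}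
    (hM : s.v .M = M) (h0W : 0 < W) (hBM : B ≤ M)
    (hc : Chain (s.a .nx) 0 (s.v .h) l) (hnd : l.Nodup)
    (hl : ∀ u ∈ l, 0 < u ∧ u < M ∧ key u < B) (hbk : ∀ d < B, s.a .bk d = 0)
    (hkey : ∀ s1, Frame (distribute keyE) s s1 → s1.v .u ∈ l →
      keyE.ok W M s1 ∧ keyE.eval s1 = key (s1.v .u)) :
    Run W M (distribute keyE) s (fun s' => s'.v .h = 0 ∧
      (∀ d < B, Chain (s'.a .nx) 0 (s'.a .bk d) (l.filter (key · = d)).reverse) ∧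
      s'.clk = s.clk + l.length) := by
  refine run_loop (fun s1 => ∃ done rest, l = done ++ rest ∧ Chain (s1.a .nx) 0 (s1.v .h) rest ∧
    (∀ d < B, Chain (s1.a .nx) 0 (s1.a .bk d) (done.filter (key · = d)).reverse) ∧
    s1.clk = s.clk + done.length ∧ s1.v .M = M) (fun s1 => s.clk + l.length - s1.clk)
    ⟨[], l, rfl, hc, fun d hd => by simpa [Chain] using hbk d hd, by simp, hM⟩ ?_
  rintro s1 hf ⟨done, rest, rfl, hrest, hbuck, hclk, hM1⟩
  refine ⟨by simp; omega, fun hh => ?_, fun hh => ?_⟩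
  · simp only [Cond.holds, Expr.eval_var, Expr.eval_num] at hh
    obtain ⟨rest, rfl, htail⟩ := hrest.exists_cons hh
    clear hrest
    generalize hu : s1.v .h = u at *
    obtain ⟨hu0, huM, hkB⟩ := hl u (by simp)
    have hud : u ∉ done := fun h => by
      have := List.disjoint_of_nodup_append hnd h
      simp at this
    have hur : u ∉ rest := by
      have := (List.nodup_append.1 hnd).2.1
      exact (List.nodup_cons.1 this).1
    simp only [run_seq_iff, run_set_iff]
    simp only [Expr.ok_var, Expr.ok_get, Expr.eval_var, Expr.eval_get, hu, Function.update_self,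
      ne_eq, reduceCtorEq, not_false_eq_true, Function.update_of_ne, hM1, huM, or_true, and_true,
      true_and, run_put_iff]
    have hk := hkey { s1 with
      v := Function.update (Function.update s1.v .u u) .h (s1.a .nx u), clk := s1.clk + 1 }
      ⟨fun v hv => ?_, fun a ha => hf.a a ?_⟩ (by simp)
    · obtain ⟨hk1, hk2⟩ := hk
      simp at hk2
      refine ⟨hk1, ?_⟩
      simp only [hk2]
      refine ⟨by omega, by omega, ⟨done ++ [u], rest, by simp, htail.update hur, fun d hd => ?_,
        by simp; omega⟩, by simp; omega⟩
      by_cases hd' : d = key u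
      · subst hd'
        rw [Function.update_self]
        simp only [List.filter_append, List.reverse_append, List.filter_cons, decide_true, if_true,
          List.filter_nil, List.reverse_cons, List.reverse_nil, List.nil_append,
          List.singleton_append]
        refine ⟨rfl, ?_⟩
        rw [Function.update_self]
        exact (hbuck _ hd).update (by simp [hud])
      · rw [Function.update_of_ne hd']
        simp only [List.filter_append, List.filter_cons, Ne.symm hd', decide_false,
          List.filter_nil, List.append_nil, Bool.false_eq_true, if_false]
        exact (hbuck _ hd).update (by simp [hud])
    · simp only [distribute, writesV, Bool.or_eq_false_iff, decide_eq_false_iff_not] at hv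
      simp only [Function.update_of_ne (Ne.symm hv.1), Function.update_of_ne (Ne.symm hv.2.1)]
      refine hf.v v ?_
      simp [writesV, hv]
    · exact ha
  · simp only [Cond.holds, Expr.eval_var, Expr.eval_num, not_not] at hh
    rw [hh] at hrest
    have := hrest.eq_nil fun h => by have := hl 0 (by simp [h]); omega
    subst this
    simp only [List.append_nil] at *
    exact ⟨hh, hbuck, hclk⟩

/-- Moving a stack reverses it, so that the bucket, which was filled in reverse, is put before `acc`
in the original order. -/
theorem run_moveBucket {s : Store} {l acc : List ℕ} (hM : s.v .M = M) (h0W : 0 < W)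
    (hd : s.v .d < M)
    (hc : Chain (s.a .nx) 0 (s.a .bk (s.v .d)) l) (hacc : Chain (s.a .nx) 0 (s.v .h) acc)
    (hnd : (l ++ acc).Nodup) (hl : ∀ u ∈ l, 0 < u ∧ u < M) :
    Run W M moveBucket s (fun s' => Chain (s'.a .nx) 0 (s'.v .h) (l.reverse ++ acc) ∧
      s'.a .bk (s.v .d) = 0 ∧ (∀ e, e ≠ s.v .d → s'.a .bk e = s.a .bk e) ∧
      (∀ u, u ∉ l → s'.a .nx u = s.a .nx u) ∧ s'.clk = s.clk + l.length) := by
  generalize hdd : s.v .d = d at *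
  refine run_loop (fun s1 => ∃ r1 r2, l = r1 ++ r2 ∧ Chain (s1.a .nx) 0 (s1.a .bk d) r2 ∧
    Chain (s1.a .nx) 0 (s1.v .h) (r1.reverse ++ acc) ∧ (∀ e, e ≠ d → s1.a .bk e = s.a .bk e) ∧
    (∀ u, u ∉ l → s1.a .nx u = s.a .nx u) ∧ s1.clk = s.clk + r1.length)
    (fun s1 => s.clk + l.length - s1.clk)
    ⟨[], l, rfl, hc, hacc, fun _ _ => rfl, fun _ _ => rfl, by simp⟩ ?_
  rintro s1 hf ⟨r1, r2, rfl, h2, h1, hbk, hnx, hclk⟩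
  have hd1 : s1.v .d = d := (hf.v .d rfl).trans hdd
  have hM1 : s1.v .M = M := (hf.v .M rfl).trans hM
  refine ⟨by simp [hd1, hM1]; omega, fun hh => ?_, fun hh => ?_⟩
  · simp only [Cond.holds, Expr.eval_get, Expr.eval_var, Expr.eval_num, hd1] at hh
    obtain ⟨r2, rfl, htail⟩ := h2.exists_cons hh
    clear h2
    generalize hu : s1.a .bk d = u at *
    obtain ⟨hu0, huM⟩ := hl u (by simp)
    have hnd' : (r1 ++ u :: (r2 ++ acc)).Nodup := by simpa using hnd
    have hu1 : u ∉ r1 := fun h => by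
      have := List.disjoint_of_nodup_append hnd' h
      simp at this
    have hu2 := List.nodup_cons.1 (List.nodup_append.1 hnd').2.1
    simp only [List.mem_append, not_or] at hu2
    simp [hd1, hM1, hu]
    refine ⟨hd, huM, hd, huM, ⟨r1 ++ [u], r2, by simp, htail.update hu2.1.1, ?_, ?_,
      ?_, by simp; omega⟩, by show _ - _ < _ - _; omega⟩
    · rw [List.reverse_append, List.append_assoc]
      refine ⟨rfl, ?_⟩
      rw [Function.update_self]
      exact h1.update (by simp [hu1, hu2.1.2])
    · intro e he
      rw [Function.update_of_ne he]; exact hbk e he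
    · intro v h3 h4 h5
      rw [Function.update_of_ne h4]
      exact hnx v (by simp [h3, h4, h5])
  · simp only [Cond.holds, Expr.eval_get, Expr.eval_var, Expr.eval_num, not_not, hd1] at hh
    rw [hh] at h2
    have := h2.eq_nil fun h => by have := hl 0 (by simp [h]); omega
    subst this
    simp only [List.append_nil] at *
    exact ⟨h1, hh, hbk, hnx, hclk⟩

/-- The buckets are emptied from the last one to the first, which gives the sorted list. -/
theorem run_collect {s : Store} {key : ℕ → ℕ} {l : List ℕ} {B : ℕ}
    (hM : s.v .M = M) (h0W : 1 < W) (hBM : B ≤ M) (hB : s.v .B = B)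
    (hh : s.v .h = 0) (hnd : l.Nodup) (hl : ∀ u ∈ l, 0 < u ∧ u < M ∧ key u < B)
    (hc : ∀ d < B, Chain (s.a .nx) 0 (s.a .bk d) (l.filter (key · = d)).reverse) :
    Run W M collect s (fun s' => Chain (s'.a .nx) 0 (s'.v .h) (bucketSort key l 0 B) ∧
      (∀ d < B, s'.a .bk d = 0) ∧ s'.clk = s.clk + B + l.length) := by
  unfold collect
  refine run_seq (run_set (by simp) ?_)
  simp only [Expr.eval_var, hB]
  refine run_loop (fun s1 => s1.v .d ≤ B ∧
    Chain (s1.a .nx) 0 (s1.v .h) (bucketSort key l (s1.v .d) B) ∧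
    (∀ d < s1.v .d, Chain (s1.a .nx) 0 (s1.a .bk d) (l.filter (key · = d)).reverse) ∧
    (∀ d < B, s1.v .d ≤ d → s1.a .bk d = 0) ∧
    s1.clk = s.clk + (B - s1.v .d) + (bucketSort key l (s1.v .d) B).length) (fun s1 => s1.v .d)
    ?_ ?_
  · simp only [Function.update_self]
    exact ⟨le_rfl, by simpa [bucketSort, Chain] using hh, by simpa using hc,
      fun d h1 h2 => by omega, by simp [bucketSort]⟩
  · rintro s1 hf ⟨hdB, hch, hbuck, hzero, hclk⟩
    have hM1 : s1.v .M = M := by rw [hf.v .M rfl]; simpa using hM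
    generalize hd : s1.v .d = d at *
    refine ⟨by simp; omega, fun hlt => ?_, fun hlt => ?_⟩
    · simp [hd] at hlt
      refine run_seq (run_set (by simp [hd]; omega) ?_)
      simp only [Expr.eval_sub, Expr.eval_var, Expr.eval_num, hd]
      have hsucc := bucketSort_succ (key := key) (l := l) (d := d - 1) (B := B) (by omega)
      rw [Nat.sub_add_cancel hlt] at hsucc
      have hn := nodup_bucketSort (key := key) (d := d - 1) (B := B) hnd
      rw [hsucc] at hn
      refine (run_moveBucket (s := { s1 with
        v := Function.update s1.v .d (d - 1), clk := s1.clk + 1 })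
        (l := (l.filter (key · = d - 1)).reverse) (acc := bucketSort key l d B)
        (by simpa using hM1) (by omega) (by simp; omega) (by simpa using hbuck (d - 1) (by omega))
        (by simpa using hch) ?_ ?_).frame ?_
      · refine List.Perm.nodup (List.Perm.append_right _ (List.reverse_perm _).symm) hn
      · intro u hu
        have := hl u (by simp at hu; exact hu.1)
        omega
      · rintro s2 hf2 - ⟨g1, g2, g3, g4, g5⟩
        have hd2 : s2.v .d = d - 1 := by rw [hf2.v .d rfl]; simp
        simp only [Function.update_self] at g2 g3
        rw [hd2, hsucc]
        refine ⟨⟨by omega, by simpa using g1, fun e he => ?_, fun e he he' => ?_, ?_⟩, by omega⟩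
        · rw [g3 e (by omega)]
          refine (hbuck e (by omega)).congr fun u hu => g4 u fun hu' => ?_
          simp at hu hu'
          omega
        · rcases Nat.eq_or_lt_of_le he' with h | h
          · rw [← h]; exact g2
          · rw [g3 e (by omega)]; exact hzero e he (by omega)
        · rw [g5]
          simp only [List.length_reverse, List.length_append]
          omega
    · simp [hd] at hlt
      rw [hlt] at hch hzero hclk
      refine ⟨hch, fun e he => hzero e he (Nat.zero_le _), ?_⟩
      have := (bucketSort_perm hnd fun u hu => (hl u hu).2.2).length_eq
      omega

theorem run_distribute_collect {s : Store} {keyE : Expr} {key : ℕ → ℕ} {l : List ℕ} {B : ℕ}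
    (hM : s.v .M = M) (h1W : 1 < W) (hBM : B ≤ M) (hB : s.v .B = B)
    (hc : Chain (s.a .nx) 0 (s.v .h) l) (hnd : l.Nodup)
    (hl : ∀ u ∈ l, 0 < u ∧ u < M ∧ key u < B) (hbk : ∀ d < B, s.a .bk d = 0)
    (hkey : ∀ s1, Frame (distribute keyE) s s1 → s1.v .u ∈ l →
      keyE.ok W M s1 ∧ keyE.eval s1 = key (s1.v .u)) :
    Run W M (distribute keyE ;; collect) s (fun s' =>
      Chain (s'.a .nx) 0 (s'.v .h) (bucketSort key l 0 B) ∧ (∀ d < B, s'.a .bk d = 0) ∧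
      s'.clk = s.clk + B + 2 * l.length) := by
  refine run_seq ((run_distribute hM (by omega) hBM hc hnd hl hbk hkey).frame
    fun s1 f1 _ ⟨p1, q1, k1⟩ => ?_)
  refine (run_collect ((f1.v .M rfl).trans hM) h1W hBM ((f1.v .B rfl).trans hB) p1 hnd hl
    q1).mono fun s2 ⟨p2, q2, k2⟩ => ⟨p2, q2, by omega⟩

/-- The nodes are sorted by parents, and the children of a node by descending letters. The number of
digits of the letters is bounded by `e`. -/
theorem run_sortNodes {s : Store} {e : ℕ} (hD : Dims W M x.length y.length A)
    (hs : TreeState M x y A pos s) (hbk : ∀ i, s.a .bk i = 0)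
    (he : A + 3 ≤ (x.length + y.length + 8) ^ e) :
    Run W M sortNodes s (fun s' => ∃ l, Chain (s'.a .nx) 0 (s'.v .h) l ∧
      l.Perm (List.range' 3 (s.v .cnt - 3)) ∧
      (l.Pairwise fun u v => s.a .par u < s.a .par v ∨
        s.a .par u = s.a .par v ∧ s.a .ltr v ≤ s.a .ltr u) ∧
      s'.clk ≤ s.clk + (e + 2) * (4 * (x.length + y.length + 8))) := by
  have h1 := hD.len_le
  have h2 := hD.letter_le
  have h3 := hD.le
  have hcnt := hs.cnt_le
  have hcnt3 : 3 ≤ s.v .cnt := hs.valid.cnt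
  generalize hB : x.length + y.length + 8 = B at *
  unfold sortNodes
  refine run_seq (run_set (by simp; omega) ?_)
  refine run_seq ?_
  apply run_for (fun j s1 => Chain (s1.a .nx) 0 (s1.v .h) (List.range' 3 (j - 3)).reverse ∧
    s1.clk = s.clk + (j - 3)) 3 (s.v .cnt) rfl
  · simp; omega
  · simp
  · exact hcnt3
  · omega
  · simp [Chain]
  · intro j s1 _ _ hf hu _
    have := hf.v .cnt rfl
    simp at this
    simp [hu, this]
  · intro j s1 hj3 hj hf hu ⟨hch, hclk⟩
    have hM : s1.v .M = M := by rw [hf.v .M rfl]; simpa using hs.consts.vM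
    simp [hu, hM]
    refine ⟨by omega, ?_, by omega⟩
    rw [show j - 2 = (j - 3) + 1 by omega, List.range'_1_concat, List.reverse_append,
      show 3 + (j - 3) = j by omega]
    refine ⟨rfl, ?_⟩
    rw [Function.update_self]
    refine hch.update ?_
    rw [List.mem_reverse, List.mem_range'_1]
    omega
  intro s1 hf1 _ ⟨hch1, hclk1⟩
  have hs1 : TreeState M x y A pos s1 := (hs.set .h _ rfl).frame hf1 rfl rfl rfl
  have hpar1 : s1.a .par = s.a .par := hf1.a .par rfl
  have hltr1 : s1.a .ltr = s.a .ltr := hf1.a .ltr rfl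
  have hbk1 : s1.a .bk = s.a .bk := hf1.a .bk rfl
  have hcnt1 : s1.v .cnt = s.v .cnt := by rw [hf1.v .cnt rfl]; simp
  set L := List.range' 3 (s.v .cnt - 3) with hL
  have hmem : ∀ u, u ∈ L ↔ 3 ≤ u ∧ u < s.v .cnt := fun u => by
    rw [hL, List.mem_range'_1]; omega
  have hlen : L.length = s.v .cnt - 3 := by simp [hL]
  have hnode : ∀ u ∈ L, s.a .par u < u ∧ s.a .ltr u < A + 3 := fun u hu => by
    have := hs.valid.node u ((hmem u).1 hu).1 ((hmem u).1 hu).2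
    exact ⟨this.par_lt, this.ltr_lt⟩
  have hLnd : L.Nodup := List.nodup_range'
  have hBsg : B * (A + 3) < M := by
    have : 0 < B * (A + 3) := Nat.mul_pos (by omega) (by omega)
    rw [hD.def_M, hB]; omega
  refine run_seq (run_set (by simp; omega) (run_seq ?_))
  refine run_loop (fun s2 => ∃ p l, s2.v .pw = B ^ p ∧ p ≤ e ∧ Chain (s2.a .nx) 0 (s2.v .h) l ∧
    l.Perm L ∧ (l.Pairwise fun u v =>
      (A + 2 - s.a .ltr u) % B ^ p ≤ (A + 2 - s.a .ltr v) % B ^ p) ∧ (∀ d < B, s2.a .bk d = 0) ∧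
      s2.clk ≤ s.clk + (p + 1) * (4 * B)) (fun s2 => A + 3 - s2.v .pw)
    ⟨0, L.reverse, by simp, by omega, hch1, List.reverse_perm L, ?_, ?_, ?_⟩ ?_
  · refine List.Pairwise.imp (fun _ => ?_) (List.pairwise_of_forall (R :=
        fun _ _ => True) (by simp))
    simp [Nat.mod_one]
  · intro d _
    show s1.a .bk d = 0
    rw [hbk1, hbk]
  · show s1.clk ≤ _
    omega
  rintro s2 hf2 ⟨p, l, hpw, hp, hch2, hperm, hsort, hbk2, hclk2⟩
  have hs2 : TreeState M x y A pos s2 := (hs1.set .pw _ rfl).frame hf2 rfl rfl rfl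
  have hpar2 : s2.a .par = s.a .par := (hf2.a .par rfl).trans hpar1
  have hltr2 : s2.a .ltr = s.a .ltr := (hf2.a .ltr rfl).trans hltr1
  have hlnd : l.Nodup := hperm.nodup_iff.2 hLnd
  have hB2 := hs2.consts.vB
  rw [hB] at hB2
  have hlenl := hperm.length_eq
  have hBpos : 0 < B ^ p := Nat.pow_pos (by omega)
  refine ⟨by simp, fun hh => ?_, fun hh => ?_⟩
  · simp only [Cond.holds, Expr.eval_var, hpw, hs2.consts.vsg] at hh
    have hpe : p < e := (Nat.pow_lt_pow_iff_right (by omega : 1 < B)).1 (hh.trans_le he)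
    have key := run_distribute_collect (W := W) (M := M)
      (s := { s2 with clk := s2.clk + 1 }) (B := B) (l := l)
      (keyE := (Expr.var .sg - 1 - Expr.get .ltr (.var .u)) / .var .pw % .var .B)
      (key := fun u => (A + 2 - s.a .ltr u) / B ^ p % B)
      hs2.consts.vM (by omega) (by omega) hB2 hch2 hlnd
      (fun u hu => by
        have := (hmem u).1 (hperm.subset hu)
        exact ⟨by omega, by omega, Nat.mod_lt _ (by omega)⟩) hbk2
      (fun s3 hf3 hu => by
        have := (hmem _).1 (hperm.subset hu)
        have h4 := hnode _ (hperm.subset hu)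
        have c3 := hs2.consts.frame (c := distribute 0) (s' := s3)
          ⟨fun v hv => hf3.v v (by simpa [distribute, writesV] using hv),
            fun a ha => hf3.a a (by simpa [distribute, writesA] using ha)⟩ rfl
        have e1 : s3.a .ltr = s.a .ltr := (hf3.a .ltr rfl).trans hltr2
        have e2 : s3.v .pw = B ^ p := (hf3.v .pw rfl).trans hpw
        have hB3 := c3.vB
        rw [hB] at hB3
        simp [c3.vsg, c3.vM, hB3, e1, e2]
        omega)
    rw [run_seq_iff] at key
    refine run_seq (key.frame fun s3 hf3 _ h => run_seq (h.frame fun s4 hf4 _ ⟨g1, g2, g3⟩ => ?_))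
    have hs4 : TreeState M x y A pos s4 :=
      (TreeState.frame (c := .skip) (s' := { s2 with clk := s2.clk + 1 }) hs2
        ⟨fun _ _ => rfl, fun _ _ => rfl⟩ rfl rfl rfl |>.frame hf3 rfl rfl rfl).frame hf4 rfl rfl rfl
    have hpw4 : s4.v .pw = B ^ p := ((hf4.v .pw rfl).trans (hf3.v .pw rfl)).trans hpw
    have hB4 := hs4.consts.vB
    rw [hB] at hB4
    have hlt : B ^ p * B < (A + 3) * B := Nat.mul_lt_mul_of_pos_right hh (by omega)
    rw [Nat.mul_comm (A + 3)] at hlt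
    have hbucket : ∀ u ∈ l, (A + 2 - s.a .ltr u) / B ^ p % B < B :=
      fun u _ => Nat.mod_lt _ (by omega)
    refine run_set (by simp [hpw4, hB4]; omega) ?_
    simp only [Function.update_self, Expr.eval_mul, Expr.eval_var, hpw4, hB4]
    refine ⟨⟨p + 1, _, by rw [pow_succ], hpe, g1, (bucketSort_perm hlnd hbucket).trans hperm,
      (pairwise_bucketSort hsort).imp fun {u v} huv => ?_, g2, ?_⟩, ?_⟩
    · -- comparison by the next digit, and then by the digits before it
      rw [pow_succ, Nat.mod_mul, Nat.mod_mul]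
      rcases huv with huv | ⟨huv, h⟩
      · have h5 := Nat.mod_lt (A + 2 - s.a .ltr u) hBpos
        have h6 := Nat.mul_le_mul_left (B ^ p) (Nat.succ_le_of_lt huv)
        rw [Nat.mul_succ] at h6
        have h7 := Nat.zero_le ((A + 2 - s.a .ltr v) % B ^ p)
        linarith
      · rw [huv]; omega
    · have e3 : (p + 1 + 1) * (4 * B) = (p + 1) * (4 * B) + 4 * B := by ring
      simp only at g3
      omega
    · have : B ^ p * 1 < B ^ p * B := Nat.mul_lt_mul_of_pos_left (by omega) hBpos
      rw [hpw]
      omega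
  · simp only [Cond.holds, Expr.eval_var, hpw, hs2.consts.vsg, not_lt] at hh
    refine (run_distribute_collect (W := W) (M := M) (B := B) (l := l) (keyE := .get .par (.var .u))
      (key := s.a .par)
      hs2.consts.vM (by omega) (by omega) hB2 hch2 hlnd
      (fun u hu => by
        have := (hmem u).1 (hperm.subset hu)
        have h4 := hnode _ (hperm.subset hu)
        exact ⟨by omega, by omega, by omega⟩) hbk2
      (fun s3 hf3 hu => by
        have := (hmem _).1 (hperm.subset hu)
        have e1 : s3.a .par = s.a .par := (hf3.a .par rfl).trans hpar2
        have e2 : s3.v .M = M := (hf3.v .M rfl).trans hs2.consts.vM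
        simp [e1, e2]
        omega)).mono fun s3 ⟨g1, g2, g3⟩ => ⟨_, g1,
            (bucketSort_perm hlnd fun u hu => ?_).trans hperm,
          (pairwise_bucketSort hsort).imp_of_mem fun hu hv huv => ?_, ?_⟩
    · have := (hmem u).1 (hperm.subset hu)
      have h4 := hnode _ (hperm.subset hu)
      omega
    · rw [mem_bucketSort (Nat.zero_le _)] at hu hv
      have h4 := hnode _ (hperm.subset hu.1)
      have h5 := hnode _ (hperm.subset hv.1)
      rw [Nat.mod_eq_of_lt (by omega), Nat.mod_eq_of_lt (by omega)] at huv
      omega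
    · have : (p + 1) * (4 * B) ≤ (e + 1) * (4 * B) := Nat.mul_le_mul_right _ (by omega)
      have e3 : (e + 2) * (4 * B) = (e + 1) * (4 * B) + 4 * B := by ring
      omega

end Prog
end Palcf

namespace Palcf

/-! ### Preorder of the palindromic tree -/

/-- The string `v` comes directly behind `u` in the preorder of a trie, where every proper
initial segment of `v` has been passed before. -/
def NextInPreorder (u v : List ℕ) : Prop := lcp u v + 1 = v.length ∧ u < v

theorem nextInPreorder_concat (u : List ℕ) (a : ℕ) : NextInPreorder u (u ++ [a]) := by
  induction u with
  | nil => exact ⟨rfl, List.nil_lt_cons _ _⟩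
  | cons b u ih =>
    exact ⟨by simpa [lcp] using ih.1, List.cons_lt_cons_iff.2 (Or.inr ⟨rfl, ih.2⟩)⟩

theorem nextInPreorder_siblings (u : List ℕ) {a b : ℕ} (h : a < b) :
    NextInPreorder (u ++ [a]) (u ++ [b]) := by
  induction u with
  | nil => exact ⟨by simp [lcp, h.ne], List.cons_lt_cons_iff.2 (Or.inl h)⟩
  | cons c u ih =>
    exact ⟨by simpa [lcp] using ih.1, List.cons_lt_cons_iff.2 (Or.inr ⟨rfl, ih.2⟩)⟩

/-- After a letter where `u` is smaller than `v`, any letters may follow. -/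
theorem NextInPreorder.append {u v w : List ℕ} (h : NextInPreorder u v) (hl : v.length ≤ u.length) :
    NextInPreorder (u ++ w) v := by
  obtain ⟨h1, h2⟩ := h
  induction u generalizing v with
  | nil => simp at hl; subst hl; exact absurd h2 (lt_irrefl _)
  | cons a u ih =>
    cases v with
    | nil => simp [lcp] at h1
    | cons b v =>
      rw [List.cons_lt_cons_iff] at h2
      by_cases hab : a = b
      · subst hab
        have h3 := ih (v := v) (by simpa using hl) (by simpa [lcp] using h1)
          (h2.resolve_left (lt_irrefl _) |>.2)
        exact ⟨by simpa [lcp] using h3.1, List.cons_lt_cons_iff.2 (Or.inr ⟨rfl, h3.2⟩)⟩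
      · exact ⟨by simpa [lcp, hab] using h1, List.cons_lt_cons_iff.2
          (Or.inl (h2.resolve_right fun h => hab h.1))⟩

theorem NextInPreorder.eq_of_length_lt {u w : List ℕ} {a : ℕ} (h : NextInPreorder u (w ++ [a]))
    (hl : u.length < (w ++ [a]).length) : w = u := by
  have h1 := h.1
  have h2 := take_lcp u (w ++ [a])
  have h3 := lcp_le_left u (w ++ [a])
  simp only [List.length_append, List.length_singleton] at h1 hl
  rw [show lcp u (w ++ [a]) = w.length by omega, List.take_left, List.take_of_length_le (by omega)]
    at h2
  exact h2.symm

namespace PTree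

variable {T : PTree} {S : ℕ → ℕ} {sg u v p : ℕ}

theorem Valid.occ_pos (hT : T.Valid S sg) (hu : 3 ≤ u) (hc : u < T.cnt) : T.Occ S u (T.pos u) :=
  ⟨by omega, hc, (hT.node u hu hc).pl, fun _ _ => rfl⟩

/-- The half of a palindrome extends that of its parent by one letter: the tree is a trie of halves.
-/
theorem Valid.half_eq (hT : T.Valid S sg) (hu : 3 ≤ u) (hc : u < T.cnt) :
    T.half S u = T.half S (T.par u) ++ [T.ltr u] := by
  have hn := hT.node u hu hc
  have ho := hT.occ_pos hu hc
  have hlam := hn.lam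
  have hge := hT.pos_ge (by omega) hc
  obtain ⟨j, hj⟩ : ∃ j, T.pos u = j + 1 := ⟨T.pos u - 1, by omega⟩
  rw [hj] at ho
  obtain ⟨h1, h2⟩ := hT.occ_parent hu ho
  have hle : T.lam (T.par u) ≤ T.pos (T.par u) := by
    rcases Nat.eq_or_lt_of_le hn.par_pos with h | h
    · rw [← h, hT.lam1]; omega
    · exact hT.pos_ge h (hn.par_lt.trans hc)
  rw [h1.half_eq hle, half, show T.lam u / 2 = T.lam (T.par u) / 2 + 1 by omega, List.range_succ,
    List.map_append, hj]
  have := h1.le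
  congr 1
  · refine List.map_congr_left fun t _ => ?_
    congr 1; omega
  · rw [List.map_singleton, ← h2]
    congr 2; omega

/-- Nodes of equal parity are determined by their halves. The trie of the odd palindromes has the
root `1`, that of the even ones the root `2`. -/
theorem Valid.half_inj (hT : T.Valid S sg) : ∀ {u v : ℕ}, 1 ≤ u → 1 ≤ v → u < T.cnt → v < T.cnt →
    T.lam u % 2 = T.lam v % 2 → T.half S u = T.half S v → u = v := by
  intro u
  induction u using Nat.strong_induction_on with
  | _ u ih =>
    intro v hu hv hcu hcv hpar h
    have hlen := congrArg List.length h
    rw [length_half, length_half] at hlen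
    rcases Nat.lt_or_ge (T.lam u) 2 with h2 | h2
    · have hu3 : u < 3 := by
        by_contra h3
        have := hT.lam_ge (by omega) hcu; omega
      have hv3 : v < 3 := by
        by_contra h3
        have := hT.lam_ge (by omega) hcv; omega
      have h1 := hT.lam1
      have h2 := hT.lam2
      have hu' : u = 1 ∨ u = 2 := by omega
      have hv' : v = 1 ∨ v = 2 := by omega
      rcases hu' with rfl | rfl <;> rcases hv' with rfl | rfl <;> omega
    · have h3 := hT.three_le h2 hu
      have h4 := hT.three_le (v := v) (by omega) hv
      have n1 := hT.node u h3 hcu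
      have n2 := hT.node v h4 hcv
      rw [hT.half_eq h3 hcu, hT.half_eq h4 hcv] at h
      obtain ⟨e1, e2⟩ := List.append_inj' h rfl
      have e3 := ih _ n1.par_lt n1.par_pos n2.par_pos (n1.par_lt.trans hcu) (n2.par_lt.trans hcv)
        (by have := n1.lam; have := n2.lam; omega) e1
      rw [← n1.tab, ← n2.tab, e3, (List.cons.inj e2).1]

/-- Node `v` may follow `u` in the list of all nodes: it starts the tree of the even
palindromes, or it follows `u` in the preorder of their tree. -/
def Adj (T : PTree) (S : ℕ → ℕ) (u v : ℕ) : Prop :=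
  v = 2 ∨ T.lam u % 2 = T.lam v % 2 ∧ NextInPreorder (T.half S u) (T.half S v)

theorem Valid.adj_parent (hT : T.Valid S sg) (hu : 3 ≤ u) (hc : u < T.cnt) :
    T.Adj S (T.par u) u := by
  refine Or.inr ⟨?_, ?_⟩
  · rw [(hT.node u hu hc).lam]; omega
  · rw [hT.half_eq hu hc]; exact nextInPreorder_concat _ _

/-- Insertion of `u` behind its parent, if the children inserted before have larger letters. -/
theorem Valid.adj_child (hT : T.Valid S sg) (hu : 3 ≤ u) (hc : u < T.cnt) (hv : 1 ≤ v)
    (hcv : v < T.cnt) (huv : u ≠ v) (h : T.Adj S (T.par u) v)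
    (hs : 3 ≤ v → T.par v = T.par u → T.ltr u ≤ T.ltr v) : T.Adj S u v := by
  rcases h with h | ⟨h1, h2⟩
  · exact Or.inl h
  · have n1 := hT.node u hu hc
    refine Or.inr ⟨by rw [n1.lam]; omega, ?_⟩
    have hd := h2.1
    rw [length_half] at hd
    have hv3 : 3 ≤ v := hT.three_le (by omega) hv
    have n2 := hT.node v hv3 hcv
    rcases Nat.lt_or_ge (T.half S (T.par u)).length (T.half S v).length with hl | hl
    · rw [hT.half_eq hv3 hcv] at h2 hl
      have hpar := hT.half_inj n2.par_pos n1.par_pos (n2.par_lt.trans hcv) (n1.par_lt.trans hc)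
        (by have := n2.lam; omega) (h2.eq_of_length_lt hl)
      rw [hT.half_eq hu hc, hT.half_eq hv3 hcv, hpar]
      refine nextInPreorder_siblings _ (lt_of_le_of_ne (hs hv3 hpar) fun he => huv ?_)
      rw [← n1.tab, ← n2.tab, hpar, he]
    · rw [hT.half_eq hu hc]
      exact h2.append hl

end PTree

/-- Insertion of `u` behind `p`. -/
theorem Chain.insert {nx : ℕ → ℕ} {z p u : ℕ} : ∀ {a b : List ℕ} {h : ℕ},
    Chain nx z h (a ++ p :: b) → u ∉ a ++ p :: b → (a ++ p :: b).Nodup →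
    Chain (Function.update (Function.update nx u (nx p)) p u) z h (a ++ p :: u :: b)
  | [], b, h, hc, hu, hnd => by
    obtain ⟨rfl, hc⟩ := hc
    simp only [List.nil_append, List.mem_cons, not_or, List.nodup_cons] at hu hnd
    refine ⟨rfl, by simp, ?_⟩
    rw [Function.update_of_ne hu.1, Function.update_self]
    exact (hc.update hu.2).update hnd.1
  | c :: a, b, h, hc, hu, hnd => by
    obtain ⟨rfl, hc⟩ := hc
    simp only [List.cons_append, List.mem_cons, List.nodup_cons] at hu hnd
    refine ⟨rfl, ?_⟩
    rw [Function.update_of_ne, Function.update_of_ne]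
    · exact Chain.insert hc (fun h => hu (Or.inr h)) hnd.2
    · exact fun he => hu (Or.inl he.symm)
    · rintro rfl; exact hnd.1 (by simp)

/-- The part of a linked list before `p` is a linked list that ends at `p`. -/
theorem Chain.split {nx : ℕ → ℕ} {z p : ℕ} : ∀ {a b : List ℕ} {h : ℕ},
    Chain nx z h (a ++ p :: b) → Chain nx p h a ∧ Chain nx z p (p :: b)
  | [], _, _, hc => ⟨hc.1, by obtain ⟨rfl, hc⟩ := hc; exact ⟨rfl, hc⟩⟩
  | _ :: _, _, _, hc => ⟨⟨hc.1, (Chain.split hc.2).1⟩, (Chain.split hc.2).2⟩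

/-- The list `l` enumerates the nodes of `T` whose `lam` has parity `b`, in preorder. -/
structure IsPreorder (T : PTree) (S : ℕ → ℕ) (b : ℕ) (l : List ℕ) : Prop where
  nodup : l.Nodup
  mem : ∀ v, v ∈ l ↔ 1 ≤ v ∧ v < T.cnt ∧ T.lam v % 2 = b
  next : l.IsChain fun u v => NextInPreorder (T.half S u) (T.half S v)

/-- The list of all nodes changes the parity only at the node `2`. -/
theorem parity_of_adj {T : PTree} {S : ℕ → ℕ} {u : ℕ} : ∀ {l : List ℕ},
    (u :: l).IsChain (T.Adj S) → 2 ∉ l → (∀ v ∈ l, T.lam v % 2 = T.lam u % 2) ∧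
      (u :: l).IsChain fun u v => NextInPreorder (T.half S u) (T.half S v)
  | [], _, _ => ⟨by simp, List.isChain_singleton _⟩
  | v :: l, h, h2 => by
    simp only [List.mem_cons, not_or] at h2
    obtain ⟨ha, hl⟩ := List.isChain_cons_cons.1 h
    obtain ⟨g1, g2⟩ := parity_of_adj hl h2.2
    obtain ⟨e1, e2⟩ := ha.resolve_left (Ne.symm h2.1)
    refine ⟨fun w hw => ?_, List.isChain_cons_cons.2 ⟨e2, g2⟩⟩
    rcases List.mem_cons.1 hw with rfl | hw
    · exact e1.symm
    · rw [g1 w hw, e1]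

namespace Prog
open Cmd

variable {W M A : ℕ} {x y : List ℕ} {pos : ℕ → ℕ}

/-- Insertion of the nodes behind their parents, in the order of the sorted list, gives the
preorder: parents come before their children, and among siblings the one with the smallest letter is
inserted last, hence directly behind the parent. The resulting list consists of the nodes of the odd
palindromes, and those of the even ones from node `2` on. -/
theorem run_preorder {s : Store} {l : List ℕ} (hD : Dims W M x.length y.length A)
    (hs : TreeState M x y A pos s) (hpre : ∀ i, s.a .pre i = 0) (hc : Chain (s.a .nx) 0 (s.v .h) l)
    (hperm : l.Perm (List.range' 3 (s.v .cnt - 3)))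
    (hsort : l.Pairwise fun u v => s.a .par u < s.a .par v ∨
      s.a .par u = s.a .par v ∧ s.a .ltr v ≤ s.a .ltr u) :
    Run W M preorder s (fun s' => ∃ O E, Chain (s'.a .pre) 2 1 O ∧ Chain (s'.a .pre) 0 2 E ∧
      IsPreorder (treeOf s pos) (s.a .str) 0 O ∧ IsPreorder (treeOf s pos) (s.a .str) 1 E ∧
      s'.clk ≤ s.clk + (x.length + y.length + 5)) := by
  have h1 := hD.len_le
  have h3 := hD.le
  have hcnt := hs.cnt_le
  have hcnt3 : 3 ≤ s.v .cnt := hs.valid.cnt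
  have hM := hs.consts.vM
  set T := treeOf s pos with hT
  have hmem : ∀ u, u ∈ l ↔ 3 ≤ u ∧ u < s.v .cnt := fun u => by
    rw [hperm.mem_iff, List.mem_range'_1]; omega
  have hlnd : l.Nodup := hperm.nodup_iff.2 List.nodup_range'
  have hlen : l.length = s.v .cnt - 3 := by rw [hperm.length_eq]; simp
  unfold preorder
  refine run_seq (run_put (by simp; omega) (by simp; omega) hM (by simp; omega) ?_)
  refine run_loop (fun s1 => ∃ done rest L, l = done ++ rest ∧ Chain (s1.a .nx) 0 (s1.v .h) rest ∧
    Chain (s1.a .pre) 0 1 (1 :: L) ∧ (1 :: L).Perm (1 :: 2 :: done) ∧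
    (1 :: L).IsChain (T.Adj (s.a .str)) ∧ s1.clk = s.clk + done.length)
    (fun s1 => s.clk + l.length - s1.clk)
    ⟨[], l, [2], rfl, hc, ⟨rfl, by simp [Chain, hpre]⟩, List.Perm.refl _, ?_, rfl⟩ ?_
  · exact List.isChain_pair.2 (Or.inl rfl)
  rintro s1 hf ⟨done, rest, L, hl, hrest, hpre1, hperm1, hchain, hclk⟩
  have hM1 : s1.v .M = M := (hf.v .M rfl).trans hM
  have hpar1 : s1.a .par = s.a .par := hf.a .par rfl
  have hndall : (1 :: 2 :: l).Nodup := by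
    refine List.nodup_cons.2 ⟨?_, List.nodup_cons.2 ⟨?_, hlnd⟩⟩
    · rw [List.mem_cons, hmem]; omega
    · rw [hmem]; omega
  have hnd1 : (1 :: L).Nodup := by
    rw [hperm1.nodup_iff]
    refine hndall.sublist ?_
    rw [hl]
    exact ((List.sublist_append_left done rest).cons_cons 2).cons_cons 1
  have hmem1 : ∀ v, v ∈ 1 :: L ↔ v = 1 ∨ v = 2 ∨ v ∈ done := fun v => by
    rw [hperm1.mem_iff]; simp
  have hdone : ∀ v ∈ done, 3 ≤ v ∧ v < s.v .cnt := fun v hv => (hmem v).1 (by simp [hl, hv])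
  refine ⟨by simp; omega, fun hh => ?_, fun hh => ?_⟩
  · simp only [Cond.holds, Expr.eval_var, Expr.eval_num] at hh
    obtain ⟨rest, rfl, htail⟩ := hrest.exists_cons hh
    clear hrest
    generalize hu : s1.v .h = u at *
    have hul : 3 ≤ u ∧ u < s.v .cnt := (hmem u).1 (by simp [hl])
    have hnode := hs.valid.node u hul.1 hul.2
    set p := s.a .par u with hp
    have hp1 : 1 ≤ p := hnode.par_pos
    have hp2 : p < u := hnode.par_lt
    -- the parent comes before `u` in the sorted list, because its own parent is smaller
    have hpm : p ∈ 1 :: L := by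
      rw [hmem1]
      by_cases h3 : 3 ≤ p
      · have hpl : p ∈ l := (hmem p).2 ⟨h3, by omega⟩
        rw [hl, List.mem_append, List.mem_cons] at hpl
        rcases hpl with h | h | h
        · exact Or.inr (Or.inr h)
        · omega
        · have hpp : s.a .par p < p := (hs.valid.node p h3 (by show p < s.v .cnt; omega)).par_lt
          rw [hl] at hsort
          have := (List.pairwise_cons.1 (List.pairwise_append.1 hsort).2.1).1 p h
          omega
      · omega
    have hum : u ∉ 1 :: L := by
      rw [hmem1]
      rintro (h | h | h)
      · omega
      · omega
      · rw [hl] at hlnd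
        have := List.disjoint_of_nodup_append hlnd h
        simp at this
    obtain ⟨a, b, hab⟩ := List.append_of_mem hpm
    have hins := Chain.insert (hab ▸ hpre1) (hab ▸ hum) (hab ▸ hnd1)
    have hnewperm : (a ++ p :: u :: b).Perm (1 :: 2 :: (done ++ [u])) := by
      have e1 : (a ++ p :: u :: b).Perm (u :: (a ++ p :: b)) := by
        have := List.perm_middle (a := u) (l₁ := a ++ [p]) (l₂ := b)
        simpa using this
      refine e1.trans ?_
      rw [← hab]
      refine (hperm1.cons u).trans ?_
      have := List.perm_append_comm (l₁ := [u]) (l₂ := 1 :: 2 :: done)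
      simpa using this
    have hnewchain : (a ++ p :: u :: b).IsChain (T.Adj (s.a .str)) := by
      rw [hab] at hchain
      obtain ⟨c1, c2⟩ := List.isChain_split.1 hchain
      refine List.isChain_split.2 ⟨c1, List.isChain_cons_cons.2
        ⟨hs.valid.adj_parent hul.1 hul.2, List.isChain_cons.2 ⟨fun v hv => ?_, c2.tail⟩⟩⟩
      have hvm : v ∈ 1 :: L := by
        rw [hab]
        have := List.mem_of_mem_head? hv
        simp [this]
      have hv2 := (hmem1 v).1 hvm
      have hvc : 1 ≤ v ∧ v < s.v .cnt := by
        rcases hv2 with h | h | h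
        · omega
        · omega
        · have := hdone v h; omega
      refine hs.valid.adj_child hul.1 hul.2 hvc.1 hvc.2 (fun h => hum (h ▸ hvm))
        ((List.isChain_cons.1 c2).1 v hv) fun h3 hpv => ?_
      have hvd : v ∈ done := by
        rcases hv2 with h | h | h
        · omega
        · omega
        · exact h
      rw [hl] at hsort
      have := (List.pairwise_append.1 hsort).2.2 v hvd u (by simp)
      simp only [treeOf] at hpv ⊢
      omega
    obtain ⟨L', hL'⟩ : ∃ L', a ++ p :: u :: b = 1 :: L' := by
      cases a with
      | nil =>
        simp only [List.nil_append, List.cons.injEq] at hab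
        exact ⟨u :: b, by rw [← hab.1]; rfl⟩
      | cons c a =>
        simp only [List.cons_append, List.cons.injEq] at hab
        exact ⟨a ++ p :: u :: b, by rw [← hab.1]; rfl⟩
    simp only [run_seq_iff, run_set_iff, run_put_iff]
    simp [hu, hM1, hpar1, ← hp]
    refine ⟨by omega, by omega, by omega, by omega, by omega, ⟨done ++ [u], rest, by simp [hl],
        htail, L', ?_, ?_, ?_,
      by simp; omega⟩, by rw [hl]; simp; omega⟩
    · rw [← hL']
      exact hins
    · rw [← List.perm_cons 1, ← hL']; simpa using hnewperm
    · rw [← hL']; exact hnewchain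
  · simp only [Cond.holds, Expr.eval_var, Expr.eval_num, not_not] at hh
    rw [hh] at hrest
    have := hrest.eq_nil fun h => by have := (hmem 0).1 (by simp [hl, h]); omega
    subst this
    rw [List.append_nil] at hl
    subst hl
    have h2L : 2 ∈ L := by
      have := (hmem1 2).2 (by simp)
      simpa using this
    obtain ⟨O, E, rfl⟩ := List.append_of_mem h2L
    have hsp := Chain.split (a := 1 :: O) hpre1
    have hnd2 : (1 :: O ++ 2 :: E).Nodup := hnd1
    have hch2 : (1 :: O ++ 2 :: E).IsChain (T.Adj (s.a .str)) := hchain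
    have hO2 : 2 ∉ O := fun h => by
      have := List.disjoint_of_nodup_append hnd2 (List.mem_cons_of_mem 1 h)
      simp at this
    have hE2 : 2 ∉ E := (List.nodup_cons.1 (List.nodup_append.1 hnd2).2.1).1
    obtain ⟨pO, cO⟩ := parity_of_adj hch2.left_of_append hO2
    obtain ⟨pE, cE⟩ := parity_of_adj hch2.right_of_append hE2
    have l1 : T.lam 1 = 0 := hs.valid.lam1
    have l2 : T.lam 2 = 1 := hs.valid.lam2
    rw [l1] at pO
    rw [l2] at pE
    have hall : ∀ v, v ∈ 1 :: O ∨ v ∈ 2 :: E ↔ 1 ≤ v ∧ v < T.cnt := fun v => by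
      rw [← List.mem_append]
      show v ∈ 1 :: (O ++ 2 :: E) ↔ _ ∧ v < s.v .cnt
      rw [hmem1, hmem]; omega
    have pO' : ∀ v ∈ 1 :: O, T.lam v % 2 = 0 := fun v hv => by
      rcases List.mem_cons.1 hv with rfl | hv
      · rw [l1]
      · exact pO v hv
    have pE' : ∀ v ∈ 2 :: E, T.lam v % 2 = 1 := fun v hv => by
      rcases List.mem_cons.1 hv with rfl | hv
      · rw [l2]
      · exact pE v hv
    refine ⟨1 :: O, 2 :: E, hsp.1, hsp.2, ⟨(List.nodup_append.1 hnd2).1, fun v => ?_, cO⟩,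
      ⟨(List.nodup_append.1 hnd2).2.1, fun v => ?_, cE⟩, by omega⟩
    · have := hall v
      constructor
      · intro h
        have h' := this.1 (Or.inl h)
        exact ⟨h'.1, h'.2, pO' v h⟩
      · rintro ⟨a, b, c⟩
        refine (this.2 ⟨a, b⟩).resolve_right fun h => ?_
        have := pE' v h; omega
    · have := hall v
      constructor
      · intro h
        have h' := this.1 (Or.inr h)
        exact ⟨h'.1, h'.2, pE' v h⟩
      · rintro ⟨a, b, c⟩
        refine (this.2 ⟨a, b⟩).resolve_left fun h => ?_
        have := pO' v h; omega

end Prog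
end Palcf

namespace Palcf

/-! ### The sorted lists of pieces -/

/-- The piece of the center `k` in the text, where `n` is the length of the first string. -/
def pieceAt (n : ℕ) (lam nd : ℕ → ℕ) (k : ℕ) : Piece where
  src := if k < 2 * n + 3 then 0 else 1
  start := if k < 2 * n + 3 then (k - 1) / 2 else (k - 1) / 2 - (n + 1)
  len := lam (nd k) / 2

/-- The arrays `P` and `C` hold the pieces with the centers `K`, and the longest common prefixes of
their strings with the preceding ones. -/
structure Emitted (T : PTree) (S nd : ℕ → ℕ) (n : ℕ) (P C : Arr) (K : List ℕ) (s : Store) :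
    Prop where
  pos : s.v .pos = K.length
  pieces : Holds (s.a P) (encode (K.map (pieceAt n T.lam nd)))
  lcp : ∀ i a b, K[i]? = some a → K[i + 1]? = some b →
    s.a C (i + 1) = lcp (T.half S (nd a)) (T.half S (nd b))

/-- `mm` is the length of the longest common prefix of `u` and the string of the last center. -/
def LastLcp (T : PTree) (S nd : ℕ → ℕ) (K : List ℕ) (u : List ℕ) (mm : ℕ) : Prop :=
  ∀ a, K.getLast? = some a → mm = lcp (T.half S (nd a)) u

theorem TreeState.tick {M A : ℕ} {x y : List ℕ} {pos : ℕ → ℕ} {s : Store}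
    (h : TreeState M x y A pos s) (t : ℕ) : TreeState M x y A pos { s with clk := t } :=
  h.frame (c := .skip) ⟨fun _ _ => rfl, fun _ _ => rfl⟩ rfl rfl rfl

theorem Emitted.snoc {T : PTree} {S nd : ℕ → ℕ} {n : ℕ} {P C : Arr} {K : List ℕ} {s s' : Store}
    {k mm : ℕ} (h : Emitted T S nd n P C K s) (hpos : s'.v .pos = K.length + 1)
    (hP : s'.a P = Function.update (Function.update (Function.update (s.a P) (3 * K.length)
      (pieceAt n T.lam nd k).src) (3 * K.length + 1) (pieceAt n T.lam nd k).start)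
      (3 * K.length + 2) (pieceAt n T.lam nd k).len)
    (hC : s'.a C = Function.update (s.a C) K.length mm)
    (hmm : LastLcp T S nd K (T.half S (nd k)) mm) : Emitted T S nd n P C (K ++ [k]) s' := by
  refine ⟨by simpa using hpos, ?_, fun i a b ha hb => ?_⟩
  · rw [hP, List.map_append, encode_append]
    have hlen : 3 * K.length = (encode (K.map (pieceAt n T.lam nd))).length := by
      rw [length_encode, List.length_map]
    have hp := h.pieces
    generalize pieceAt n T.lam nd = g at *
    have e : encode ([k].map g) = [(g k).src] ++ [(g k).start] ++ [(g k).len] := by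
      simp [encode]
    rw [e, ← List.append_assoc, ← List.append_assoc, hlen]
    have := ((hp.snoc (a := (g k).src)).snoc (a := (g k).start)).snoc (a := (g k).len)
    simpa using this
  · rw [hC]
    rcases Nat.lt_or_ge (i + 1) K.length with hi | hi
    · rw [Function.update_of_ne hi.ne]
      rw [List.getElem?_append_left (by omega)] at ha hb
      exact h.lcp i a b ha hb
    · have hi' : i + 1 = K.length := by
        have := (List.getElem?_eq_some_iff.1 hb).1
        simp at this; omega
      rw [List.getElem?_append_right hi, hi', Nat.sub_self] at hb
      rw [List.getElem?_append_left (by omega)] at ha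
      simp only [List.getElem?_cons_zero, Option.some_inj] at hb
      rw [hi', Function.update_self, ← hb]
      exact hmm a (by rw [List.getLast?_eq_getElem?, ← ha]; congr 1; omega)

namespace Prog
open Cmd

variable {W M A : ℕ} {x y : List ℕ} {pos : ℕ → ℕ}

/-- The centers `ks` have been attached before; those from `lo` up to `b` are added to the lists of
their nodes. -/
theorem run_attach {s : Store} {loE hiE : Expr} {lo b : ℕ} {ks : List ℕ}
    (hD : Dims W M x.length y.length A) (hs : TreeState M x y A pos s)
    (hlo : loE.ok W M s ∧ loE.eval s = lo) (hlb : lo ≤ b) (hlo1 : 1 ≤ lo)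
    (hb : b ≤ 2 * (x.length + y.length + 2))
    (hhi : ∀ s1 : Store, Consts M x.length y.length A s1 → lo ≤ s1.v .k →
      hiE.ok W M s1 ∧ (s1.v .k < hiE.eval s1 ↔ s1.v .k < b))
    (hks : ∀ k ∈ ks, k < lo)
    (hc : ∀ v, Chain (s.a .pnx) 0 (s.a .head v) (ks.filter (s.a .nd · = v)).reverse) :
    Run W M (attach loE hiE) s (fun s' => (∀ v, Chain (s'.a .pnx) 0 (s'.a .head v)
        ((ks ++ List.range' lo (b - lo)).filter (s.a .nd · = v)).reverse) ∧
      s'.clk = s.clk + (b - lo)) := by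
  have h1 := hD.len_le
  have h3 := hD.le
  have hcnt := hs.cnt_le
  unfold attach
  apply run_for (fun j s1 => (∀ v, Chain (s1.a .pnx) 0 (s1.a .head v)
    ((ks ++ List.range' lo (j - lo)).filter (s.a .nd · = v)).reverse) ∧
      s1.clk = s.clk + (j - lo)) lo b rfl
  · exact hlo.1
  · exact hlo.2
  · exact hlb
  · omega
  · simpa using hc
  · intro j s1 hj _ hf hk _
    have := hhi s1 (hs.consts.frame hf rfl) (by omega)
    simpa [hk] using this
  · intro j s1 hj hjb hf hk ⟨hch, hclk⟩
    have hM : s1.v .M = M := (hf.v .M rfl).trans hs.consts.vM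
    have hnd : s1.a .nd = s.a .nd := hf.a .nd rfl
    have hnode := hs.node (q := j) (by omega) (by omega)
    simp only [run_seq_iff, run_put_iff]
    simp [hk, hM, hnd, -List.filter_append, -List.reverse_append]
    refine ⟨by omega, by omega, by omega, fun v => ?_, by omega⟩
    rw [show j + 1 - lo = (j - lo) + 1 by omega, List.range'_1_concat, ← List.append_assoc,
      List.filter_append, List.reverse_append, show lo + (j - lo) = j by omega]
    have hj' : j ∉ ((ks ++ List.range' lo (j - lo)).filter (s.a .nd · = v)).reverse := by
      rw [List.mem_reverse, List.mem_filter, List.mem_append, List.mem_range'_1]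
      rintro ⟨h | h, -⟩
      · have := hks j h; omega
      · omega
    by_cases hv : v = s.a .nd j
    · subst hv
      rw [Function.update_self]
      simp only [List.filter_cons, decide_true, if_true, List.filter_nil, List.reverse_singleton,
        List.singleton_append]
      refine ⟨rfl, ?_⟩
      rw [Function.update_self]
      exact (hch _).update hj'
    · rw [Function.update_of_ne hv]
      simp only [List.filter_cons, Ne.symm hv, decide_false, List.filter_nil, Bool.false_eq_true,
        if_false, List.reverse_nil, List.nil_append]
      exact (hch v).update hj'
  · intro s1 _ _ h
    exact h

/-- All pieces `r` of a node denote the same string. The longest common prefix of the first with the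
preceding piece is `mm`, and then it is the length of the string. -/
theorem run_emitNode {s : Store} {P C : Arr} {K r : List ℕ} {v : ℕ}
    {T : PTree} {S nd : ℕ → ℕ}
    (hPC : P = .oddL ∧ C = .oddC ∨ P = .evenL ∧ C = .evenC)
    (hD : Dims W M x.length y.length A) (hs : TreeState M x y A pos s)
    (hT : treeOf s pos = T) (hS : s.a .str = S) (hnd : s.a .nd = nd)
    (hv : s.v .v = v) (hvc : v < s.v .cnt)
    (hc : Chain (s.a .pnx) 0 (s.v .k) r)
    (hr : ∀ k ∈ r, 2 ≤ k ∧ k < 2 * (x.length + y.length + 2) ∧ nd k = v)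
    (hlen : K.length + r.length ≤ 2 * (x.length + y.length))
    (hK : Emitted T S nd x.length P C K s)
    (hm : LastLcp T S nd K (T.half S v)
      (s.v .mm)) :
    Run W M (emitNode P C) s (fun s' =>
      Emitted T S nd x.length P C (K ++ r) s' ∧
      LastLcp T S nd (K ++ r) (T.half S v)
        (s'.v .mm) ∧ s'.clk = s.clk + r.length) := by
  subst hT hS hnd
  have h1 := hD.len_le
  have h3 := hD.le
  have hcnt := hs.cnt_le
  have p1 : Arr.lam ≠ P := by rcases hPC with h | h <;> simp [h.1]
  have p2 : Arr.lam ≠ C := by rcases hPC with h | h <;> simp [h.2]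
  have p3 : Arr.pnx ≠ P := by rcases hPC with h | h <;> simp [h.1]
  have p4 : Arr.pnx ≠ C := by rcases hPC with h | h <;> simp [h.2]
  have p5 : P ≠ C := by rcases hPC with h | h <;> simp [h.1, h.2]
  set T := treeOf s pos with hT
  set S := s.a .str with hS
  set nd := s.a .nd with hnd
  have hw : ∀ B, B ≠ P → B ≠ C → (emitNode P C).writesA B = false := fun B b1 b2 => by
    simp [emitNode, writesA, Ne.symm b1, Ne.symm b2]
  refine run_loop (fun s1 => ∃ d r', r = d ++ r' ∧ Chain (s1.a .pnx) 0 (s1.v .k) r' ∧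
    Emitted T S nd x.length P C (K ++ d) s1 ∧ LastLcp T S nd (K ++ d) (T.half S v) (s1.v .mm) ∧
    s1.clk = s.clk + d.length) (fun s1 => s.clk + r.length - s1.clk)
    ⟨[], r, rfl, hc, by simpa using hK, by simpa using hm, rfl⟩ ?_
  rintro s1 hf ⟨d, r', rfl, hch, hE, hmm, hclk⟩
  have hv1 : s1.v .v = v := (hf.v .v rfl).trans hv
  have hc1 := hs.consts.frame hf rfl
  have hlam : s1.a .lam = s.a .lam := hf.a .lam (hw .lam p1 p2)
  refine ⟨by simp; omega, fun hh => ?_, fun hh => ?_⟩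
  · simp only [Cond.holds, Expr.eval_var, Expr.eval_num] at hh
    obtain ⟨r', rfl, htail⟩ := hch.exists_cons hh
    clear hch
    generalize hk : s1.v .k = k at *
    obtain ⟨hk2, hkM, hkv⟩ := hr k (by simp)
    have hpos := hE.pos
    simp only [List.length_append, List.length_cons] at hlen hpos
    set f := pieceAt x.length T.lam nd k with hfp
    have hflen : f.len = s.a .lam v / 2 := by
      rw [hfp, pieceAt]; simp only [hkv]; rfl
    refine run_seq (Run.mono (Q := fun s2 => s2 = { s1 with
      clk := s1.clk + 1, a := Function.update s1.a P (Function.update (Function.update (s1.a P)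
        (3 * s1.v .pos) f.src) (3 * s1.v .pos + 1) f.start) }) ?_ ?_)
    · rw [run_ite_iff]
      refine ⟨by simp [hc1.vn]; omega, fun h => ?_, fun h => ?_⟩
      · simp only [Cond.holds, Expr.eval_var, Expr.eval_add, Expr.eval_mul, Expr.eval_num, hc1.vn,
          hk] at h
        simp [hk, hpos, hc1.vM, hfp, pieceAt, h]
        omega
      · simp only [Cond.holds, Expr.eval_var, Expr.eval_add, Expr.eval_mul, Expr.eval_num, hc1.vn,
          hk] at h
        simp [hk, hpos, hc1.vM, hc1.vn, hfp, pieceAt, h]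
        omega
    · rintro _ rfl
      simp only [run_seq_iff, run_put_iff, run_set_iff]
      simp [hk, hv1, hc1.vM, hlam, p1, p2, p3, p4, p5.symm, ← hflen]
      have hpos' : s1.v .pos = (K ++ d).length := hE.pos
      refine ⟨⟨⟨by omega, by omega⟩, by omega, by omega⟩, ⟨by omega, by omega⟩, by omega, by omega,
        ⟨by omega, by omega⟩, ⟨by omega, by omega⟩, by omega,
        ⟨d ++ [k], r', by simp, htail, ?_, ?_, by simp; omega⟩, by omega⟩
      · rw [← List.append_assoc, hpos']
        refine hE.snoc (by simp) ?_ ?_ (hkv ▸ hmm)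
        · simp only [Function.update_of_ne p5, Function.update_self]; rfl
        · simp only [Function.update_self]
      · intro a ha
        rw [← List.append_assoc, List.getLast?_append, List.getLast?_singleton, Option.some_or,
          Option.some_inj] at ha
        rw [← ha, hkv, lcp_self, PTree.length_half, hflen]; rfl
  · simp only [Cond.holds, Expr.eval_var, Expr.eval_num, not_not] at hh
    rw [hh] at hch
    have := hch.eq_nil fun h => by have := hr 0 (by simp [h]); omega
    subst this
    simp only [List.append_nil] at *
    exact ⟨hE, hmm, hclk⟩

/-- The pieces are listed in preorder of their nodes, hence in lexicographic order. The variable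
`mm` keeps the longest common prefix of the last piece and the string of the current node: the
minimum of those of the adjacent nodes passed since the last piece, each of which is the length of
the latter node's string minus one. -/
theorem run_emit {s : Store} {P C : Arr} {root last b : ℕ} {ks O : List ℕ}
    (hPC : P = .oddL ∧ C = .oddC ∨ P = .evenL ∧ C = .evenC)
    (hD : Dims W M x.length y.length A) (hs : TreeState M x y A pos s)
    (hroot : root < W) (hlast : last < W) (hO2 : last ∉ O)
    (hc : Chain (s.a .pre) last root O) (hO : IsPreorder (treeOf s pos) (s.a .str) b O)
    (hks : ∀ k ∈ ks, 2 ≤ k ∧ k < 2 * (x.length + y.length + 2)) (hnd : ks.Nodup)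
    (hlen : ks.length ≤ 2 * (x.length + y.length))
    (hch : ∀ v, Chain (s.a .pnx) 0 (s.a .head v) (ks.filter (s.a .nd · = v)).reverse) :
    Run W M (emit root last P C) s (fun s' => ∃ K, Emitted (treeOf s pos) (s.a .str) (s.a .nd)
        x.length P C K s' ∧ K.Nodup ∧
      (∀ k, k ∈ K ↔ k ∈ ks ∧ (treeOf s pos).lam (s.a .nd k) % 2 = b) ∧
      (K.Pairwise fun k l => (treeOf s pos).half (s.a .str) (s.a .nd k) ≤
        (treeOf s pos).half (s.a .str) (s.a .nd l)) ∧
      s'.clk ≤ s.clk + (3 * (x.length + y.length) + 5)) := by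
  have h1 := hD.len_le
  have h3 := hD.le
  have hcnt := hs.cnt_le
  have p1 : Arr.lam ≠ P := by rcases hPC with h | h <;> simp [h.1]
  have p2 : Arr.lam ≠ C := by rcases hPC with h | h <;> simp [h.2]
  have p3 : Arr.pnx ≠ P := by rcases hPC with h | h <;> simp [h.1]
  have p4 : Arr.pnx ≠ C := by rcases hPC with h | h <;> simp [h.2]
  set T := treeOf s pos with hT
  set S := s.a .str with hS
  set nd := s.a .nd with hndd
  -- the centers of the pieces of a node, in the order of its list
  set g : ℕ → List ℕ := fun v => (ks.filter (nd · = v)).reverse with hg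
  have hgm : ∀ v k, k ∈ g v ↔ k ∈ ks ∧ nd k = v := fun v k => by simp [hg]
  have hmono : O.Pairwise fun u v => T.half S u < T.half S v := by
    have hch := hO.next.imp (S := fun u v => T.half S u < T.half S v) fun _ _ h => h.2
    have : Trans (fun u v : ℕ => T.half S u < T.half S v) (fun u v => T.half S u < T.half S v)
      (fun u v => T.half S u < T.half S v) := ⟨fun h h' => lt_trans h h'⟩
    exact List.isChain_iff_pairwise.1 hch
  have hall : ∀ l : List ℕ, l.Nodup → (l.flatMap g).Nodup := fun l hl => by
    rw [List.nodup_flatMap]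
    refine ⟨fun v _ => List.nodup_reverse.2 (hnd.filter _), hl.imp fun {u v} huv k hu hv => ?_⟩
    rw [hgm] at hu hv
    exact huv (hu.2.symm.trans hv.2)
  have hsub : ∀ l : List ℕ, l.Nodup → (l.flatMap g).length ≤ 2 * (x.length + y.length) := by
    intro l hl
    refine le_trans (List.Subperm.length_le ((List.subperm_of_subset (hall l hl))
      fun k hk => ?_)) hlen
    obtain ⟨v, -, hk⟩ := List.mem_flatMap.1 hk
    exact ((hgm v k).1 hk).1
  have hOlen : O.length ≤ x.length + y.length + 5 := by
    have : O.length ≤ (List.range' 1 (s.v .cnt - 1)).length :=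
      List.Subperm.length_le (List.subperm_of_subset hO.nodup fun v hv => by
        have : 1 ≤ v ∧ v < s.v .cnt := ⟨((hO.mem v).1 hv).1, ((hO.mem v).1 hv).2.1⟩
        rw [List.mem_range'_1]; omega)
    simp at this; omega
  unfold emit
  refine run_seq (run_set (by simpa) (run_seq (run_set (by simp; omega)
    (run_seq (run_set (by simp; omega) ?_)))))
  refine run_loop (fun s1 => ∃ d r, O = d ++ r ∧ Chain (s1.a .pre) last (s1.v .v) r ∧
    Emitted T S nd x.length P C (d.flatMap g) s1 ∧
    (∀ v, r.head? = some v → LastLcp T S nd (d.flatMap g) (T.half S v) (s1.v .mm)) ∧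
    s1.clk = s.clk + d.length + (d.flatMap g).length)
    (fun s1 => s.clk + O.length + (O.flatMap g).length - s1.clk)
    ⟨[], O, rfl, by simpa using hc, ⟨by simp, fun i hi => by simp [encode] at hi, by simp⟩,
      fun v _ a ha => by simp at ha, by simp⟩ ?_
  rintro s1 hf ⟨d, r, rfl, hch1, hE, hmm, hclk⟩
  have hs1 : TreeState M x y A pos s1 :=
    (((hs.set .v _ rfl).set .pos _ rfl).set .mm _ rfl).frame hf rfl rfl
      (by rcases hPC with ⟨rfl, rfl⟩ | ⟨rfl, rfl⟩ <;> rfl)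
  refine ⟨by simpa using hlast, fun hh => ?_, fun hh => ?_⟩
  · simp only [Cond.holds, Expr.eval_var, Expr.eval_lit] at hh
    obtain ⟨r, rfl, htail⟩ := hch1.exists_cons hh
    generalize hv : s1.v .v = v at *
    obtain ⟨hv1, hvc, hvb⟩ := (hO.mem v).1 (by simp)
    have hvc : v < s.v .cnt := hvc
    have hhead : s1.a .head = s.a .head := hf.a .head (by
      rcases hPC with ⟨rfl, rfl⟩ | ⟨rfl, rfl⟩ <;> rfl)
    have hpnx : s1.a .pnx = s.a .pnx := hf.a .pnx (by
      rcases hPC with ⟨rfl, rfl⟩ | ⟨rfl, rfl⟩ <;> rfl)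
    have hnd1 : s1.a .nd = s.a .nd := hf.a .nd (by
      rcases hPC with ⟨rfl, rfl⟩ | ⟨rfl, rfl⟩ <;> rfl)
    have hstr1 : s1.a .str = s.a .str := hf.a .str (by
      rcases hPC with ⟨rfl, rfl⟩ | ⟨rfl, rfl⟩ <;> rfl)
    have hlam1 : s1.a .lam = s.a .lam := hf.a .lam (by
      rcases hPC with ⟨rfl, rfl⟩ | ⟨rfl, rfl⟩ <;> rfl)
    have hcnt1 : s1.v .cnt = s.v .cnt := by rw [hf.v .cnt rfl]; simp
    have hT1 : treeOf s1 pos = T := treeOf_congr hcnt1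
      (hf.a .par (by rcases hPC with ⟨rfl, rfl⟩ | ⟨rfl, rfl⟩ <;> rfl))
      (hf.a .ltr (by rcases hPC with ⟨rfl, rfl⟩ | ⟨rfl, rfl⟩ <;> rfl)) hlam1
      (hf.a .lnk (by rcases hPC with ⟨rfl, rfl⟩ | ⟨rfl, rfl⟩ <;> rfl))
      (hf.a .tab (by rcases hPC with ⟨rfl, rfl⟩ | ⟨rfl, rfl⟩ <;> rfl))
    have hgv : (s1.a .head v) = s.a .head v := by rw [hhead]
    have hsplit : (d ++ v :: r).flatMap g = (d ++ [v]).flatMap g ++ r.flatMap g := by simp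
    have hsplit' : (d ++ [v]).flatMap g = d.flatMap g ++ g v := by simp
    have hlenK := hsub _ hO.nodup
    rw [hsplit, hsplit', List.length_append, List.length_append] at hlenK
    refine run_seq (run_set (by simp [hv, hs1.consts.vM]; omega) ?_)
    simp only [Expr.eval_get, Expr.eval_var, hv, hgv]
    refine run_seq ((run_emitNode (K := d.flatMap g) (r := g v) (v := v) (T := T) (S := S)
      (nd := nd) (pos := pos) hPC hD ((hs1.set .k _ rfl).tick _) hT1 hstr1 hnd1 (by simpa using hv)
      (by simpa [hcnt1] using hvc) (by simpa [hpnx] using hch v) (fun k hk => ?_) (by omega)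
      ⟨by simpa using hE.pos, hE.pieces, hE.lcp⟩ (by simpa using hmm v rfl)).frame
      fun s2 hf2 _ ⟨q1, q2, q3⟩ => ?_)
    · rw [hgm] at hk
      have := hks k hk.1
      exact ⟨by omega, by omega, hk.2⟩
    · have hpre2 : s2.a .pre = s1.a .pre := hf2.a .pre (by
        rcases hPC with ⟨rfl, rfl⟩ | ⟨rfl, rfl⟩ <;> rfl)
      have hlam2 : s2.a .lam = s.a .lam := (hf2.a .lam (by
        rcases hPC with ⟨rfl, rfl⟩ | ⟨rfl, rfl⟩ <;> rfl)).trans hlam1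
      have hv2 : s2.v .v = v := (hf2.v .v rfl).trans (by simpa using hv)
      have hM2 : s2.v .M = M := (hf2.v .M rfl).trans (by simpa using hs1.consts.vM)
      rw [← hsplit'] at q1 q2
      refine run_seq (run_set (by simp [hv2, hM2]; omega) ?_)
      simp only [Expr.eval_get, Expr.eval_var, hv2, hpre2]
      have hclk3 : s2.clk = s.clk + (d ++ [v]).length + ((d ++ [v]).flatMap g).length := by
        rw [hsplit', List.length_append, List.length_append, List.length_singleton]
        simp only at q3
        omega
      have hvar : s.clk + (d ++ v :: r).length + ((d ++ v :: r).flatMap g).length - s2.clk <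
          s.clk + (d ++ v :: r).length + ((d ++ v :: r).flatMap g).length - s1.clk := by
        rw [hclk3, hclk, hsplit, hsplit']
        simp only [List.length_append, List.length_cons, List.length_nil]
        omega
      have fin : ∀ s3 : Store, s3.a = s2.a → s3.v .v = s1.a .pre v → s3.v .pos = s2.v .pos →
          s3.clk = s2.clk → (∀ z, r.head? = some z →
            LastLcp T S nd ((d ++ [v]).flatMap g) (T.half S z) (s3.v .mm)) →
          (∃ d_1 r_1, d ++ v :: r = d_1 ++ r_1 ∧ Chain (s3.a .pre) last (s3.v .v) r_1 ∧
            Emitted T S nd x.length P C (d_1.flatMap g) s3 ∧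
            (∀ z, r_1.head? = some z →
              LastLcp T S nd (d_1.flatMap g) (T.half S z) (s3.v .mm)) ∧
            s3.clk = s.clk + d_1.length + (d_1.flatMap g).length) ∧
          s.clk + (d ++ v :: r).length + ((d ++ v :: r).flatMap g).length - s3.clk <
            s.clk + (d ++ v :: r).length + ((d ++ v :: r).flatMap g).length - s1.clk := by
        intro s3 e1 e2 e3 e4 h
        refine ⟨⟨d ++ [v], r, by simp, by rw [e1, e2, hpre2]; exact htail,
          ⟨by rw [e3]; exact q1.pos, by rw [e1]; exact q1.pieces, by rw [e1]; exact q1.lcp⟩, h,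
          by rw [e4]; exact hclk3⟩, by rw [e4]; exact hvar⟩
      refine run_ite (by simpa using hlast) (fun h => run_skip ?_) (fun h => ?_)
      · simp only [Cond.holds, Expr.eval_var, Expr.eval_lit, Function.update_self] at h
        refine fin _ rfl (by simp) (by simp) rfl fun z hz => ?_
        rw [h] at htail
        rw [htail.eq_nil fun h => hO2 (by simp [h])] at hz
        simp at hz
      · simp only [Cond.holds, Expr.eval_var, Expr.eval_lit, Function.update_self] at h
        obtain ⟨r', rfl, -⟩ := htail.exists_cons h
        generalize hz : s1.a .pre v = z at *
        have hzc : z < s.v .cnt := ((hO.mem z).1 (by simp)).2.1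
        have hnext : NextInPreorder (T.half S v) (T.half S z) := by
          have := (List.isChain_append.1 hO.next).2.1
          exact (List.isChain_cons_cons.1 this).1
        have hlenz : (T.half S z).length = s.a .lam z / 2 := T.length_half S z
        have hstep : ∀ a, ((d ++ [v]).flatMap g).getLast? = some a →
            lcp (T.half S (nd a)) (T.half S z) = min (s2.v .mm) (s.a .lam z / 2 - 1) := by
          intro a ha
          have ham := List.mem_of_getLast? ha
          obtain ⟨u, hu, hau⟩ := List.mem_flatMap.1 ham
          rw [hgm] at hau
          have hle : T.half S (nd a) ≤ T.half S v := by
            rw [hau.2]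
            rcases List.mem_append.1 hu with hu | hu
            · exact ((List.pairwise_append.1 hmono).2.2 u hu v (by simp)).le
            · rw [List.mem_singleton.1 hu]
          rw [lcp_of_sorted hle hnext.2.le, ← q2 a ha]
          have := hnext.1
          rw [hlenz] at this
          congr 1; omega
        refine run_ite (by simp [hM2]; omega) (fun h => run_skip ?_) (fun h => run_set ?_ ?_)
        · simp [hlam2] at h
          refine fin _ rfl (by simp) (by simp) rfl fun w hw a ha => ?_
          simp only [List.head?_cons, Option.some_inj] at hw
          rw [← hw, hstep a ha]
          simp; omega
        · have := hnext.1
          simp [hM2, hlam2]; omega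
        · simp [hlam2] at h
          refine fin _ rfl (by simp) (by simp) rfl fun w hw a ha => ?_
          simp only [List.head?_cons, Option.some_inj] at hw
          rw [← hw, hstep a ha]
          simp [hlam2]; omega
  · simp only [Cond.holds, Expr.eval_var, Expr.eval_lit, not_not] at hh
    rw [hh] at hch1
    have := hch1.eq_nil fun h => hO2 (by simp [h])
    subst this
    simp only [List.append_nil] at *
    refine ⟨_, hE, hall d hO.nodup, fun k => ?_, ?_, ?_⟩
    · rw [List.mem_flatMap]
      constructor
      · rintro ⟨v, hv, hk⟩
        rw [hgm] at hk
        exact ⟨hk.1, by rw [hk.2]; exact ((hO.mem v).1 hv).2.2⟩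
      · rintro ⟨hk, hb⟩
        have := hs.node (q := k) (by have := hks k hk; omega) (hks k hk).2
        exact ⟨nd k, (hO.mem _).2 ⟨this.1, this.2, hb⟩, (hgm _ _).2 ⟨hk, rfl⟩⟩
    · rw [List.pairwise_flatMap]
      refine ⟨fun v _ => ?_, hmono.imp fun {u v} huv k hk l hl => ?_⟩
      · refine List.pairwise_of_forall_mem_list fun k hk l hl => ?_
        rw [hgm] at hk hl
        rw [hk.2, hl.2]
      · rw [hgm] at hk hl
        rw [hk.2, hl.2]; exact huv.le
    · have := hsub d hO.nodup
      omega

end Prog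
end Palcf

namespace Palcf

/-! ### The sorted lists produced by the program -/

/-- The centers, in the text `0 x (A + 1) y (A + 2)`, of the pieces of `x` and `y`, where `n` and
`m` are the lengths of `x` and `y`. -/
def centers (n m : ℕ) : List ℕ :=
  List.range' 2 (max 2 (2 * n + 1) - 2) ++
    List.range' (2 * n + 4) (max (2 * n + 4) (2 * n + 2 * m + 3) - (2 * n + 4))

/-- The center `k'` of a string with offset `off` in the text is `k' + 2 * off`; the offsets are `1`
and `n + 2`. -/
theorem mem_centers {n m k : ℕ} : k ∈ centers n m ↔
    (∃ k', k = k' + 2 * 1 ∧ k' + 1 < 2 * n) ∨ ∃ k', k = k' + 2 * (n + 2) ∧ k' + 1 < 2 * m := by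
  rw [centers, List.mem_append, List.mem_range'_1, List.mem_range'_1]
  constructor
  · rintro (h | h)
    · exact Or.inl ⟨k - 2, by omega, by omega⟩
    · exact Or.inr ⟨k - 2 * (n + 2), by omega, by omega⟩
  · rintro (⟨k', h1, h2⟩ | ⟨k', h1, h2⟩)
    · left; omega
    · right; omega

theorem nodup_centers (n m : ℕ) : (centers n m).Nodup := by
  rw [centers, List.nodup_append]
  refine ⟨List.nodup_range', List.nodup_range', fun a ha b hb => ?_⟩
  rw [List.mem_range'_1] at ha hb
  omega

section
variable {M A : ℕ} {x y : List ℕ} {pos : ℕ → ℕ} {s : Store}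

theorem TreeState.piece_left (hs : TreeState M x y A pos s) {k : ℕ} (hk : k + 1 < 2 * x.length) :
    pieceAt x.length (s.a .lam) (s.a .nd) (k + 2 * 1) = ⟨0, (k + 1) / 2, (maxPalLen x k + 1) / 2⟩ ∧
    (pieceAt x.length (s.a .lam) (s.a .nd) (k + 2 * 1)).str x y =
      (treeOf s pos).half (s.a .str) (s.a .nd (k + 2 * 1)) := by
  have hm := hs.settled (k + 2 * 1) (by omega) (by omega)
  have h1 := hm.maxPalLen_eq hs.text.block_left hk
  have h2 := hm.factor_eq hs.valid hs.text.block_left hk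
  simp only [treeOf] at h1 h2
  have e : pieceAt x.length (s.a .lam) (s.a .nd) (k + 2 * 1) =
      ⟨0, (k + 1) / 2, s.a .lam (s.a .nd (k + 2 * 1)) / 2⟩ := by
    rw [pieceAt, if_pos (by omega), if_pos (by omega),
      show (k + 2 * 1 - 1) / 2 = (k + 1) / 2 by omega]
  refine ⟨by rw [e, h1.2, Nat.sub_add_cancel h1.1], ?_⟩
  rw [e]; exact h2

theorem TreeState.piece_right (hs : TreeState M x y A pos s) {k : ℕ} (hk : k + 1 < 2 * y.length) :
    pieceAt x.length (s.a .lam) (s.a .nd) (k + 2 * (x.length + 2)) =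
      ⟨1, (k + 1) / 2, (maxPalLen y k + 1) / 2⟩ ∧
    (pieceAt x.length (s.a .lam) (s.a .nd) (k + 2 * (x.length + 2))).str x y =
      (treeOf s pos).half (s.a .str) (s.a .nd (k + 2 * (x.length + 2))) := by
  have hm := hs.settled (k + 2 * (x.length + 2)) (by omega) (by omega)
  have h1 := hm.maxPalLen_eq hs.text.block_right hk
  have h2 := hm.factor_eq hs.valid hs.text.block_right hk
  simp only [treeOf] at h1 h2
  have e : pieceAt x.length (s.a .lam) (s.a .nd) (k + 2 * (x.length + 2)) =
      ⟨1, (k + 1) / 2, s.a .lam (s.a .nd (k + 2 * (x.length + 2))) / 2⟩ := by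
    rw [pieceAt, if_neg (by omega), if_neg (by omega),
      show (k + 2 * (x.length + 2) - 1) / 2 - (x.length + 1) = (k + 1) / 2 by omega]
  refine ⟨by rw [e, h1.2, Nat.sub_add_cancel h1.1], ?_⟩
  rw [e]; exact h2

/-- The string of a piece is the half of its node. -/
theorem TreeState.piece_str (hs : TreeState M x y A pos s) {k : ℕ}
    (hk : k ∈ centers x.length y.length) :
    (pieceAt x.length (s.a .lam) (s.a .nd) k).str x y =
      (treeOf s pos).half (s.a .str) (s.a .nd k) := by
  rcases mem_centers.1 hk with ⟨k, rfl, h⟩ | ⟨k, rfl, h⟩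
  · exact (hs.piece_left h).2
  · exact (hs.piece_right h).2

theorem TreeState.centers_lt {k : ℕ} (hk : k ∈ centers x.length y.length) :
    2 ≤ k ∧ k < 2 * (x.length + y.length + 2) := by
  rcases mem_centers.1 hk with ⟨k, rfl, hk⟩ | ⟨k, rfl, hk⟩ <;> omega

/-- The pieces of the centers of one parity. -/
theorem TreeState.perm_pieces (hs : TreeState M x y A pos s) {K : List ℕ} {pieces : List Piece}
    {b : ℕ} (hnd : K.Nodup)
    (hK : ∀ k, k ∈ K ↔ k ∈ centers x.length y.length ∧ s.a .lam (s.a .nd k) % 2 = b)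
    (hp : pieces.Nodup) (hmem : ∀ f, f ∈ pieces ↔
      (∃ k, k % 2 = b ∧ k + 1 < 2 * x.length ∧ f = ⟨0, (k + 1) / 2, (maxPalLen x k + 1) / 2⟩) ∨
      ∃ k, k % 2 = b ∧ k + 1 < 2 * y.length ∧ f = ⟨1, (k + 1) / 2, (maxPalLen y k + 1) / 2⟩) :
    (K.map (pieceAt x.length (s.a .lam) (s.a .nd))).Perm pieces := by
  have hpar : ∀ k ∈ centers x.length y.length, s.a .lam (s.a .nd k) % 2 = k % 2 := fun k hk => by
    have := TreeState.centers_lt hk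
    obtain ⟨j, h1, -, -⟩ := hs.settled k (by omega) this.2
    simp only [treeOf] at h1
    omega
  rw [List.perm_ext_iff_of_nodup (hnd.map_on fun k hk l hl hkl => ?_) hp]
  · intro f
    rw [hmem, List.mem_map]
    constructor
    · rintro ⟨k, hk, rfl⟩
      obtain ⟨hk, hb⟩ := (hK k).1 hk
      rw [hpar k hk] at hb
      rcases mem_centers.1 hk with ⟨k, rfl, h⟩ | ⟨k, rfl, h⟩
      · exact Or.inl ⟨k, by omega, h, (hs.piece_left h).1⟩
      · exact Or.inr ⟨k, by omega, h, (hs.piece_right h).1⟩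
    · rintro (⟨k, hb, hk, rfl⟩ | ⟨k, hb, hk, rfl⟩)
      · have hc := mem_centers.2 (Or.inl ⟨k, rfl, hk⟩ : _ ∨ ∃ k', _ = k' + 2 * (x.length + 2) ∧
          k' + 1 < 2 * y.length)
        exact ⟨_, (hK _).2 ⟨hc, by rw [hpar _ hc]; omega⟩, (hs.piece_left hk).1⟩
      · have hc := mem_centers.2 (Or.inr ⟨k, rfl, hk⟩ : (∃ k', _ = k' + 2 * 1 ∧
          k' + 1 < 2 * x.length) ∨ _)
        exact ⟨_, (hK _).2 ⟨hc, by rw [hpar _ hc]; omega⟩, (hs.piece_right hk).1⟩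
  · obtain ⟨hk, hb⟩ := (hK k).1 hk
    obtain ⟨hl, hb'⟩ := (hK l).1 hl
    rw [hpar _ hk] at hb
    rw [hpar _ hl] at hb'
    rcases mem_centers.1 hk with ⟨k, rfl, h1⟩ | ⟨k, rfl, h1⟩ <;>
      rcases mem_centers.1 hl with ⟨l, rfl, h2⟩ | ⟨l, rfl, h2⟩
    · rw [(hs.piece_left h1).1, (hs.piece_left h2).1, Piece.mk.injEq] at hkl; omega
    · rw [(hs.piece_left h1).1, (hs.piece_right h2).1, Piece.mk.injEq] at hkl; omega
    · rw [(hs.piece_right h1).1, (hs.piece_left h2).1, Piece.mk.injEq] at hkl; omega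
    · rw [(hs.piece_right h1).1, (hs.piece_right h2).1, Piece.mk.injEq] at hkl; omega

theorem nodup_oddPieces (x y : List ℕ) : (oddPieces 0 x ++ oddPieces 1 y).Nodup := by
  have h : ∀ src (z : List ℕ), (oddPieces src z).Nodup := fun src z =>
    List.nodup_range.map fun i j h => by simpa using congrArg Piece.start h
  refine List.nodup_append.2 ⟨h _ _, h _ _, fun f hf g hg => ?_⟩
  obtain ⟨_, -, -, rfl⟩ := mem_oddPieces.1 hf
  obtain ⟨_, -, -, rfl⟩ := mem_oddPieces.1 hg
  simp

theorem nodup_evenPieces (x y : List ℕ) : (evenPieces 0 x ++ evenPieces 1 y).Nodup := by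
  have h : ∀ src (z : List ℕ), (evenPieces src z).Nodup := fun src z =>
    List.nodup_range.map fun i j h => by simpa using congrArg Piece.start h
  refine List.nodup_append.2 ⟨h _ _, h _ _, fun f hf g hg => ?_⟩
  obtain ⟨_, -, -, rfl⟩ := mem_evenPieces.1 hf
  obtain ⟨_, -, -, rfl⟩ := mem_evenPieces.1 hg
  simp

/-- The arrays `P` and `C` hold a sorted list of `pieces` and the longest common prefixes. The first
word of `C` belongs to the first piece, which has no predecessor. -/
structure HoldsSorted (x y : List ℕ) (P C : Arr) (pieces L : List Piece) (s : Store) : Prop where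
  sorted : IsSortedListOf x y L pieces
  pieces : Holds (s.a P) (encode L)
  lcps : Holds (fun i => s.a C (i + 1)) (lcps x y L)

theorem TreeState.holdsSorted (hs : TreeState M x y A pos s) {K : List ℕ} {pieces : List Piece}
    {P C : Arr} {s' : Store}
    (hK : Emitted (treeOf s pos) (s.a .str) (s.a .nd) x.length P C K s')
    (hc : ∀ k ∈ K, k ∈ centers x.length y.length)
    (hsort : K.Pairwise fun k l => (treeOf s pos).half (s.a .str) (s.a .nd k) ≤
        (treeOf s pos).half (s.a .str) (s.a .nd l))
    (hp : (K.map (pieceAt x.length (s.a .lam) (s.a .nd))).Perm pieces) :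
    HoldsSorted x y P C pieces (K.map (pieceAt x.length (s.a .lam) (s.a .nd))) s' := by
  refine ⟨⟨hp, ?_⟩, hK.pieces, fun i hi => ?_⟩
  · rw [List.pairwise_map]
    refine hsort.imp_of_mem fun hk hl h => ?_
    rw [hs.piece_str (hc _ hk), hs.piece_str (hc _ hl)]
    exact h
  · have hi' : i + 1 < K.length := by
      simp [Palcf.lcps] at hi; omega
    have e1 : K[i]? = some K[i] := List.getElem?_eq_getElem (by omega)
    have e2 : K[i + 1]? = some K[i + 1] := List.getElem?_eq_getElem hi'
    simp only [Palcf.lcps, List.getElem_zipWith, List.getElem_map, List.getElem_tail]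
    rw [hs.piece_str (hc _ (List.getElem_mem _)), hs.piece_str (hc _ (List.getElem_mem _))]
    exact hK.lcp i _ _ e1 e2

end

theorem treeOf_frame {c : Cmd} {s s' : Store} {pos : ℕ → ℕ} (hf : c.Frame s s')
    (hc : c.writesV .cnt = false)
    (ha : (c.writesA .lam || c.writesA .lnk || c.writesA .par || c.writesA .ltr ||
      c.writesA .tab) = false) : treeOf s' pos = treeOf s pos := by
  simp only [Bool.or_eq_false_iff] at ha
  exact treeOf_congr (hf.v _ hc) (hf.a _ ha.1.1.2) (hf.a _ ha.1.2) (hf.a _ ha.1.1.1.1)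
    (hf.a _ ha.1.1.1.2) (hf.a _ ha.2)

namespace Prog
open Cmd

variable {W M A : ℕ} {x y : List ℕ} {pos : ℕ → ℕ}

/-- The nodes are sorted in `e + 1` passes of radix sort, and the other loops run through the nodes
or the centers once. -/
theorem run_step3 {s : Store} {e : ℕ} (hD : Dims W M x.length y.length A)
    (hs : TreeState M x y A pos s) (hbk : ∀ i, s.a .bk i = 0) (hpre : ∀ i, s.a .pre i = 0)
    (hhead : ∀ i, s.a .head i = 0) (he : A + 3 ≤ (x.length + y.length + 8) ^ e) :
    Run W M step3 s (fun s' => ∃ oddL evenL,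
      HoldsSorted x y .oddL .oddC (oddPieces 0 x ++ oddPieces 1 y) oddL s' ∧
      HoldsSorted x y .evenL .evenC (evenPieces 0 x ++ evenPieces 1 y) evenL s' ∧
      s'.v .pos = evenL.length ∧ s'.v .out0 = Arr.oddL.idx * M ∧ s'.v .out1 = Arr.evenL.idx * M ∧
      s'.clk ≤ s.clk + (e + 5) * (4 * (x.length + y.length + 8))) := by
  have h1 := hD.len_le
  have h3 := hD.le
  unfold step3
  refine run_seq ((run_sortNodes hD hs hbk he).frame fun s1 f1 _ ⟨l, c1, pl, sl, k1⟩ => ?_)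
  have hs1 := hs.frame f1 rfl rfl rfl
  refine run_seq ((run_preorder hD hs1 (fun i => by rw [f1.a .pre rfl]; exact hpre i) c1
    (by rw [f1.v .cnt rfl]; exact pl) (by rw [f1.a .par rfl, f1.a .ltr rfl]; exact sl)).frame
    fun s2 f2 _ ⟨O, E, cO, cE, pO, pE, k2⟩ => ?_)
  have hs2 := hs1.frame f2 rfl rfl rfl
  have hcl : (centers x.length y.length).length ≤ 2 * (x.length + y.length) := by
    simp [centers]; omega
  refine run_seq ((run_attach (lo := 2) (b := max 2 (2 * x.length + 1)) (ks := []) hD hs2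
    (by simp; omega) (by omega) (by omega) (by omega) (fun s1 h hk => ?_) (by simp)
    (fun v => by simp [Chain, f2.a .head rfl, f1.a .head rfl, hhead])).frame
    fun s3 f3 _ ⟨c3, k3⟩ => ?_)
  · simp [h.vn]; omega
  have hs3 := hs2.frame f3 rfl rfl rfl
  have hnd3 : s3.a .nd = s2.a .nd := f3.a .nd rfl
  refine run_seq ((run_attach (lo := 2 * x.length + 4)
    (b := max (2 * x.length + 4) (2 * x.length + 2 * y.length + 3))
    (ks := List.range' 2 (max 2 (2 * x.length + 1) - 2)) hD hs3
    (by simp [hs3.consts.vn]; omega) (by omega) (by omega) (by omega) (fun s1 h hk => ?_)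
    (fun k hk => by rw [List.mem_range'_1] at hk; omega)
    (fun v => by rw [hnd3]; exact c3 v)).frame
    fun s4 f4 _ ⟨c4, k4⟩ => ?_)
  · simp [h.vn, h.vm]; omega
  have hs4 := hs3.frame f4 rfl rfl rfl
  have hnd4 : s4.a .nd = s3.a .nd := f4.a .nd rfl
  have hT4 : treeOf s4 pos = treeOf s1 pos := by
    rw [treeOf_frame f4 rfl rfl, treeOf_frame f3 rfl rfl, treeOf_frame f2 rfl rfl]
  have hS4 : s4.a .str = s1.a .str := by
    rw [f4.a .str rfl, f3.a .str rfl, f2.a .str rfl]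
  have hpre4 : s4.a .pre = s2.a .pre := by rw [f4.a .pre rfl, f3.a .pre rfl]
  rw [← hT4, ← hS4] at pO pE
  rw [← hpre4] at cO cE
  rw [← hnd4] at c4
  have hl2 : (treeOf s4 pos).lam 2 = 1 := hs4.valid.lam2
  refine run_seq ((run_emit (P := .oddL) (C := .oddC) (b := 0) (ks := centers x.length y.length)
    (Or.inl ⟨rfl, rfl⟩) hD hs4 (by omega) (by omega)
    (fun h => by have := (pO.mem 2).1 h; omega) cO pO
    (fun k hk => TreeState.centers_lt hk) (nodup_centers _ _) hcl c4).frame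
    fun s5 f5 _ ⟨K5, E5, n5, m5, w5, k5⟩ => ?_)
  have hs5 := hs4.frame f5 rfl rfl rfl
  have hT5 : treeOf s5 pos = treeOf s4 pos := treeOf_frame f5 rfl rfl
  have hS5 : s5.a .str = s4.a .str := f5.a .str rfl
  have hnd5 : s5.a .nd = s4.a .nd := f5.a .nd rfl
  refine run_seq ((run_emit (P := .evenL) (C := .evenC) (b := 1) (ks := centers x.length y.length)
    (Or.inr ⟨rfl, rfl⟩) hD hs5 (by omega) (by omega)
    (fun h => by have := (pE.mem 0).1 h; omega) (by rw [f5.a .pre rfl]; exact cE)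
    (by rw [hT5, hS5]; exact pE)
    (fun k hk => TreeState.centers_lt hk) (nodup_centers _ _) hcl
    (fun v => by rw [f5.a .pnx rfl, f5.a .head rfl, hnd5]; exact c4 v)).frame
    fun s6 f6 _ ⟨K6, E6, n6, m6, w6, k6⟩ => ?_)
  have hs6 := hs5.frame f6 rfl rfl rfl
  have hM := hs6.consts.vM
  have i1 : Arr.oddL.idx * M ≤ 31 * M := Nat.mul_le_mul_right _ (by decide)
  have i2 : Arr.evenL.idx * M ≤ 31 * M := Nat.mul_le_mul_right _ (by decide)
  have i3 := Arr.oddL.idx_lt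
  have i4 := Arr.evenL.idx_lt
  refine run_seq (run_set (by simp [hM]; omega) (run_set (by simp [hM]; omega) ?_))
  have g5 := hs4.holdsSorted E5 (fun k hk => ((m5 k).1 hk).1) w5
    (hs4.perm_pieces n5 m5 (nodup_oddPieces x y) fun f => by
      rw [List.mem_append, mem_oddPieces, mem_oddPieces])
  have g6 := hs5.holdsSorted E6 (fun k hk => ((m6 k).1 hk).1) w6
    (hs5.perm_pieces n6 m6 (nodup_evenPieces x y) fun f => by
      rw [List.mem_append, mem_evenPieces, mem_evenPieces])
  refine ⟨_, _, ⟨g5.sorted, ?_, ?_⟩, ⟨g6.sorted, g6.pieces, g6.lcps⟩, by simp [E6.pos],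
    by simp [hM], by simp [hM], ?_⟩
  · show Holds (s6.a .oddL) _
    rw [f6.a .oddL rfl]; exact g5.pieces
  · show Holds (fun i => s6.a .oddC (i + 1)) _
    rw [f6.a .oddC rfl]; exact g5.lcps
  · show s6.clk ≤ _
    have : (e + 5) * (4 * (x.length + y.length + 8)) =
      (e + 2) * (4 * (x.length + y.length + 8)) + 3 * (4 * (x.length + y.length + 8)) := by ring
    omega

end Prog
end Palcf

namespace Palcf

/-! ### The maximal common prefix of pieces of different strings -/

theorem maxCrossLcp_le (x y : List ℕ) (L : List Piece) : maxCrossLcp x y L ≤ x.length := by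
  by_cases h : maxCrossLcp x y L = 0
  · omega
  · obtain ⟨f, -, g, -, hf, -, he⟩ := maxCrossLcp_attained h
    rw [← he]
    refine (lcp_le_left _ _).trans ?_
    rw [Piece.str, if_pos hf]
    exact (factor_infix x f.start f.len).length_le

/-- In a sorted list, the maximum over the consecutive pieces of different strings is the maximum
over all pairs of pieces of different strings. -/
theorem eq_maxCrossLcp {x y : List ℕ} {L : List Piece} {b : ℕ}
    (hs : L.Pairwise fun f g => f.str x y ≤ g.str x y) (hsrc : ∀ f ∈ L, f.src ≤ 1)
    (h1 : ∀ i f g, L[i]? = some f → L[i + 1]? = some g → f.src ≠ g.src →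
      lcp (f.str x y) (g.str x y) ≤ b)
    (h2 : b = 0 ∨ ∃ i f g, L[i]? = some f ∧ L[i + 1]? = some g ∧ f.src ≠ g.src ∧
      lcp (f.str x y) (g.str x y) = b) : b = maxCrossLcp x y L := by
  have hle : ∀ (i j : ℕ) (f g : Piece), i < j → L[i]? = some f → L[j]? = some g →
      Piece.str x y f ≤ Piece.str x y g := by
    intro i j f g hij hf hg
    obtain ⟨hi, rfl⟩ := List.getElem?_eq_some_iff.1 hf
    obtain ⟨hj, rfl⟩ := List.getElem?_eq_some_iff.1 hg
    exact List.pairwise_iff_getElem.1 hs i j hi hj hij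
  -- between two pieces of different strings there are consecutive ones
  have hall : ∀ (d i : ℕ) (f g : Piece), L[i]? = some f → L[i + d]? = some g → f.src ≠ g.src →
      lcp (f.str x y) (g.str x y) ≤ b := by
    intro d
    induction d with
    | zero =>
      intro i f g hf hg hne
      rw [Nat.add_zero, hf, Option.some_inj] at hg
      exact absurd (by rw [hg]) hne
    | succ d ih =>
      intro i f g hf hg hne
      rcases Nat.eq_zero_or_pos d with rfl | hd
      · exact h1 i f g hf hg hne
      have hlt := (List.getElem?_eq_some_iff.1 hg).1
      have hh : L[i + 1]? = some L[i + 1] := List.getElem?_eq_getElem (by omega)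
      generalize L[i + 1] = h at hh
      rw [lcp_of_sorted (hle i (i + 1) f h (by omega) hf hh)
        (hle (i + 1) (i + (d + 1)) h g (by omega) hh hg)]
      by_cases hfh : f.src = h.src
      · refine (min_le_right _ _).trans (ih (i + 1) h g hh ?_ (hfh ▸ hne))
        rw [← hg]; congr 1; omega
      · exact (min_le_left _ _).trans (h1 i f h hf hh hfh)
  refine le_antisymm ?_ ?_
  · rcases h2 with h | ⟨i, f, g, hf, hg, hne, he⟩
    · omega
    · have mf := List.mem_of_getElem? hf
      have mg := List.mem_of_getElem? hg
      have := hsrc f mf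
      have := hsrc g mg
      rw [← he]
      rcases Nat.eq_zero_or_pos f.src with h0 | h0
      · exact le_maxCrossLcp mf mg h0 (by omega)
      · rw [lcp_comm]
        exact le_maxCrossLcp mg mf (by omega) (by omega)
  · by_cases h : maxCrossLcp x y L = 0
    · omega
    · obtain ⟨f, mf, g, mg, hf, hg, he⟩ := maxCrossLcp_attained h
      obtain ⟨i, hi⟩ := List.mem_iff_getElem?.1 mf
      obtain ⟨j, hj⟩ := List.mem_iff_getElem?.1 mg
      rw [← he]
      rcases Nat.le_total i j with hij | hij
      · exact hall (j - i) i f g hi (by rw [← hj]; congr 1; omega) (by omega)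
      · rw [lcp_comm]
        exact hall (i - j) j g f hj (by rw [← hi]; congr 1; omega) (by omega)

theorem encode_getElem? {L : List Piece} : ∀ {i : ℕ} {f : Piece}, L[i]? = some f →
    (encode L)[3 * i]? = some f.src := by
  induction L with
  | nil => intro i f h; simp at h
  | cons g L ih =>
    intro i f h
    have e : encode (g :: L) = g.src :: g.start :: g.len :: encode L := by simp [encode]
    cases i with
    | zero => rw [e]; simp at h; simp [h]
    | succ i =>
      rw [e, show 3 * (i + 1) = 3 * i + 3 by ring]
      simpa using ih (by simpa using h)

theorem Holds.getElem? {f : ℕ → ℕ} {l : List ℕ} {i a : ℕ} (h : Holds f l) (hi : l[i]? = some a) :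
    f i = a := by
  obtain ⟨hi', rfl⟩ := List.getElem?_eq_some_iff.1 hi
  exact h i hi'

theorem HoldsSorted.src {x y : List ℕ} {P C : Arr} {pieces L : List Piece} {s : Store}
    (h : HoldsSorted x y P C pieces L s) {i : ℕ} {f : Piece} (hf : L[i]? = some f) :
    s.a P (3 * i) = f.src := h.pieces.getElem? (encode_getElem? hf)

theorem HoldsSorted.lcp {x y : List ℕ} {P C : Arr} {pieces L : List Piece} {s : Store}
    (h : HoldsSorted x y P C pieces L s) {i : ℕ} {f g : Piece} (hf : L[i]? = some f)
    (hg : L[i + 1]? = some g) : s.a C (i + 1) = Palcf.lcp (f.str x y) (g.str x y) := by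
  refine h.lcps.getElem? ?_
  rw [Palcf.lcps, List.getElem?_zipWith, List.getElem?_tail, hf, hg]

namespace Prog
open Cmd

variable {W M A : ℕ} {x y : List ℕ} {pos : ℕ → ℕ}

theorem run_crossMax {s : Store} {b : Var} {P C : Arr} {lenE : Expr} {pieces L : List Piece}
    (hD : Dims W M x.length y.length A) (hM : s.v .M = M) (hb : b = .bo ∨ b = .be)
    (h : HoldsSorted x y P C pieces L s) (hsrc : ∀ f ∈ L, f.src ≤ 1)
    (hlen : L.length ≤ 2 * (x.length + y.length))
    (hl : ∀ s1 : Store, s1.v .N = s.v .N → s1.v .pos = s.v .pos →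
      lenE.ok W M s1 ∧ lenE.eval s1 = L.length) :
    Run W M (crossMax b P C lenE) s (fun s' => s'.v b = maxCrossLcp x y L ∧
      s'.clk ≤ s.clk + L.length) := by
  have h1 := hD.len_le
  have h3 := hD.le
  have b1 : b ≠ .i := by rcases hb with rfl | rfl <;> simp
  have b2 : b ≠ .M := by rcases hb with rfl | rfl <;> simp
  have b3 : b ≠ .N := by rcases hb with rfl | rfl <;> simp
  have b4 : b ≠ .pos := by rcases hb with rfl | rfl <;> simp
  unfold crossMax
  refine run_seq (run_set (by simp; omega) ?_)
  apply run_for (fun j s1 => s1.clk = s.clk + (j - 1) ∧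
    (∀ i f g, i + 1 < j → L[i]? = some f → L[i + 1]? = some g → f.src ≠ g.src →
      lcp (f.str x y) (g.str x y) ≤ s1.v b) ∧
    (s1.v b = 0 ∨ ∃ i f g, L[i]? = some f ∧ L[i + 1]? = some g ∧ f.src ≠ g.src ∧
      lcp (f.str x y) (g.str x y) = s1.v b)) 1 (max 1 L.length)
  · simp [writesV, b1]
  · simp; omega
  · simp
  · omega
  · omega
  · refine ⟨rfl, fun i f g hi => by omega, Or.inl ?_⟩
    simp [Function.update_of_ne b1]
  · intro j s1 hj _ hf hi hI
    clear hI
    have e1 : s1.v .N = s.v .N := by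
      rw [hf.v .N (by simp [for_, writesV, b3])]
      simp [Function.update_of_ne b3.symm]
    have e2 : s1.v .pos = s.v .pos := by
      rw [hf.v .pos (by simp [for_, writesV, b4])]
      simp [Function.update_of_ne b4.symm]
    have := hl s1 e1 e2
    simp [this, hi]; omega
  · intro j s1 hj hjl hf hi ⟨hclk, hall, hex⟩
    have hM1 : s1.v .M = M := by
      rw [hf.v .M (by simp [for_, writesV, b2])]
      simp [Function.update_of_ne b2.symm, hM]
    have hP : s1.a P = s.a P := hf.a P (by simp [for_, writesA])
    have hC : s1.a C = s.a C := hf.a C (by simp [for_, writesA])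
    obtain ⟨i, rfl⟩ : ∃ i, j = i + 1 := Nat.exists_eq_add_of_le' hj
    have hf1 : L[i]? = some L[i] := List.getElem?_eq_getElem (by omega)
    have hg1 : L[i + 1]? = some L[i + 1] := List.getElem?_eq_getElem (by omega)
    generalize L[i] = f at hf1
    generalize L[i + 1] = g at hg1
    have e1 := h.src hf1
    have e2 := h.src hg1
    have e3 := h.lcp hf1 hg1
    have hnew : ∀ i' f' g', i' + 1 < i + 1 + 1 → L[i']? = some f' → L[i' + 1]? = some g' →
        i' + 1 < i + 1 ∨ f' = f ∧ g' = g := by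
      intro i' f' g' hi' hf' hg'
      rcases Nat.lt_or_ge (i' + 1) (i + 1) with h | h
      · exact Or.inl h
      · obtain rfl : i' = i := by omega
        rw [hf1] at hf'
        rw [hg1] at hg'
        exact Or.inr ⟨(Option.some_inj.1 hf').symm, (Option.some_inj.1 hg').symm⟩
    have e4 : 3 * (i + 1) - 3 = 3 * i := by omega
    have hnum : 3 * (i + 1) < M ∧ i + 1 < M := by clear hall hex; omega
    have hclk' : s1.clk + 1 = s.clk + (i + 1 + 1 - 1) := by clear hall hex; omega
    refine run_ite (by simp [hi, hM1]; omega) (fun hh => run_skip ?_) (fun hh => run_ite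
      (by simp [hi, hM1]; omega) (fun hlt => run_set (by simp [hi, hM1]; omega) ?_)
      (fun hlt => run_skip ?_))
    · simp only [Cond.holds, Expr.eval_get, Expr.eval_mul, Expr.eval_sub, Expr.eval_num,
        Expr.eval_var, hi, hP, e1, e2, e4] at hh
      simp only [Function.update_of_ne b1]
      refine ⟨hclk', fun i' f' g' hi' hf' hg' hne => ?_, hex⟩
      rcases hnew i' f' g' hi' hf' hg' with h' | ⟨rfl, rfl⟩
      · exact hall i' f' g' h' hf' hg' hne
      · exact absurd hh.symm hne
    · simp only [Cond.holds, Expr.eval_get, Expr.eval_mul, Expr.eval_sub, Expr.eval_num,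
        Expr.eval_var, hi, hP, hC, e1, e2, e3, e4] at hh hlt
      simp only [Function.update_of_ne b1, Function.update_self, Expr.eval_get, Expr.eval_var, hi,
        hC, e3]
      refine ⟨hclk', fun i' f' g' hi' hf' hg' hne => ?_,
        Or.inr ⟨i, f, g, hf1, hg1, fun h => hh h.symm, rfl⟩⟩
      rcases hnew i' f' g' hi' hf' hg' with h' | ⟨rfl, rfl⟩
      · exact (hall i' f' g' h' hf' hg' hne).trans hlt.le
      · exact le_rfl
    · simp only [Cond.holds, Expr.eval_get, Expr.eval_mul, Expr.eval_sub, Expr.eval_num,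
        Expr.eval_var, hi, hP, hC, e1, e2, e3, e4, not_lt] at hh hlt
      simp only [Function.update_of_ne b1]
      refine ⟨hclk', fun i' f' g' hi' hf' hg' hne => ?_, hex⟩
      rcases hnew i' f' g' hi' hf' hg' with h' | ⟨rfl, rfl⟩
      · exact hall i' f' g' h' hf' hg' hne
      · exact hlt
  · intro s1 hf hi ⟨hclk, hall, hex⟩
    refine ⟨eq_maxCrossLcp h.sorted.2 hsrc (fun i f g hf hg hne => hall i f g ?_ hf hg hne) hex, ?_⟩
    · have := (List.getElem?_eq_some_iff.1 hg).1
      clear hall hex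
      omega
    · clear hall hex
      omega

/-- The doubled maximum of the odd list is decreased by one only if it is not `0`, in agreement with
truncated subtraction. -/
theorem run_step5 {s : Store} {oddL evenL : List Piece} (hD : Dims W M x.length y.length A)
    (hc : Consts M x.length y.length A s)
    (ho : HoldsSorted x y .oddL .oddC (oddPieces 0 x ++ oddPieces 1 y) oddL s)
    (he : HoldsSorted x y .evenL .evenC (evenPieces 0 x ++ evenPieces 1 y) evenL s)
    (hpos : s.v .pos = evenL.length) :
    Run W M step5 s (fun s' => s'.v .out0 =
        max (2 * maxCrossLcp x y oddL - 1) (2 * maxCrossLcp x y evenL) ∧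
      s'.clk ≤ s.clk + 2 * (x.length + y.length)) := by
  have h1 := hD.len_le
  have h3 := hD.le
  have b1 := maxCrossLcp_le x y oddL
  have b2 := maxCrossLcp_le x y evenL
  have l1 : oddL.length = x.length + y.length := by
    rw [ho.sorted.1.length_eq]; simp [oddPieces]
  have l2 : evenL.length ≤ x.length + y.length := by
    rw [he.sorted.1.length_eq]; simp [evenPieces]; omega
  have s1 : ∀ f ∈ oddL, f.src ≤ 1 := fun f hf => by
    have := ho.sorted.1.subset hf
    rw [List.mem_append, mem_oddPieces, mem_oddPieces] at this
    rcases this with ⟨_, -, -, rfl⟩ | ⟨_, -, -, rfl⟩ <;> simp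
  have s2 : ∀ f ∈ evenL, f.src ≤ 1 := fun f hf => by
    have := he.sorted.1.subset hf
    rw [List.mem_append, mem_evenPieces, mem_evenPieces] at this
    rcases this with ⟨_, -, -, rfl⟩ | ⟨_, -, -, rfl⟩ <;> simp
  unfold step5
  refine run_seq ((run_crossMax hD hc.vM (Or.inl rfl) ho s1 (by omega)
    (fun s1 h _ => ⟨by simp, by simp [h, hc.vN, l1]⟩)).frame fun t1 f1 _ ⟨r1, k1⟩ => ?_)
  refine run_seq ((run_crossMax (L := evenL) (pieces := evenPieces 0 x ++ evenPieces 1 y) hD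
    ((f1.v .M rfl).trans hc.vM) (Or.inr rfl)
    ⟨he.sorted, by rw [f1.a .evenL rfl]; exact he.pieces, by
      rw [f1.a .evenC rfl]; exact he.lcps⟩ s2 (by omega)
    (fun s1 _ h => ⟨by simp, by simp [h, f1.v .pos rfl, hpos]⟩)).frame
    fun t2 f2 _ ⟨r2, k2⟩ => ?_)
  have r1' : t2.v .bo = maxCrossLcp x y oddL := (f2.v .bo rfl).trans r1
  simp [r1', r2]
  omega

end Prog
end Palcf

namespace Palcf

/-! ### The word RAM program -/

/-- The store that the initial state of the machine represents. -/
def initStore (x y : List ℕ) : Store where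
  v := fun v => if v = .out0 then x.length else if v = .out1 then y.length else 0
  a := fun B i => if B = .inp then (x ++ y).getD i 0 else 0
  clk := 0

theorem initial_initStore (x y : List ℕ) : Prog.Initial x y (initStore x y) :=
  ⟨rfl, rfl, fun _ => rfl, fun _ hB _ => if_neg hB⟩

/-- The input array is the first one, so it starts at the address `0` of the input; all other arrays
are zero. -/
theorem represents_initState {w M : ℕ} {x y : List ℕ} (hM : x.length + y.length ≤ M)
    (hMw : M < 2 ^ w) (hl : ∀ a ∈ x ++ y, a < 2 ^ w) :
    Represents w M (initStore x y) (initState x y) := by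
  have hget : ∀ i, (x ++ y).getD i 0 < 2 ^ w := fun i => by
    rcases Nat.lt_or_ge i (x ++ y).length with h | h
    · rw [List.getD_eq_getElem _ _ h]; exact hl _ (List.getElem_mem h)
    · rw [List.getD_eq_default _ _ h]; omega
  refine ⟨fun v => by cases v <;> rfl, fun B i hi => ?_, fun v => ?_, fun B i _ => ?_⟩
  · by_cases hB : B = .inp
    · subst hB
      show (x ++ y).getD (0 * M + i) 0 = (x ++ y).getD i 0
      rw [Nat.zero_mul, Nat.zero_add]
    · have h1 : 1 ≤ B.idx := by
        by_contra h
        exact hB (Arr.idx_inj (show B.idx = Arr.inp.idx by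
          rw [show Arr.inp.idx = 0 from rfl]; omega))
      have h2 : 1 * M ≤ B.idx * M := Nat.mul_le_mul_right _ h1
      show (x ++ y).getD (B.idx * M + i) 0 = if B = .inp then _ else 0
      rw [if_neg hB, List.getD_eq_default _ _ (by simp; omega)]
  · simp only [initStore]
    split_ifs <;> omega
  · simp only [initStore]
    split_ifs
    · exact hget i
    · omega

/-- A variable that holds the address of the cell `d` of the array `B` points to the list stored
there. -/
theorem Represents.holdsArray {w M d : ℕ} {s : Store} {st : State} {v : Var} {B : Arr} {l : List ℕ}
    (h : Represents w M s st) (hM : 32 * M ≤ 2 ^ w) (hv : s.v v = B.idx * M + d)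
    (hl : Holds (fun i => s.a B (i + d)) l) (hlen : d + l.length ≤ M) :
    st.HoldsArray w v.idx l := by
  have h1 : (B.idx + 1) * M ≤ 32 * M := Nat.mul_le_mul_right _ B.idx_lt
  rw [Nat.add_mul] at h1
  refine ⟨by rw [h.reg, hv]; omega, fun i hi => ?_⟩
  rw [h.reg, hv, Nat.add_assoc, h.mem B _ (by omega), Nat.add_comm d]
  exact hl i hi

theorem maxLetter_le {c : ℕ} {x y : List ℕ} (h : OverPolyAlphabet c x y) :
    maxLetter x y ≤ (x.length + y.length) ^ c := by
  rcases foldr_max_mem (x ++ y) with h0 | h0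
  · rw [maxLetter, h0]; omega
  · exact (h _ h0).2

/-- The exponent covers all arrays: with `N = |x| + |y|` and largest letter `A ≤ N ^ c`, the `32`
arrays take `2 ^ 8 * (N + 8) * (A + 3)` cells, and `N + 8` and `A + 3` are at most `4 * (N + 2)` and
`4 * (N + 2) ^ c`. -/
theorem dims_of_le {c w : ℕ} {x y : List ℕ} (h : OverPolyAlphabet c x y)
    (hw : (x.length + y.length + 2) ^ (c + 13) ≤ 2 ^ w) :
    Dims (2 ^ w) (8 * ((x.length + y.length + 8) * (maxLetter x y + 3))) x.length y.length
      (maxLetter x y) := by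
  refine ⟨rfl, le_trans ?_ hw⟩
  have hA := maxLetter_le h
  generalize maxLetter x y = A at *
  generalize x.length + y.length = N at *
  have h1 : N ^ c ≤ (N + 2) ^ c := Nat.pow_le_pow_left (by omega) c
  have h0 : 1 ≤ (N + 2) ^ c := Nat.one_le_pow _ _ (by omega)
  have h2 : 2 ^ 8 ≤ (N + 2) ^ 8 := Nat.pow_le_pow_left (by omega) 8
  have h3 : 2 ^ 2 ≤ (N + 2) ^ 2 := Nat.pow_le_pow_left (by omega) 2
  calc 32 * (8 * ((N + 8) * (A + 3))) = 2 ^ 8 * ((N + 8) * (A + 3)) := by ring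
    _ ≤ (N + 2) ^ 8 * ((2 ^ 2 * (N + 2)) * (2 ^ 2 * (N + 2) ^ c)) :=
      Nat.mul_le_mul h2 (Nat.mul_le_mul (by omega) (by omega))
    _ ≤ (N + 2) ^ 8 * (((N + 2) ^ 2 * (N + 2)) * ((N + 2) ^ 2 * (N + 2) ^ c)) := by gcongr
    _ = (N + 2) ^ (c + 13) := by ring

/-- Letters have at most `c + 1` digits in base `|x| + |y| + 8`. -/
theorem maxLetter_digits {c : ℕ} {x y : List ℕ} (h : OverPolyAlphabet c x y) :
    maxLetter x y + 3 ≤ (x.length + y.length + 8) ^ (c + 1) := by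
  have hA := maxLetter_le h
  generalize maxLetter x y = A at *
  generalize x.length + y.length = N at *
  have h1 : N ^ c ≤ (N + 8) ^ c := Nat.pow_le_pow_left (by omega) c
  have h0 : 1 ≤ (N + 8) ^ c := Nat.one_le_pow _ _ (by omega)
  have h2 : (N + 8) ^ c * 4 ≤ (N + 8) ^ c * (N + 8) := Nat.mul_le_mul_left _ (by omega)
  rw [pow_succ]
  omega

namespace Prog

/-- The program for the word RAM. -/
def program : Program := main.code 0

/-- The commands run one after the other on the represented stores, so the machine passes through
the states that represent the stores between them. The factor `32 * c + 400` bounds the number of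
loop iterations and `main.size` the number of instructions between them. -/
theorem program_carriesOut {c w : ℕ} {x y : List ℕ} (h : OverPolyAlphabet c x y)
    (hw : (x.length + y.length + 2) ^ (c + 13) ≤ 2 ^ w) :
    ∃ E : Execution, E.IsLPalcf x y ∧ CarriesOut w program x y E
      (main.size * (32 * c + 400) * (x.length + y.length + 1)) := by
  have hD := dims_of_le h hw
  have he := maxLetter_digits h
  generalize hM : 8 * ((x.length + y.length + 8) * (maxLetter x y + 3)) = M at hD
  generalize hA : maxLetter x y = A at *
  have h1 := hD.len_le
  have h2 := hD.letter_le
  have h3 := hD.le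
  have hrep : Represents w M (initStore x y) (initState x y) :=
    represents_initState (by omega) (by omega) fun a ha => by
      have : a ≤ A := hA ▸ le_foldr_max ha
      omega
  obtain ⟨s1, x1, ⟨pos, T1⟩, a1, b1, c1, d1, k1⟩ := run_step1 (W := 2 ^ w) (M := M) (hA ▸ hD)
    (initial_initStore x y) fun a ha => (h a ha).1
  rw [hA] at T1
  obtain ⟨s2, x2, a2, b2, c2, d2, k2⟩ := run_step2 hD T1
  have T2 := T1.frame x2.frame rfl rfl rfl
  have hz : ∀ B, B ≠ .inp → step1.writesA B = false → step2.writesA B = false →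
      ∀ i, s2.a B i = 0 := fun B h0 e1 e2 i => by
    rw [x2.frame.a B e2, x1.frame.a B e1]; exact (initial_initStore x y).zero B h0 i
  obtain ⟨s3, x3, oddL, evenL, a3, b3, p3, c3, d3, k3⟩ := run_step3 hD T2
    (hz .bk (by simp) rfl rfl) (hz .pre (by simp) rfl rfl) (hz .head (by simp) rfl rfl) he
  have T3 := T2.frame x3.frame rfl rfl rfl
  have hM3 := T3.consts.vM
  have i1 : Arr.oddC.idx * M ≤ 31 * M := Nat.mul_le_mul_right _ (by decide)
  have i2 : Arr.evenC.idx * M ≤ 31 * M := Nat.mul_le_mul_right _ (by decide)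
  have i3 := Arr.oddC.idx_lt
  have i4 := Arr.evenC.idx_lt
  obtain ⟨s4, x4, c4, d4, a4, k4⟩ : Cmd.Run (2 ^ w) M step4 s3 fun s' =>
      s'.v .out0 = Arr.oddC.idx * M + 1 ∧ s'.v .out1 = Arr.evenC.idx * M + 1 ∧ s'.a = s3.a ∧
        s'.clk = s3.clk := by
    have hw0 : w ≠ 0 := by rintro rfl; omega
    simp [step4, hM3, hw0]; omega
  have T4 := T3.frame x4.frame rfl rfl rfl
  have a4' : HoldsSorted x y .oddL .oddC (oddPieces 0 x ++ oddPieces 1 y) oddL s4 :=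
    ⟨a3.sorted, by rw [a4]; exact a3.pieces, by rw [a4]; exact a3.lcps⟩
  have b4' : HoldsSorted x y .evenL .evenC (evenPieces 0 x ++ evenPieces 1 y) evenL s4 :=
    ⟨b3.sorted, by rw [a4]; exact b3.pieces, by rw [a4]; exact b3.lcps⟩
  obtain ⟨s5, x5, c5, k5⟩ := run_step5 hD T4.consts a4' b4' ((x4.frame.v .pos rfl).trans p3)
  -- the code of the five steps
  have hcode : CodeAt program 0 (main.code 0) := fun i hi => by
    rw [Nat.zero_add]; exact List.getElem?_eq_getElem hi
  have q1 := hcode.right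
  have q2 := q1.right
  have q3 := q2.right
  have q4 := q3.right
  simp only [Cmd.length_code, Nat.zero_add] at q1 q2 q3 q4
  obtain ⟨t1, n1, m1, e1, pc1, r1⟩ := x1.simulate h3 0 _ rfl hrep hcode.left
  obtain ⟨t2, n2, m2, e2, pc2, r2⟩ := x2.simulate h3 _ t1 pc1 r1 (by simpa using q1.left)
  obtain ⟨t3, n3, m3, e3, pc3, r3⟩ := x3.simulate h3 _ t2 pc2 r2 (by simpa using q2.left)
  obtain ⟨t4, n4, m4, e4, pc4, r4⟩ := x4.simulate h3 _ t3 pc3 r3 (by simpa using q3.left)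
  obtain ⟨t5, n5, m5, e5, pc5, r5⟩ := x5.simulate h3 _ t4 pc4 r4 (by simpa using q4)
  have g1 : stateAt w program x y n1 = t1 := e1
  have g2 : stateAt w program x y (n2 + n1) = t2 := by
    rw [stateAt, Function.iterate_add_apply, e1, e2]
  have g3 : stateAt w program x y (n3 + (n2 + n1)) = t3 := by
    rw [stateAt, Function.iterate_add_apply, ← stateAt, g2, e3]
  have g4 : stateAt w program x y (n4 + (n3 + (n2 + n1))) = t4 := by
    rw [stateAt, Function.iterate_add_apply, ← stateAt, g3, e4]
  have g5 : stateAt w program x y (n5 + (n4 + (n3 + (n2 + n1)))) = t5 := by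
    rw [stateAt, Function.iterate_add_apply, ← stateAt, g4, e5]
  have lo : oddL.length = x.length + y.length := by
    rw [a3.sorted.1.length_eq]; simp [oddPieces]
  have le : evenL.length ≤ x.length + y.length := by
    rw [b3.sorted.1.length_eq]; simp [evenPieces]; omega
  have llo := length_encode oddL
  have lle := length_encode evenL
  have lfo := length_encode (oddPieces 0 x ++ oddPieces 1 y)
  have lfe := length_encode (evenPieces 0 x ++ evenPieces 1 y)
  simp only [List.length_append, oddPieces, evenPieces, List.length_map, List.length_range]
    at lfo lfe
  refine ⟨⟨maxPals x, maxPals y, oddPieces 0 x ++ oddPieces 1 y,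
    evenPieces 0 x ++ evenPieces 1 y, oddL, evenL, lcps x y oddL, lcps x y evenL,
    max (2 * maxCrossLcp x y oddL - 1) (2 * maxCrossLcp x y evenL)⟩,
    ⟨rfl, rfl, rfl, rfl, a3.sorted, b3.sorted, rfl, rfl, rfl⟩,
    n1, n2 + n1, n3 + (n2 + n1), n4 + (n3 + (n2 + n1)), n5 + (n4 + (n3 + (n2 + n1))),
    by omega, by omega, by omega, by omega, ?_, ?_, ?_, ?_, ?_, ?_, ?_⟩
  · have z1 := x1.clk_le
    have z2 := x2.clk_le
    have z3 := x3.clk_le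
    have z5 := x5.clk_le
    have hsz : main.size = step1.size + (step2.size + (step3.size + (step4.size + step5.size))) :=
      rfl
    have hk : ∀ {n k d : ℕ}, n ≤ k * (d + 1) → k ≤ main.size → n ≤ main.size * (d + 1) :=
      fun hn hk => hn.trans (Nat.mul_le_mul_right _ hk)
    have hk1 := hk m1 (by omega)
    have hk2 := hk m2 (by omega)
    have hk3 := hk m3 (by omega)
    have hk4 := hk m4 (by omega)
    have hk5 := hk m5 (by omega)
    have hsum : n5 + (n4 + (n3 + (n2 + n1))) ≤ main.size * ((s1.clk - (initStore x y).clk + 1) +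
        (s2.clk - s1.clk + 1) + (s3.clk - s2.clk + 1) + (s4.clk - s3.clk + 1) +
        (s5.clk - s4.clk + 1)) := by
      simp only [Nat.mul_add] at hk1 hk2 hk3 hk4 hk5 ⊢
      omega
    refine hsum.trans ?_
    rw [Nat.mul_assoc]
    refine Nat.mul_le_mul_left _ ?_
    have hc8 : (c + 1 + 5) * (4 * (x.length + y.length + 8)) ≤
        (c + 1 + 5) * (32 * (x.length + y.length + 1)) := Nat.mul_le_mul_left _ (by omega)
    have hexp : (32 * c + 400) * (x.length + y.length + 1) =
      (c + 1 + 5) * (32 * (x.length + y.length + 1)) + 208 * (x.length + y.length + 1) := by ring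
    omega
  · rw [g1]
    exact ⟨r1.holdsArray (v := .out0) (d := 0) h3 c1 a1 (by simp [maxPals]; omega),
      r1.holdsArray (v := .out1) (d := 0) h3 d1 b1 (by simp [maxPals]; omega)⟩
  · rw [g2]
    exact ⟨r2.holdsArray (v := .out0) (d := 0) h3 c2 a2 (by simp only [oddPieces]; omega),
      r2.holdsArray (v := .out1) (d := 0) h3 d2 b2 (by simp only [evenPieces]; omega)⟩
  · rw [g3]
    exact ⟨r3.holdsArray (v := .out0) (d := 0) h3 c3 a3.pieces (by simp only; omega),
      r3.holdsArray (v := .out1) (d := 0) h3 d3 b3.pieces (by simp only; omega)⟩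
  · rw [g4]
    exact ⟨r4.holdsArray (v := .out0) (d := 1) h3 c4 a4'.lcps (by simp [lcps]; omega),
      r4.holdsArray (v := .out1) (d := 1) h3 d4 b4'.lcps (by simp [lcps]; omega)⟩
  · rw [g5]
    show program.length ≤ t5.pc
    rw [pc5, program, Cmd.length_code]
    show step1.size + (step2.size + (step3.size + (step4.size + step5.size))) ≤ _
    omega
  · rw [g5]
    exact (r5.reg .out0).trans c5

end Prog
end Palcf

theorem theorem3 :
    (∀ (x y : List ℕ) (E : Palcf.Execution), E.IsLPalcf x y → Palcf.IsLPALCF x y E.result) ∧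
    ∃ P : Palcf.Program, ∀ c : ℕ, ∃ K C : ℕ, ∀ (x y : List ℕ) (w : ℕ),
      Palcf.OverPolyAlphabet c x y → (x.length + y.length + 2) ^ K ≤ 2 ^ w →
      ∃ E : Palcf.Execution, E.IsLPalcf x y ∧ Palcf.IsLPALCF x y E.result ∧
        Palcf.CarriesOut w P x y E (C * (x.length + y.length + 1)) := by
  refine ⟨fun _ _ _ h => h.correct, Palcf.Prog.program, fun c =>
    ⟨c + 13, Palcf.Prog.main.size * (32 * c + 400), fun x y w h hw => ?_⟩⟩
  obtain ⟨E, hE, hC⟩ := Palcf.Prog.program_carriesOut h hw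
  exact ⟨E, hE, hE.correct, hC⟩
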